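/- Let $n\ge 1$ and let $M$ be a smooth manifold (possibly with boundary) of dimension $2n+1$. Let $\mathfrak g$ be a finite-dimensional real Lie algebra, let $\langle\cdots\rangle$ be a symmetric $\mathbb R$-multilinear map $\mathfrak g^{n+1}\to\mathbb C$ which is invariant under the adjoint action of $\mathfrak g$, extended to $\mathfrak g$-valued differential forms by the wedge product, and let $k\in\mathbb C$. For a smooth $\mathfrak g$-valued one-form $A$ on $M$ write $D_AZ=dZ+[A,Z]$ and $F=dA+\tfrac12[A,A]$. Let $A,\bar A$ be two smooth $\mathfrak g$-valued one-forms (gauge connections) on $M$, with curvatures $F,\bar F$, put $\theta=A-\bar A$, $A_t=\bar A+t\theta$, $F_t=dA_t+\tfrac12[A_t,A_t]$, and consider the transgression lagrangian $$L(A,\bar A)=(n+1)k\int_0^1dt\,\langle\theta F_t^{n}\rangle .$$ For smooth variations $\delta A,\delta\bar A$ put $\delta A_t=\delta\bar A+t(\delta A-\delta\bar A)$ and $$\Theta(\delta A,\delta\bar A)=n(n+1)k\int_0^1dt\,\langle\delta A_t\,\theta F_t^{n-1}\rangle .$$ The induced variation of the lagrangian is $$\delta L=(n+1)k\left(\langle\delta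 A\,F^n\rangle-\langle\delta\bar A\,\bar F^n\rangle\right)+d\Theta(\delta A,\delta\bar A).$$ Thus the field equations are $\langle F^nG\rangle=0=\langle\bar F^nG\rangle$ for all $G\in\mathfrak g$, and $\Theta$ is the boundary term. If they hold, we say that $(A,\bar A)$ is on shell. (i) Gauge transformations. Let $\lambda$ be a smooth $\mathfrak g$-valued zero-form, and let $\delta A=-D_A\lambda$, $\delta\bar A=-D_{\bar A}\lambda$. Then $\delta L=0$, and the Noether current ${\star J}_{\rm gauge}=-\Theta(-D_A\lambda,-D_{\bar A}\lambda)$ satisfies $${\star J}_{\rm gauge}=n(n+1)k\,d\int_0^1dt\,\langle\lambda\theta F_t^{n-1}\rangle-(n+1)k\left(\langle\lambda F^n\rangle-\langle\lambda\bar F^n\rangle\right).$$ On shell it is therefore the exact form $n(n+1)k\,d\int_0^1dt\,\langle\lambda\theta F_t^{n-1}\rangle$. (ii) Diffeomorphisms. Let $\xi$ be a smooth vector field on $M$ with contraction operator $I_\xi$, let $\pounds_\xi=dI_\xi+I_\xi d$, and let $\delta A=-\pounds_\xi A$, $\delta\bar A=-\pounds_\xi\bar A$. Then $\delta L=-d\,I_\xi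 L$, and the Noether current ${\star J}_{\rm diff}=-\Theta(-\pounds_\xi A,-\pounds_\xi\bar A)-I_\xi L$ satisfies $${\star J}_{\rm diff}=n(n+1)k\,d\int_0^1dt\,\langle I_\xi A_t\,\theta F_t^{n-1}\rangle-(n+1)k\left(\langle I_\xi A\,F^n\rangle-\langle I_\xi\bar A\,\bar F^n\rangle\right).$$ On shell it is therefore the exact form $n(n+1)k\,d\int_0^1dt\,\langle I_\xi A_t\,\theta F_t^{n-1}\rangle$. In both cases the potential under $d$ is a smooth $(2n-1)$-form, and on shell $d{\star J}=0$. -/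

import Mathlib

open Set MeasureTheory
open scoped Manifold ContDiff

noncomputable section

namespace Transgression

/-! ### Lie algebras with a norm -/

/-- A Lie ring with a norm inducing the same additive group. The norm is only used to speak about
derivatives of Lie-algebra-valued maps; nothing relates it to the bracket. -/
class NormedLieRing (𝔤 : Type*) extends LieRing 𝔤, NormedAddCommGroup 𝔤

/-- A real Lie algebra with a norm. Every finite-dimensional real Lie algebra carries one, and all
of them are equivalent. -/
class NormedLieAlgebra (𝔤 : Type*) [NormedLieRing 𝔤] extends LieAlgebra ℝ 𝔤, NormedSpace ℝ 𝔤

/-- The Lie bracket of a finite-dimensional Lie algebra as a continuous multilinear map. -/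
def lieBracket (𝔤 : Type*) [NormedLieRing 𝔤] [NormedLieAlgebra 𝔤] [FiniteDimensional ℝ 𝔤] :
    ContinuousMultilinearMap ℝ (fun _ : Fin 2 => 𝔤) 𝔤 where
  toFun v := ⁅v 0, v 1⁆
  map_update_add' {inst} v i x y := by
    rw [Subsingleton.elim inst (instDecidableEqFin 2)]
    fin_cases i <;> simp
  map_update_smul' {inst} v i c x := by
    rw [Subsingleton.elim inst (instDecidableEqFin 2)]
    fin_cases i <;> simp
  cont := by
    let B : 𝔤 →ₗ[ℝ] 𝔤 →ₗ[ℝ] 𝔤 :=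
      LinearMap.mk₂ ℝ (fun x y => ⁅x, y⁆) (by simp) (by simp) (by simp) (by simp)
    have h : Continuous fun v : Fin 2 → 𝔤 => B.toContinuousBilinearMap (v 0) (v 1) := by
      fun_prop
    exact h

/-- An invariant symmetric polynomial `⟨ ⋯ ⟩` of rank `r` on `𝔤`: a symmetric multilinear map which
is invariant under the adjoint action,
`⟨[X, v₁] v₂ ⋯ vᵣ⟩ + ⟨v₁ [X, v₂] ⋯ vᵣ⟩ + ⋯ + ⟨v₁ ⋯ [X, vᵣ]⟩ = 0`. -/
structure IsInvariantSymmetric {𝔤 : Type*} [NormedLieRing 𝔤] [NormedLieAlgebra 𝔤] {r : ℕ}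
    (P : ContinuousMultilinearMap ℝ (fun _ : Fin r => 𝔤) ℂ) : Prop where
  symmetric : ∀ (σ : Equiv.Perm (Fin r)) (v : Fin r → 𝔤), P (fun i => v (σ i)) = P v
  invariant : ∀ (X : 𝔤) (v : Fin r → 𝔤), ∑ i, P (Function.update v i ⁅X, v i⁆) = 0

/-! ### Products of alternating forms on a vector space -/

section Algebra

variable {E V W : Type*} [NormedAddCommGroup E] [NormedSpace ℝ E]
  [NormedAddCommGroup V] [NormedSpace ℝ V] [NormedAddCommGroup W] [NormedSpace ℝ W]

/-- The multilinear map
`v ↦ P (Z₁ (v₁, …, v_{p₁}), Z₂ (v_{p₁ + 1}, …, v_{p₁ + p₂}), …, Zᵣ (…, v_N))`,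
where `N = p₁ + ⋯ + pᵣ`. -/
def blockComp {r N : ℕ} {p : Fin r → ℕ} (h : ∑ i, p i = N)
    (P : ContinuousMultilinearMap ℝ (fun _ : Fin r => V) W)
    (Z : ∀ i, E [⋀^Fin (p i)]→L[ℝ] V) :
    ContinuousMultilinearMap ℝ (fun _ : Fin N => E) W where
  toMultilinearMap :=
    (P.toMultilinearMap.compMultilinearMap
      (fun i => (Z i).toContinuousMultilinearMap.toMultilinearMap)).domDomCongr
      (finSigmaFinEquiv.trans (finCongr h))
  cont := by
    change Continuous fun v : Fin N → E =>
      P fun i => Z i fun j => v (finCongr h (finSigmaFinEquiv ⟨i, j⟩))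
    fun_prop

/-- The wedge product `P(Z₁ ∧ ⋯ ∧ Zᵣ)` of `V`-valued alternating forms of degrees `p₁, …, pᵣ`,
their values being multiplied by the multilinear map `P`:
`(v₁, …, v_N) ↦ (p₁! ⋯ pᵣ!)⁻¹ ∑_σ sign σ • P (Z₁ (v_{σ 1}, …), …, Zᵣ (…, v_{σ N}))`. -/
def wedge {r N : ℕ} {p : Fin r → ℕ} (h : ∑ i, p i = N)
    (P : ContinuousMultilinearMap ℝ (fun _ : Fin r => V) W)
    (Z : ∀ i, E [⋀^Fin (p i)]→L[ℝ] V) : E [⋀^Fin N]→L[ℝ] W :=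
  ((∏ i, ((p i).factorial : ℝ))⁻¹) •
    ContinuousMultilinearMap.alternatization (blockComp h P Z)

/-- The degrees `(a, b, 2, …, 2)`. -/
def degs (a b : ℕ) {r : ℕ} : Fin r → ℕ
  | ⟨0, _⟩ => a
  | ⟨1, _⟩ => b
  | ⟨_ + 2, _⟩ => 2

theorem sum_degs (a b m : ℕ) : ∑ i : Fin (m + 2), degs a b i = 2 * m + (a + b) := by
  rw [Fin.sum_univ_succ, Fin.sum_univ_succ]
  have h : ∀ i : Fin m, degs a b (i.succ.succ) = 2 := fun i => rfl
  have h0 : degs a b (0 : Fin (m + 2)) = a := rfl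
  have h1 : degs a b (Fin.succ (0 : Fin (m + 1))) = b := rfl
  simp only [h, h0, h1, Finset.sum_const, Finset.card_univ, Fintype.card_fin, smul_eq_mul]
  ring

/-- The factors `(α, β, F, …, F)`. -/
def factors {a b r : ℕ} (α : E [⋀^Fin a]→L[ℝ] V) (β : E [⋀^Fin b]→L[ℝ] V)
    (F : E [⋀^Fin 2]→L[ℝ] V) : ∀ i : Fin r, E [⋀^Fin (degs a b i)]→L[ℝ] V
  | ⟨0, _⟩ => α
  | ⟨1, _⟩ => β
  | ⟨_ + 2, _⟩ => F

/-- `⟨α β Fᵐ⟩` for a polynomial of rank `m + 2`, forms `α`, `β` of degrees `a`, `b` and a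
two-form `F`. -/
def angle {a b m : ℕ} (P : ContinuousMultilinearMap ℝ (fun _ : Fin (m + 2) => V) W)
    (α : E [⋀^Fin a]→L[ℝ] V) (β : E [⋀^Fin b]→L[ℝ] V) (F : E [⋀^Fin 2]→L[ℝ] V) :
    E [⋀^Fin (2 * m + (a + b))]→L[ℝ] W :=
  wedge (sum_degs a b m) P (factors α β F)

/-- The bracket `[α, β]` of two Lie-algebra-valued alternating forms, of total degree `N`. -/
def formBracket {𝔤 : Type*} [NormedLieRing 𝔤] [NormedLieAlgebra 𝔤] [FiniteDimensional ℝ 𝔤]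
    {a b N : ℕ} (h : a + b = N) (α : E [⋀^Fin a]→L[ℝ] 𝔤) (β : E [⋀^Fin b]→L[ℝ] 𝔤) :
    E [⋀^Fin N]→L[ℝ] 𝔤 :=
  wedge (p := degs a b) (by simpa [sum_degs] using (sum_degs a b 0).trans (by omega))
    (lieBracket 𝔤) (factors α β 0)

end Algebra

/-! ### Differential forms on a manifold -/

/-- A `V`-valued differential form of degree `p` on a manifold `M` modelled on `E`, not necessarily
smooth. It assigns to `x` an alternating form on the tangent space at `x`, and `TangentSpace I x`
is by definition the model space `E`. -/
abbrev Form (E M V : Type*) [NormedAddCommGroup E] [NormedSpace ℝ E]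
    [NormedAddCommGroup V] [NormedSpace ℝ V] (p : ℕ) : Type _ :=
  M → E [⋀^Fin p]→L[ℝ] V

section Forms

variable {E H M V : Type*} [NormedAddCommGroup E] [NormedSpace ℝ E]
  [TopologicalSpace H] (I : ModelWithCorners ℝ E H) [TopologicalSpace M] [ChartedSpace H M]
  [NormedAddCommGroup V] [NormedSpace ℝ V]

/-- The coordinate representation of a form in the preferred chart `φ` at `x₀`, that is, the
pullback of the form under `φ⁻¹`. -/
def chartRep {p : ℕ} (η : Form E M V p) (x₀ : M) (y : E) : E [⋀^Fin p]→L[ℝ] V :=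
  (η ((extChartAt I x₀).symm y)).compContinuousLinearMap
    (mfderivWithin 𝓘(ℝ, E) I (extChartAt I x₀).symm (range I) y)

/-- A form is smooth if all its coordinate representations are smooth. -/
def IsSmooth {p : ℕ} (η : Form E M V p) : Prop :=
  ∀ x₀ : M, ContDiffOn ℝ ∞ (chartRep I η x₀) (extChartAt I x₀).target

/-- The exterior derivative: at `x` it is `φ^* d ((φ⁻¹)^* η)`, where `φ` is the preferred chart
at `x`. -/
def extD {p : ℕ} (η : Form E M V p) : Form E M V (p + 1) := fun x =>
  (extDerivWithin (chartRep I η x) (range I) (extChartAt I x x)).compContinuousLinearMap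
    (mfderiv I 𝓘(ℝ, E) (extChartAt I x) x)

variable {I}

/-- The contraction `I_ξ η` of a form with a vector field. -/
def contract {p : ℕ} (ξ : ∀ x : M, TangentSpace I x) (η : Form E M V (p + 1)) : Form E M V p :=
  fun x => ContinuousAlternatingMap.curryLeft (η x) (ξ x)

variable (I)

/-- The Lie derivative of a form of positive degree, `£_ξ = d I_ξ + I_ξ d`. -/
def lieD {p : ℕ} (ξ : ∀ x : M, TangentSpace I x) (η : Form E M V (p + 1)) : Form E M V (p + 1) :=
  extD I (contract ξ η) + contract ξ (extD I η)

variable {I}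

/-- The integral `∫₀¹ dt η_t` of a family of forms. -/
def intForm {p : ℕ} (η : ℝ → Form E M V p) : Form E M V p :=
  fun x => ∫ t in (0 : ℝ)..1, η t x

end Forms

/-! ### Connections and the transgression lagrangian -/

section Gauge

variable {E H M 𝔤 : Type*} [NormedAddCommGroup E] [NormedSpace ℝ E]
  [TopologicalSpace H] (I : ModelWithCorners ℝ E H) [TopologicalSpace M] [ChartedSpace H M]
  [NormedLieRing 𝔤] [NormedLieAlgebra 𝔤] [FiniteDimensional ℝ 𝔤]

/-- The covariant derivative `D_A Z = dZ + [A, Z]`. -/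
def covD {p : ℕ} (A : Form E M 𝔤 1) (Z : Form E M 𝔤 p) : Form E M 𝔤 (p + 1) :=
  fun x => extD I Z x + formBracket (Nat.add_comm 1 p) (A x) (Z x)

/-- The curvature `F = dA + A²`, where `A² = ½ [A, A]`. -/
def curvature (A : Form E M 𝔤 1) : Form E M 𝔤 2 :=
  fun x => extD I A x + (1 / 2 : ℝ) • formBracket rfl (A x) (A x)

/-- `B̄ + t (B - B̄)`. It gives `A_t` from `A`, `Ā`, and `δA_t` from `δA`, `δĀ`. -/
def interp (B B' : Form E M 𝔤 1) (t : ℝ) : Form E M 𝔤 1 := B' + t • (B - B')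

variable {m : ℕ} (P : ContinuousMultilinearMap ℝ (fun _ : Fin (m + 2) => 𝔤) ℂ) (k : ℂ)

/-! In what follows `P = ⟨ ⋯ ⟩` has rank `m + 2`, so that the number `n` in the dimension `2n + 1`
is `m + 1`; the connections are `A` and `A' = Ā`, and `θ = A - Ā`. -/

/-- `⟨α Fⁿ⟩`, where `F` is the curvature of `A`. -/
def angleCurv {a : ℕ} (α : Form E M 𝔤 a) (A : Form E M 𝔤 1) : Form E M ℂ (2 * m + (a + 2)) :=
  fun x => angle P (α x) (curvature I A x) (curvature I A x)

/-- `∫₀¹ dt ⟨α_t θ F_tⁿ⁻¹⟩`. -/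
def angleInt {a : ℕ} (α : ℝ → Form E M 𝔤 a) (A A' : Form E M 𝔤 1) :
    Form E M ℂ (2 * m + (a + 1)) :=
  intForm fun t x => angle P (α t x) ((A - A') x) (curvature I (interp A A' t) x)

/-- The transgression lagrangian `L = (n + 1) k ∫₀¹ dt ⟨θ F_tⁿ⟩`. -/
def lagrangian (A A' : Form E M 𝔤 1) : Form E M ℂ (2 * m + 3) :=
  ((m + 2 : ℂ) * k) • intForm fun t => angleCurv I P (A - A') (interp A A' t)

/-- The field equations of one connection, `⟨Fⁿ G⟩ = 0` for all `G` in the Lie algebra. -/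
def FieldEquation (A : Form E M 𝔤 1) : Prop :=
  ∀ G : 𝔤, angleCurv I P
    (fun _ => ContinuousAlternatingMap.constOfIsEmpty ℝ E (Fin 0) G : Form E M 𝔤 0) A = 0

/-- The bulk part `(n + 1) k (⟨δA Fⁿ⟩ - ⟨δĀ F̄ⁿ⟩)` of the variation of the lagrangian; also used
for zero-forms in place of `δA`, `δĀ`. -/
def bulk {a : ℕ} (A A' : Form E M 𝔤 1) (δA δA' : Form E M 𝔤 a) : Form E M ℂ (2 * m + (a + 2)) :=
  ((m + 2 : ℂ) * k) • (angleCurv I P δA A - angleCurv I P δA' A')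

/-- The boundary term `Θ(A, Ā, δA, δĀ) = n (n + 1) k ∫₀¹ dt ⟨δA_t θ F_tⁿ⁻¹⟩` of the variation of
the lagrangian. -/
def boundaryTerm (A A' δA δA' : Form E M 𝔤 1) : Form E M ℂ (2 * m + 2) :=
  ((m + 1 : ℂ) * (m + 2) * k) • angleInt I P (interp δA δA') A A'

/-- The Noether current `Ω - Θ` of a gauge transformation `δA = -D_A Λ`, `δĀ = -D_Ā Λ`; the
lagrangian is gauge invariant, so `Ω = 0`. -/
def gaugeCurrent (A A' : Form E M 𝔤 1) (Λ : Form E M 𝔤 0) : Form E M ℂ (2 * m + 2) :=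
  -boundaryTerm I P k A A' (-covD I A Λ) (-covD I A' Λ)

/-- The Noether current `-Θ - I_ξ L` of a diffeomorphism, `δA = -£_ξ A`, `δĀ = -£_ξ Ā`. -/
def diffCurrent (A A' : Form E M 𝔤 1) (ξ : ∀ x : M, TangentSpace I x) :
    Form E M ℂ (2 * m + 2) :=
  -boundaryTerm I P k A A' (-lieD I ξ A) (-lieD I ξ A') - contract ξ (lagrangian I P k A A')

/-- `δL = η`: the derivative at `ε = 0` of the lagrangian of `A + ε δA`, `Ā + ε δĀ` is `η`. -/
def HasVariation (A A' δA δA' : Form E M 𝔤 1) (η : Form E M ℂ (2 * m + 3)) : Prop :=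
  ∀ x : M, HasDerivAt (fun ε : ℝ => lagrangian I P k (A + ε • δA) (A' + ε • δA') x) (η x) 0

end Gauge

end Transgression

end

open Transgression

/-! ### Alternating forms in the exterior algebra of the dual space -/

section ExteriorAlgebra

/-! Write n = m + 1, D_t for the covariant derivative of A_t, and θ for the velocity of the line
A_t. Everything rests on two identities. The first is the Leibniz rule d⟨α β F^{n-1}⟩ = ⟨D_Aα β
F^{n-1}⟩ + (-1)^a ⟨α D_Aβ F^{n-1}⟩ for a form α of degree a (`extD_wedge_factors_curvature`):
invariance of the polynomial allows ad A to be added in every slot at no cost, which turns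
derivatives into covariant ones, and the Bianchi identity removes the curvature slots. The second is
dF_t/dt = D_tθ (`hasDerivAt_curvature`), so that d/dt⟨α_t F_t^n⟩ = ⟨α̇ F_t^n⟩ + n⟨α_t D_tθ
F_t^{n-1}⟩.

Integrating the second over [0, 1] and eliminating the D_tθ term with the first gives the
transgression formula `extD_angleInt`: n d∫⟨α_t θ F_t^{n-1}⟩ = n∫⟨D_tα_t θ F_t^{n-1}⟩ + (-1)^a (⟨α_1
F^n⟩ - ⟨α_0 F̄^n⟩ - ∫⟨α̇ F_t^n⟩). The theorem is this formula for three choices of α_t. With α_t =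
δA_t it yields the variation of the lagrangian. With α_t = λ constant it yields the gauge current,
because D_tλ interpolates between D_Āλ and D_Aλ. With α_t = I_ξA_t it yields the diffeomorphism
current, through £_ξA = D_A I_ξA + I_ξF and I_ξ⟨θF^n⟩ = ⟨I_ξθ F^n⟩ + n⟨I_ξF θ F^{n-1}⟩.

The symmetry statements follow by inserting the current into the general variation: d² = 0 removes
the potential, and d⟨αF^n⟩ = ⟨D_Aα F^n⟩ cancels the bulk part. For diffeomorphisms there also
remains ⟨I_ξF F^n⟩, a multiple of I_ξ⟨F^{n+1}⟩, which vanishes because 2n + 2 exceeds the dimension.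

The signs in the multilinear algebra are handled by embedding alternating forms injectively into the
exterior algebra of the dual space (`toExt_injective`), where wedge products become honest products
(`toExt_wedge`), contraction is an antiderivation and elements of degree two are central. All
families in t are polynomial with smooth coefficients, so d commutes with the t-integral by a finite
computation. -/

theorem List.prod_ofFn_sigma {A : Type*} [Monoid A] {r N : ℕ} {p : Fin r → ℕ}
    (h : ∑ i, p i = N) (g : Fin N → A) :
    (List.ofFn g).prod =
      (List.ofFn fun i => (List.ofFn fun j => g (finCongr h (finSigmaFinEquiv ⟨i, j⟩))).prod).prod := by
  induction r generalizing N with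
  | zero =>
    have hN : N = 0 := by simpa using h.symm
    subst hN
    simp
  | succ r ih =>
    have h' : ∑ i : Fin r, p i.castSucc + p (Fin.last r) = N := by
      rw [← h, Fin.sum_univ_castSucc]
    subst h'
    rw [List.ofFn_add, List.prod_append, List.ofFn_succ', List.concat_eq_append, List.prod_append,
      List.prod_singleton, ih (p := fun i => p i.castSucc) rfl]
    congr 1
    · congr 1
      refine congrArg List.ofFn (funext fun i => ?_)
      congr 1
      refine congrArg List.ofFn (funext fun j => ?_)
      congr 1
      apply Fin.ext
      simp [finSigmaFinEquiv_apply]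
    · congr 1
      refine congrArg List.ofFn (funext fun j => ?_)
      congr 1
      apply Fin.ext
      simp only [Fin.val_natAdd, finCongr_apply, Fin.val_cast, finSigmaFinEquiv_apply]
      rfl

variable {E : Type*} [NormedAddCommGroup E] [NormedSpace ℝ E]
  {ι : Type*} [Fintype ι] (b : Module.Basis ι ℝ E)

/-- The exterior algebra of the dual space. -/
abbrev CoExt (E : Type*) [NormedAddCommGroup E] [NormedSpace ℝ E] : Type _ :=
  ExteriorAlgebra ℝ (Module.Dual ℝ E)

open ExteriorAlgebra in
/-- An alternating form as an element of the exterior algebra of the dual space. -/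
noncomputable def toExt (p : ℕ) : (E [⋀^Fin p]→L[ℝ] ℝ) →ₗ[ℝ] CoExt E where
  -- The sum runs over all index tuples, so each set of p distinct indices is counted p! times; the
  -- factor compensates for this.
  toFun η := ((p.factorial : ℝ)⁻¹) •
    ∑ J : Fin p → ι, η (fun j => b (J j)) • ιMulti ℝ p (fun j => b.coord (J j))
  map_add' η η' := by simp [add_smul, Finset.sum_add_distrib]
  map_smul' c η := by
    simp only [ContinuousAlternatingMap.smul_apply, smul_eq_mul, mul_smul, RingHom.id_apply,
      ← Finset.smul_sum]
    rw [smul_comm]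

open ExteriorAlgebra

theorem toExt_apply {p : ℕ} (η : E [⋀^Fin p]→L[ℝ] ℝ) :
    toExt b p η = ((p.factorial : ℝ)⁻¹) •
      ∑ J : Fin p → ι, η (fun j => b (J j)) • ιMulti ℝ p (fun j => b.coord (J j)) := rfl

theorem toExt_zero_apply (η : E [⋀^Fin 0]→L[ℝ] ℝ) :
    toExt b 0 η = algebraMap ℝ _ (η ![]) := by
  rw [toExt_apply]
  simp only [Nat.factorial_zero, Nat.cast_one, inv_one, one_smul, Finset.univ_unique,
    Finset.sum_singleton, ιMulti_zero_apply, Algebra.algebraMap_eq_smul_one]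
  congr 2
  exact Subsingleton.elim _ _

/-- Splitting off the first index of the tuple gives a recursion in the degree, on which the
computation of contractions rests. -/
theorem toExt_succ {p : ℕ} (η : E [⋀^Fin (p + 1)]→L[ℝ] ℝ) :
    toExt b (p + 1) η =
      ((p + 1 : ℝ)⁻¹) • ∑ i, ExteriorAlgebra.ι ℝ (b.coord i) * toExt b p (η.curryLeft (b i)) := by
  simp only [toExt_apply]
  rw [← (Fin.consEquiv fun _ => ι).sum_comp, Fintype.sum_prod_type]
  simp only [Finset.smul_sum, Finset.mul_sum]
  refine Finset.sum_congr rfl fun i _ => Finset.sum_congr rfl fun J _ => ?_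
  rw [mul_smul_comm, mul_smul_comm, smul_smul (M := ℝ) (_)⁻¹ (_)⁻¹, Nat.factorial_succ]
  have h1 : (fun j => b ((Fin.consEquiv fun _ => ι) (i, J) j)) =
      Matrix.vecCons (b i) (fun j => b (J j)) := by
    funext j
    refine Fin.cases ?_ (fun j => ?_) j <;> simp [Fin.consEquiv]
  have h2 : ιMulti ℝ (p + 1) (fun j => b.coord ((Fin.consEquiv fun _ => ι) (i, J) j)) =
      ExteriorAlgebra.ι ℝ (b.coord i) * ιMulti ℝ p (fun j => b.coord (J j)) := by
    rw [ιMulti_succ_apply]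
    simp [Fin.consEquiv, Matrix.vecTail, Function.comp_def]
  rw [h1, h2, ContinuousAlternatingMap.curryLeft_apply_apply]
  push_cast
  rw [mul_inv]

theorem sum_coord_smul_toExt_curryLeft {p : ℕ} (η : E [⋀^Fin (p + 1)]→L[ℝ] ℝ) (v : E) :
    ∑ i, b.coord i v • toExt b p (η.curryLeft (b i)) = toExt b p (η.curryLeft v) := by
  conv_rhs => rw [← b.sum_repr v]
  simp only [map_sum, map_smul, Module.Basis.coord_apply]

open CliffordAlgebra in
theorem contractLeft_toExt_zero (d : Module.Dual ℝ (Module.Dual ℝ E)) (η : E [⋀^Fin 0]→L[ℝ] ℝ) :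
    contractLeft (Q := (0 : QuadraticForm ℝ (Module.Dual ℝ E))) d (toExt b 0 η) = 0 := by
  rw [toExt_zero_apply]
  exact contractLeft_algebraMap _ _ _

open CliffordAlgebra in
-- Contraction is the Clifford contraction for the zero quadratic form. In the inductive step,
-- contracting the split-off covector gives one copy of the result; contracting the rest gives,
-- after one use of antisymmetry and the recursion `toExt_succ`, as many further copies as the
-- remaining degree. The normalising factor of the recursion cancels the total.
theorem contractLeft_toExt {p : ℕ} (η : E [⋀^Fin (p + 1)]→L[ℝ] ℝ) (v : E) :
    contractLeft (Q := (0 : QuadraticForm ℝ (Module.Dual ℝ E))) (Module.Dual.eval ℝ E v)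
      (toExt b (p + 1) η) = toExt b p (η.curryLeft v) := by
  induction p generalizing v with
  | zero =>
    rw [toExt_succ]
    simp only [map_smul, map_sum, ExteriorAlgebra.ι, contractLeft_ι_mul, contractLeft_toExt_zero,
      mul_zero, sub_zero, Module.Dual.eval_apply]
    rw [sum_coord_smul_toExt_curryLeft]
    simp
  | succ p ih =>
    rw [toExt_succ]
    simp only [map_smul, map_sum, ExteriorAlgebra.ι, contractLeft_ι_mul, Module.Dual.eval_apply, ih,
      Finset.sum_sub_distrib]
    rw [sum_coord_smul_toExt_curryLeft]
    have h : ∀ i, (η.curryLeft (b i)).curryLeft v = -(η.curryLeft v).curryLeft (b i) := by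
      intro i
      ext w
      have := (η.toAlternatingMap).map_swap (Matrix.vecCons (b i) (Matrix.vecCons v w))
        (i := 0) (j := 1) (by simp)
      simp only [ContinuousAlternatingMap.curryLeft_apply_apply, ContinuousAlternatingMap.neg_apply]
      rw [← neg_eq_iff_eq_neg]
      refine this.symm.trans ?_
      refine congrArg η ?_
      funext j
      refine Fin.cases ?_ (fun j => Fin.cases ?_ (fun j => ?_) j) j
      · simp
      · simp [Fin.succ_zero_eq_one]
      · simp only [Function.comp_apply, Matrix.cons_val_succ]
        rw [Equiv.swap_apply_of_ne_of_ne (Fin.succ_ne_zero _)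
          (by rw [← Fin.succ_zero_eq_one]; exact fun h => Fin.succ_ne_zero _ (Fin.succ_injective _ h))]
        simp
    simp only [h, map_neg, mul_neg, Finset.sum_neg_distrib, sub_neg_eq_add]
    have h2 := toExt_succ b (η.curryLeft v)
    rw [eq_inv_smul_iff₀ (by positivity)] at h2
    simp only [ExteriorAlgebra.ι] at h2
    rw [← h2]
    push_cast
    rw [← one_smul ℝ (toExt b (p + 1) (η.curryLeft v)), smul_smul, ← add_smul, smul_smul]
    congr 1
    field_simp
    ring

/-- If the image of η vanishes, so do all its contractions, which are the images of the forms
obtained by fixing the first argument. Induction on the degree then shows that η vanishes, without a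
basis of the exterior algebra. -/
theorem toExt_injective (p : ℕ) : Function.Injective (toExt b p) := by
  rw [injective_iff_map_eq_zero]
  induction p with
  | zero =>
    intro η h
    rw [toExt_zero_apply, algebraMap_eq_zero_iff] at h
    ext v
    rw [Subsingleton.elim v ![], h]
    rfl
  | succ p ih =>
    intro η h
    have h' : ∀ v, η.curryLeft v = 0 := fun v => ih _ (by
      rw [← contractLeft_toExt, h, map_zero])
    ext v
    have := DFunLike.congr_fun (h' (v 0)) (Fin.tail v)
    rw [ContinuousAlternatingMap.curryLeft_apply_apply] at this
    refine Eq.trans (congrArg η ?_) this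
    exact (Matrix.cons_head_tail v).symm

/-- Moving the distinguished covector from slot j to the front costs (-1)^j, which is the sign in
the alternatization. Hence all p + 1 slots contribute equally and turn 1/(p+1)! into 1/p!. In this
form an exterior derivative is left multiplication by covectors. -/
theorem toExt_alternatizeUncurryFin {p : ℕ} (L : E →L[ℝ] E [⋀^Fin p]→L[ℝ] ℝ) :
    toExt b (p + 1) (ContinuousAlternatingMap.alternatizeUncurryFin L) =
      ∑ i, ExteriorAlgebra.ι ℝ (b.coord i) * toExt b p (L (b i)) := by
  have key : ∀ j : Fin (p + 1), ∑ J : Fin (p + 1) → ι,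
      ((-1) ^ (j : ℕ) • L (b (J j)) (j.removeNth fun j => b (J j))) •
        ιMulti ℝ (p + 1) (fun j => b.coord (J j)) =
      ∑ i, ∑ J : Fin p → ι, L (b i) (fun k => b (J k)) •
        (ExteriorAlgebra.ι ℝ (b.coord i) * ιMulti ℝ p (fun k => b.coord (J k))) := by
    intro j
    rw [← (Fin.insertNthEquiv (fun _ => ι) j).sum_comp, Fintype.sum_prod_type]
    refine Finset.sum_congr rfl fun i _ => Finset.sum_congr rfl fun J _ => ?_
    have h2 : (fun k => b.coord ((Fin.insertNthEquiv (fun _ => ι) j) (i, J) k)) =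
        j.insertNth (b.coord i) (fun k => b.coord (J k)) := by
      funext k
      refine Fin.succAboveCases j ?_ (fun k => ?_) k <;> simp [Fin.insertNthEquiv]
    have h3 : (j.removeNth fun k => b ((Fin.insertNthEquiv (fun _ => ι) j) (i, J) k)) =
        fun k => b (J k) := by
      funext k
      simp [Fin.removeNth, Fin.insertNthEquiv]
    rw [h2, h3, AlternatingMap.map_insertNth, ιMulti_succ_apply]
    simp only [Fin.insertNthEquiv, Equiv.coe_fn_mk, Fin.insertNth_apply_same, Matrix.cons_val_zero,
      Matrix.tail_cons]
    rcases Nat.even_or_odd (j : ℕ) with he | ho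
    · simp [he.neg_one_pow]
    · simp [ho.neg_one_pow]
  rw [toExt_apply]
  simp only [ContinuousAlternatingMap.alternatizeUncurryFin_apply, Finset.sum_smul]
  rw [Finset.sum_comm]
  simp only [key, Finset.sum_const, Finset.card_univ, Fintype.card_fin]
  simp only [toExt_apply, mul_smul_comm, Finset.mul_sum, ← Finset.smul_sum]
  rw [← Nat.cast_smul_eq_nsmul ℝ, smul_smul, Nat.factorial_succ]
  congr 1
  push_cast
  field_simp

/-- After reindexing the tuples, the sign of each permutation is absorbed by the alternating product
of covectors, so the N! terms agree and cancel the normalisation. -/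
theorem toExt_alternatization {N : ℕ} (f : ContinuousMultilinearMap ℝ (fun _ : Fin N => E) ℝ) :
    toExt b N (ContinuousMultilinearMap.alternatization f) =
      ∑ J : Fin N → ι, f (fun j => b (J j)) • ιMulti ℝ N (fun j => b.coord (J j)) := by
  have key : ∀ σ : Equiv.Perm (Fin N), ∑ J : Fin N → ι,
      (Equiv.Perm.sign σ • f fun j => b (J (σ j))) • ιMulti ℝ N (fun j => b.coord (J j)) =
      ∑ J : Fin N → ι, f (fun j => b (J j)) • ιMulti ℝ N (fun j => b.coord (J j)) := by
    intro σ
    rw [← (Equiv.arrowCongr σ (Equiv.refl ι)).sum_comp]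
    refine Finset.sum_congr rfl fun J _ => ?_
    have : (fun j => b.coord ((Equiv.arrowCongr σ (Equiv.refl ι)) J j)) =
        (fun j => b.coord (J j)) ∘ σ.symm := by
      funext j
      simp [Equiv.arrowCongr]
    rw [this, AlternatingMap.map_perm, Equiv.Perm.sign_symm]
    simp only [Equiv.arrowCongr, Equiv.coe_fn_mk, Equiv.coe_refl, Function.comp_apply, id,
      Equiv.symm_apply_apply]
    rcases Int.units_eq_one_or (Equiv.Perm.sign σ) with h | h <;> simp [h]
  rw [toExt_apply]
  simp only [ContinuousMultilinearMap.alternatization_apply_apply, Finset.sum_smul]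
  rw [Finset.sum_comm]
  simp only [Function.comp_def, key, Finset.sum_const, Finset.card_univ, Fintype.card_perm,
    Fintype.card_fin]
  rw [← Nat.cast_smul_eq_nsmul ℝ, smul_smul, inv_mul_cancel₀ (by positivity), one_smul]

end ExteriorAlgebra

/-! ### Wedge products as products in the exterior algebra -/

section Wedge

variable {E : Type*} [NormedAddCommGroup E] [NormedSpace ℝ E]
  {V : Type*} [NormedAddCommGroup V] [NormedSpace ℝ V]
  {W : Type*} [NormedAddCommGroup W] [NormedSpace ℝ W]

theorem blockComp_apply {r N : ℕ} {p : Fin r → ℕ} (h : ∑ i, p i = N)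
    (P : ContinuousMultilinearMap ℝ (fun _ : Fin r => V) W)
    (Z : ∀ i, E [⋀^Fin (p i)]→L[ℝ] V) (v : Fin N → E) :
    blockComp h P Z v = P fun i => Z i fun j => v (finCongr h (finSigmaFinEquiv ⟨i, j⟩)) := rfl

theorem wedge_apply {r N : ℕ} {p : Fin r → ℕ} (h : ∑ i, p i = N)
    (P : ContinuousMultilinearMap ℝ (fun _ : Fin r => V) W)
    (Z : ∀ i, E [⋀^Fin (p i)]→L[ℝ] V) (v : Fin N → E) :
    wedge h P Z v = (∏ i, ((p i).factorial : ℝ))⁻¹ • ∑ σ : Equiv.Perm (Fin N),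
      Equiv.Perm.sign σ •
        P fun i => Z i fun j => v (σ (finCongr h (finSigmaFinEquiv ⟨i, j⟩))) := by
  rw [wedge, ContinuousAlternatingMap.smul_apply,
    ContinuousMultilinearMap.alternatization_apply_apply]
  rfl

theorem wedge_update_add {r N : ℕ} {p : Fin r → ℕ} (h : ∑ i, p i = N)
    (P : ContinuousMultilinearMap ℝ (fun _ : Fin r => V) W)
    (Z : ∀ i, E [⋀^Fin (p i)]→L[ℝ] V) (i : Fin r) (x y : E [⋀^Fin (p i)]→L[ℝ] V) :
    wedge h P (Function.update Z i (x + y)) =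
      wedge h P (Function.update Z i x) + wedge h P (Function.update Z i y) := by
  ext v
  simp only [wedge_apply, ContinuousAlternatingMap.add_apply]
  rw [← smul_add, ← Finset.sum_add_distrib]
  congr 1
  refine Finset.sum_congr rfl fun σ _ => ?_
  rw [← smul_add]
  congr 1
  have h1 : ∀ z : E [⋀^Fin (p i)]→L[ℝ] V,
      (fun k => (Function.update Z i z k) fun j => v (σ (finCongr h (finSigmaFinEquiv ⟨k, j⟩)))) =
      Function.update (fun k => Z k fun j => v (σ (finCongr h (finSigmaFinEquiv ⟨k, j⟩)))) i
        (z fun j => v (σ (finCongr h (finSigmaFinEquiv ⟨i, j⟩)))) := by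
    intro z
    funext k
    by_cases hk : k = i
    · subst hk; simp
    · simp [hk]
  rw [h1, h1, h1, ContinuousAlternatingMap.add_apply, P.map_update_add]

theorem wedge_update_smul {r N : ℕ} {p : Fin r → ℕ} (h : ∑ i, p i = N)
    (P : ContinuousMultilinearMap ℝ (fun _ : Fin r => V) W)
    (Z : ∀ i, E [⋀^Fin (p i)]→L[ℝ] V) (i : Fin r) (c : ℝ) (x : E [⋀^Fin (p i)]→L[ℝ] V) :
    wedge h P (Function.update Z i (c • x)) = c • wedge h P (Function.update Z i x) := by
  ext v
  simp only [wedge_apply, ContinuousAlternatingMap.smul_apply]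
  rw [smul_comm c, Finset.smul_sum (r := c)]
  congr 1
  refine Finset.sum_congr rfl fun σ _ => ?_
  rw [smul_comm c]
  congr 1
  have h1 : ∀ z : E [⋀^Fin (p i)]→L[ℝ] V,
      (fun k => (Function.update Z i z k) fun j => v (σ (finCongr h (finSigmaFinEquiv ⟨k, j⟩)))) =
      Function.update (fun k => Z k fun j => v (σ (finCongr h (finSigmaFinEquiv ⟨k, j⟩)))) i
        (z fun j => v (σ (finCongr h (finSigmaFinEquiv ⟨i, j⟩)))) := by
    intro z
    funext k
    by_cases hk : k = i
    · subst hk; simp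
    · simp [hk]
  rw [h1, h1, ContinuousAlternatingMap.smul_apply, P.map_update_smul]

/-- This crude bound, one term for each of the N! permutations, is what makes the wedge product a
continuous multilinear map, and hence smooth and differentiable by the product rule. -/
theorem norm_wedge_le {r N : ℕ} {p : Fin r → ℕ} (h : ∑ i, p i = N)
    (P : ContinuousMultilinearMap ℝ (fun _ : Fin r => V) W)
    (Z : ∀ i, E [⋀^Fin (p i)]→L[ℝ] V) :
    ‖wedge h P Z‖ ≤ ((∏ i, ((p i).factorial : ℝ))⁻¹ * (N.factorial * ‖P‖)) * ∏ i, ‖Z i‖ := by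
  refine ContinuousAlternatingMap.opNorm_le_bound _ (by positivity) fun v => ?_
  rw [wedge_apply, norm_smul, Real.norm_of_nonneg (by positivity), mul_assoc, mul_assoc]
  refine mul_le_mul_of_nonneg_left ?_ (by positivity)
  have key : ∀ σ : Equiv.Perm (Fin N), ‖Equiv.Perm.sign σ •
      P fun i => Z i fun j => v (σ (finCongr h (finSigmaFinEquiv ⟨i, j⟩)))‖ ≤
      ‖P‖ * ((∏ i, ‖Z i‖) * ∏ j, ‖v j‖) := by
    intro σ
    have h1 : ‖Equiv.Perm.sign σ •
      P fun i => Z i fun j => v (σ (finCongr h (finSigmaFinEquiv ⟨i, j⟩)))‖ =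
      ‖P fun i => Z i fun j => v (σ (finCongr h (finSigmaFinEquiv ⟨i, j⟩)))‖ := by
      rcases Int.units_eq_one_or (Equiv.Perm.sign σ) with h | h <;> simp [h]
    rw [h1]
    refine (P.le_opNorm _).trans (mul_le_mul_of_nonneg_left ?_ (norm_nonneg _))
    have h2 : ∏ j, ‖v j‖ =
        ∏ i, ∏ j, ‖v (σ (finCongr h (finSigmaFinEquiv ⟨i, j⟩)))‖ := by
      rw [← Fintype.prod_sigma', ← ((finSigmaFinEquiv.trans (finCongr h)).trans σ).prod_comp]
      rfl
    rw [h2, ← Finset.prod_mul_distrib]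
    exact Finset.prod_le_prod (fun _ _ => norm_nonneg _) fun i _ => (Z i).le_opNorm _
  refine (norm_sum_le_of_le _ fun σ _ => key σ).trans (le_of_eq ?_)
  simp only [Finset.sum_const, Finset.card_univ, Fintype.card_perm, Fintype.card_fin, nsmul_eq_mul]
  ring

/-- The wedge product as a continuous multilinear map of its factors. -/
noncomputable def wedgeCM {r N : ℕ} {p : Fin r → ℕ} (h : ∑ i, p i = N)
    (P : ContinuousMultilinearMap ℝ (fun _ : Fin r => V) W) :
    ContinuousMultilinearMap ℝ (fun i => E [⋀^Fin (p i)]→L[ℝ] V) (E [⋀^Fin N]→L[ℝ] W) :=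
  MultilinearMap.mkContinuous
    { toFun := fun Z => wedge h P Z
      map_update_add' := fun {inst} Z i x y => by
        rw [Subsingleton.elim inst (instDecidableEqFin r)]
        exact wedge_update_add h P Z i x y
      map_update_smul' := fun {inst} Z i c x => by
        rw [Subsingleton.elim inst (instDecidableEqFin r)]
        exact wedge_update_smul h P Z i c x }
    _ (norm_wedge_le h P)

theorem compContinuousAlternatingMap_wedge {U : Type*} [NormedAddCommGroup U] [NormedSpace ℝ U]
    {r N : ℕ} {p : Fin r → ℕ} (h : ∑ i, p i = N) (f : W →L[ℝ] U)
    (P : ContinuousMultilinearMap ℝ (fun _ : Fin r => V) W)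
    (Z : ∀ i, E [⋀^Fin (p i)]→L[ℝ] V) :
    f.compContinuousAlternatingMap (wedge h P Z) =
      wedge h (f.compContinuousMultilinearMap P) Z := by
  ext v
  rw [ContinuousLinearMap.compContinuousAlternatingMap_coe, Function.comp_apply, wedge_apply,
    wedge_apply]
  simp only [map_smul, map_sum]
  congr 1
  refine Finset.sum_congr rfl fun σ _ => ?_
  rcases Int.units_eq_one_or (Equiv.Perm.sign σ) with h | h <;> simp [h]

theorem wedge_compContinuousLinearMap {E' : Type*} [NormedAddCommGroup E'] [NormedSpace ℝ E']
    {r N : ℕ} {p : Fin r → ℕ} (h : ∑ i, p i = N)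
    (P : ContinuousMultilinearMap ℝ (fun _ : Fin r => V) W)
    (Z : ∀ i, E [⋀^Fin (p i)]→L[ℝ] V) (T : E' →L[ℝ] E) :
    (wedge h P Z).compContinuousLinearMap T =
      wedge h P fun i => (Z i).compContinuousLinearMap T := by
  ext v
  rw [ContinuousAlternatingMap.compContinuousLinearMap_apply, wedge_apply, wedge_apply]
  rfl

/-- Reduces identities of vector-valued forms to real-valued ones, to which the embedding in the
exterior algebra applies. -/
theorem ContinuousAlternatingMap.ext_dual {N : ℕ} {f g : E [⋀^Fin N]→L[ℝ] W}
    (h : ∀ l : W →L[ℝ] ℝ,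
      l.compContinuousAlternatingMap f = l.compContinuousAlternatingMap g) : f = g := by
  ext v
  exact (SeparatingDual.eq_iff_forall_dual_eq (R := ℝ)).2 fun l => DFunLike.congr_fun (h l) v

variable {ι κ : Type*} [Fintype ι] [FiniteDimensional ℝ V]
  (b : Module.Basis ι ℝ E) (e : Module.Basis κ ℝ V)

/-- The components of a vector-valued alternating form, in the exterior algebra. -/
noncomputable def extCoord (p : ℕ) : (E [⋀^Fin p]→L[ℝ] V) →ₗ[ℝ] κ → CoExt E :=
  LinearMap.pi fun k => toExt b p ∘ₗ
    { toFun := fun Z =>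
        (LinearMap.toContinuousLinearMap (e.coord k)).compContinuousAlternatingMap Z
      map_add' := fun _ _ => by ext; simp
      map_smul' := fun _ _ => by ext; simp }

theorem extCoord_apply {p : ℕ} (Z : E [⋀^Fin p]→L[ℝ] V) (k : κ) :
    extCoord b e p Z k = toExt b p
      ((LinearMap.toContinuousLinearMap (e.coord k)).compContinuousAlternatingMap Z) := rfl

variable [Fintype κ]

/-- The product of tuples of elements of an algebra with coefficients given by a multilinear
map. -/
noncomputable def tupleProd {A : Type*} [Ring A] [Algebra ℝ A] {r : ℕ}
    (P : ContinuousMultilinearMap ℝ (fun _ : Fin r => V) ℝ) (x : Fin r → κ → A) : A :=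
  ∑ K : Fin r → κ, P (fun i => e (K i)) • (List.ofFn fun i => x i (K i)).prod

/-- The product of N basis covectors splits into r consecutive blocks. Expanding P in the basis of
V, block i together with its share 1/pᵢ! of the normalisation assembles into a component of the i-th
factor. This is the bridge by which identities of wedge products become identities in an associative
algebra. -/
theorem toExt_wedge {r N : ℕ} {p : Fin r → ℕ} (h : ∑ i, p i = N)
    (P : ContinuousMultilinearMap ℝ (fun _ : Fin r => V) ℝ)
    (Z : ∀ i, E [⋀^Fin (p i)]→L[ℝ] V) :
    toExt b N (wedge h P Z) = tupleProd e P fun i => extCoord b e (p i) (Z i) := by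
  classical
  rw [wedge, map_smul, toExt_alternatization, tupleProd]
  -- One index tuple of length N is the same as one tuple for each block.
  let eqv : ((i : Fin r) → Fin (p i) → ι) ≃ (Fin N → ι) :=
    (Equiv.piCurry fun (i : Fin r) (_ : Fin (p i)) => ι).symm.trans
      (Equiv.arrowCongr (finSigmaFinEquiv.trans (finCongr h)) (Equiv.refl ι))
  have heqv : ∀ J i j, eqv J (finCongr h (finSigmaFinEquiv ⟨i, j⟩)) = J i j := by
    intro J i j
    exact congrArg (Sigma.uncurry J) ((finSigmaFinEquiv.trans (finCongr h)).symm_apply_apply ⟨i, j⟩)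
  have hP : ∀ u : Fin r → V, P u =
      ∑ K : Fin r → κ, (∏ i, e.coord (K i) (u i)) * P fun i => e (K i) := by
    intro u
    conv_lhs => rw [show u = fun i => ∑ k, e.coord k (u i) • e k from
      funext fun i => by simp]
    rw [P.map_sum]
    refine Finset.sum_congr rfl fun K _ => ?_
    rw [P.map_smul_univ, smul_eq_mul]
  have step : ∀ J : (i : Fin r) → Fin (p i) → ι,
      blockComp h P Z (fun j => b (eqv J j)) •
        ExteriorAlgebra.ιMulti ℝ N (fun j => b.coord (eqv J j)) =
      ∑ K : Fin r → κ, P (fun i => e (K i)) •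
        (List.ofFn fun i => e.coord (K i) (Z i fun j => b (J i j)) •
          ExteriorAlgebra.ιMulti ℝ (p i) (fun j => b.coord (J i j))).prod := by
    intro J
    rw [ExteriorAlgebra.ιMulti_apply, List.prod_ofFn_sigma h, blockComp_apply]
    simp only [heqv]
    rw [hP, Finset.sum_smul]
    refine Finset.sum_congr rfl fun K _ => ?_
    rw [← MultilinearMap.mkPiAlgebraFin_apply (R := ℝ), ← MultilinearMap.mkPiAlgebraFin_apply (R := ℝ),
      MultilinearMap.map_smul_univ, smul_smul, mul_comm]
    simp only [ExteriorAlgebra.ιMulti_apply]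
  rw [← eqv.sum_comp]
  simp only [step]
  rw [Finset.sum_comm, Finset.smul_sum]
  refine Finset.sum_congr rfl fun K _ => ?_
  rw [← Finset.smul_sum, smul_comm]
  congr 1
  simp only [extCoord_apply, toExt_apply]
  simp only [← MultilinearMap.mkPiAlgebraFin_apply (R := ℝ)]
  rw [MultilinearMap.map_smul_univ, MultilinearMap.map_sum, Finset.prod_inv_distrib]
  rfl

end Wedge

/-! ### Products of tuples -/

section TupleProd

variable {A : Type*} [Ring A] [Algebra ℝ A]

/-- The factor c travels from the front to slot l and collects a scalar from every factor it passes.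
The scalars are arbitrary here; in the applications they are (-1) to the degree of the factor. -/
theorem mul_prod_ofFn_update {r : ℕ} (w : Fin r → A) (s : Fin r → ℝ) (c y : A) (l : Fin r)
    (h : ∀ j < l, c * w j = s j • (w j * c)) :
    c * (List.ofFn (Function.update w l y)).prod =
      (∏ j ∈ Finset.Iio l, s j) • (List.ofFn (Function.update w l (c * y))).prod := by
  induction r with
  | zero => exact l.elim0
  | succ r ih =>
    refine Fin.cases (fun h => ?_) (fun l h => ?_) l h
    · rw [List.ofFn_succ, List.ofFn_succ]
      simp [mul_assoc, show Finset.Iio (0 : Fin (r + 1)) = ∅ by ext; simp]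
    · have h1 : ∀ z, (List.ofFn (Function.update w l.succ z)).prod =
          w 0 * (List.ofFn (Function.update (fun j => w j.succ) l z)).prod := by
        intro z
        rw [List.ofFn_succ, List.prod_cons, Function.update_of_ne (Fin.succ_ne_zero l).symm]
        congr 3
        funext j
        exact Function.update_apply_of_injective w (Fin.succ_injective r) l z j
      have h2 : ∏ j ∈ Finset.Iio l.succ, s j = s 0 * ∏ j ∈ Finset.Iio l, s j.succ := by
        rw [show Finset.Iio l.succ = insert 0 ((Finset.Iio l).map (Fin.succEmb r)) by
          ext j
          refine Fin.cases ?_ (fun j => ?_) j <;> simp]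
        rw [Finset.prod_insert (by simp), Finset.prod_map]
        rfl
      rw [h1, h1, ← mul_assoc, h 0 (Fin.succ_pos l), smul_mul_assoc, mul_assoc,
        ih (fun j => w j.succ) (fun j => s j.succ) l fun j hj => h j.succ (by simpa using hj),
        h2, mul_smul, mul_smul_comm]

/-- The graded Leibniz rule, with the scalars s in the role of signs, iterated along the list of
factors. It serves for contraction with a vector. -/
theorem derivation_prod_ofFn {r : ℕ} (D : A →ₗ[ℝ] A) (hD : D 1 = 0) (w : Fin r → A)
    (s : Fin r → ℝ) (h : ∀ j z, D (w j * z) = D (w j) * z + s j • (w j * D z)) :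
    D (List.ofFn w).prod =
      ∑ l, (∏ j ∈ Finset.Iio l, s j) • (List.ofFn (Function.update w l (D (w l)))).prod := by
  induction r with
  | zero => simpa using hD
  | succ r ih =>
    have h1 : ∀ l z, (List.ofFn (Function.update w (Fin.succ l) z)).prod =
        w 0 * (List.ofFn (Function.update (fun j => w j.succ) l z)).prod := by
      intro l z
      rw [List.ofFn_succ, List.prod_cons, Function.update_of_ne (Fin.succ_ne_zero l).symm]
      congr 3
      funext j
      exact Function.update_apply_of_injective w (Fin.succ_injective r) l z j
    have h2 : ∀ l : Fin r, ∏ j ∈ Finset.Iio l.succ, s j = s 0 * ∏ j ∈ Finset.Iio l, s j.succ := by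
      intro l
      rw [show Finset.Iio l.succ = insert 0 ((Finset.Iio l).map (Fin.succEmb r)) by
        ext j
        refine Fin.cases ?_ (fun j => ?_) j <;> simp]
      rw [Finset.prod_insert (by simp), Finset.prod_map]
      rfl
    rw [Fin.sum_univ_succ]
    simp only [h1, h2]
    rw [List.ofFn_succ, List.prod_cons, h, ih (fun j => w j.succ) (fun j => s j.succ)
      fun j z => h j.succ z, Finset.mul_sum, Finset.smul_sum]
    congr 1
    · rw [List.ofFn_succ]
      simp [show Finset.Iio (0 : Fin (r + 1)) = ∅ by ext; simp]
    · refine Finset.sum_congr rfl fun l _ => ?_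
      rw [mul_smul, mul_smul_comm]

variable {V : Type*} [NormedAddCommGroup V] [NormedSpace ℝ V] {κ : Type*} [Fintype κ]
  (e : Module.Basis κ ℝ V)

theorem update_eval {A κ : Type*} {r : ℕ} (x : Fin r → κ → A) (l : Fin r) (y : κ → A) (K : Fin r → κ) :
    (fun i => Function.update x l y i (K i)) = Function.update (fun i => x i (K i)) l (y (K l)) := by
  funext i
  by_cases hi : i = l
  · subst hi; simp
  · simp [hi]

theorem tupleProd_update_sum {r : ℕ} (P : ContinuousMultilinearMap ℝ (fun _ : Fin r => V) ℝ)
    {J : Type*} [Fintype J] (x : Fin r → κ → A) (l : Fin r) (y : J → κ → A) :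
    ∑ j, tupleProd e P (Function.update x l (y j)) =
      tupleProd e P (Function.update x l (∑ j, y j)) := by
  simp only [tupleProd]
  rw [Finset.sum_comm]
  refine Finset.sum_congr rfl fun K _ => ?_
  rw [← Finset.smul_sum]
  congr 1
  simp only [update_eval, Finset.sum_apply]
  simp only [← MultilinearMap.mkPiAlgebraFin_apply (R := ℝ)]
  exact (MultilinearMap.map_update_sum (MultilinearMap.mkPiAlgebraFin ℝ r A) Finset.univ l
    (fun j => y j (K l)) fun i => x i (K i)).symm

theorem tupleProd_update_zero {r : ℕ} (P : ContinuousMultilinearMap ℝ (fun _ : Fin r => V) ℝ)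
    (x : Fin r → κ → A) (l : Fin r) : tupleProd e P (Function.update x l 0) = 0 := by
  simpa using (tupleProd_update_sum e P x l (J := Empty) fun j => j.elim).symm

/-- Applied with basis covectors for c: the covectors of an exterior derivative are carried past the
first l factors into the slot that is being differentiated. -/
theorem sum_mul_tupleProd_update {r : ℕ} (P : ContinuousMultilinearMap ℝ (fun _ : Fin r => V) ℝ)
    {J : Type*} [Fintype J] (x : Fin r → κ → A) (l : Fin r) (c : J → A) (y : J → κ → A)
    (s : Fin r → ℝ) (h : ∀ i, ∀ j < l, ∀ k, c i * x j k = s j • (x j k * c i)) :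
    ∑ i, c i * tupleProd e P (Function.update x l (y i)) =
      (∏ j ∈ Finset.Iio l, s j) •
        tupleProd e P (Function.update x l fun k => ∑ i, c i * y i k) := by
  have h1 : ∀ i, c i * tupleProd e P (Function.update x l (y i)) =
      (∏ j ∈ Finset.Iio l, s j) •
        tupleProd e P (Function.update x l fun k => c i * y i k) := by
    intro i
    simp only [tupleProd, Finset.mul_sum, Finset.smul_sum]
    refine Finset.sum_congr rfl fun K _ => ?_
    rw [mul_smul_comm, smul_comm]
    congr 1
    rw [update_eval, update_eval]
    exact mul_prod_ofFn_update _ s _ _ _ fun j hj => h i j hj _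
  simp only [h1]
  rw [← Finset.smul_sum, tupleProd_update_sum]
  congr 3
  funext k
  simp

theorem derivation_tupleProd {r : ℕ} (P : ContinuousMultilinearMap ℝ (fun _ : Fin r => V) ℝ)
    (D : A →ₗ[ℝ] A) (hD : D 1 = 0) (x : Fin r → κ → A) (s : Fin r → ℝ)
    (h : ∀ j k z, D (x j k * z) = D (x j k) * z + s j • (x j k * D z)) :
    D (tupleProd e P x) = ∑ l, (∏ j ∈ Finset.Iio l, s j) •
      tupleProd e P (Function.update x l fun k => D (x l k)) := by
  simp only [tupleProd, map_sum, map_smul, Finset.smul_sum]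
  rw [Finset.sum_comm]
  refine Finset.sum_congr rfl fun K _ => ?_
  rw [derivation_prod_ofFn D hD _ s fun j z => h j (K j) z, Finset.smul_sum]
  refine Finset.sum_congr rfl fun l _ => ?_
  rw [smul_comm, update_eval]

/-- For symmetric coefficients the summation indices can be permuted along with the factors, so only
the reordering of the algebra elements matters. -/
theorem tupleProd_comp_perm {r : ℕ} (P : ContinuousMultilinearMap ℝ (fun _ : Fin r => V) ℝ)
    (σ : Equiv.Perm (Fin r)) (hP : ∀ v : Fin r → V, P (fun i => v (σ i)) = P v) (s : ℝ)
    (x : Fin r → κ → A)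
    (h : ∀ K : Fin r → κ, (List.ofFn fun i => x (σ i) (K (σ i))).prod =
      s • (List.ofFn fun i => x i (K i)).prod) :
    tupleProd e P (fun i => x (σ i)) = s • tupleProd e P x := by
  simp only [tupleProd, Finset.smul_sum]
  rw [← (Equiv.arrowCongr σ.symm (Equiv.refl κ)).sum_comp]
  refine Finset.sum_congr rfl fun K _ => ?_
  have h1 : ∀ i, (Equiv.arrowCongr σ.symm (Equiv.refl κ)) K i = K (σ i) := fun i => by
    simp [Equiv.arrowCongr]
  simp only [h1]
  rw [h, hP fun i => e (K i), smul_comm]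

theorem tupleProd_cons_cons_swap {n : ℕ}
    (P : ContinuousMultilinearMap ℝ (fun _ : Fin (n + 2) => V) ℝ)
    (hP : ∀ v : Fin (n + 2) → V, P (fun i => v (Equiv.swap 0 1 i)) = P v) (s : ℝ)
    (x y : κ → A) (t : Fin n → κ → A) (h : ∀ k k', y k * x k' = s • (x k' * y k)) :
    tupleProd e P (Fin.cons y (Fin.cons x t : Fin (n + 1) → κ → A) : Fin (n + 2) → κ → A) =
      s • tupleProd e P (Fin.cons x (Fin.cons y t : Fin (n + 1) → κ → A)) := by
  rw [← tupleProd_comp_perm e P (Equiv.swap 0 1) hP s]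
  · congr 1
    funext i
    refine Fin.cases ?_ (fun i => Fin.cases ?_ (fun i => ?_) i) i
    · rw [Equiv.swap_apply_left, ← Fin.succ_zero_eq_one]; simp
    · rw [Fin.succ_zero_eq_one, Equiv.swap_apply_right, ← Fin.succ_zero_eq_one]; simp
    · rw [Equiv.swap_apply_of_ne_of_ne (Fin.succ_ne_zero _)
        (by rw [← Fin.succ_zero_eq_one]; exact fun h => Fin.succ_ne_zero _ (Fin.succ_injective _ h))]
      simp
  · intro K
    have h2 : ∀ i : Fin n, Equiv.swap (0 : Fin (n + 2)) 1 i.succ.succ = i.succ.succ := fun i =>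
      Equiv.swap_apply_of_ne_of_ne (Fin.succ_ne_zero _)
        (by rw [← Fin.succ_zero_eq_one]; exact fun h => Fin.succ_ne_zero _ (Fin.succ_injective _ h))
    simp only [List.ofFn_succ, List.prod_cons, Fin.succ_zero_eq_one, Equiv.swap_apply_left,
      Equiv.swap_apply_right, h2]
    simp only [← Fin.succ_zero_eq_one, Fin.cons_succ, Fin.cons_zero]
    rw [← mul_assoc, h, smul_mul_assoc, mul_assoc]

/-- The repeated factor z has central entries, so the exceptional factor y can be moved to the
second place without a sign. This makes the n + 1 terms in which one curvature is replaced equal to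
each other. -/
theorem tupleProd_cons_update {n : ℕ}
    (P : ContinuousMultilinearMap ℝ (fun _ : Fin (n + 2) => V) ℝ)
    (hP : ∀ (σ : Equiv.Perm (Fin (n + 2))) (v : Fin (n + 2) → V), P (fun i => v (σ i)) = P v)
    (u y z : κ → A) (hz : ∀ k a, Commute (z k) a) (l : Fin (n + 1)) :
    tupleProd e P (Fin.cons u (Function.update (fun _ => z) l y : Fin (n + 1) → κ → A) :
        Fin (n + 2) → κ → A) =
      tupleProd e P (Fin.cons u (Fin.cons y fun _ => z : Fin (n + 1) → κ → A)) := by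
  set τ : Equiv.Perm (Fin (n + 1)) := Equiv.swap 0 l with hτ
  have hswap : ∀ i : Fin (n + 1), Equiv.swap (1 : Fin (n + 2)) l.succ i.succ = (τ i).succ := by
    intro i
    rw [← Fin.succ_zero_eq_one, hτ]
    exact (Fin.succ_injective _).swap_apply _ _ _
  have hswap0 : Equiv.swap (1 : Fin (n + 2)) l.succ 0 = 0 :=
    Equiv.swap_apply_of_ne_of_ne (by rw [← Fin.succ_zero_eq_one]; exact (Fin.succ_ne_zero _).symm)
      (Fin.succ_ne_zero _).symm
  have hw : ∀ i, (Fin.cons y fun _ => z : Fin (n + 1) → κ → A) (τ i) =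
      (Function.update (fun _ => z) l y : Fin (n + 1) → κ → A) i := by
    intro i
    by_cases hi : i = l
    · subst hi; simp [hτ]
    · rw [Function.update_of_ne hi]
      by_cases h0 : i = 0
      · subst h0
        rw [hτ, Equiv.swap_apply_left]
        obtain ⟨j, rfl⟩ := Fin.exists_succ_eq_of_ne_zero (Ne.symm hi)
        simp
      · rw [hτ, Equiv.swap_apply_of_ne_of_ne h0 hi]
        obtain ⟨j, rfl⟩ := Fin.exists_succ_eq_of_ne_zero h0
        simp
  have := tupleProd_comp_perm e P (Equiv.swap 1 l.succ) (hP _) 1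
    (Fin.cons u (Fin.cons y fun _ => z : Fin (n + 1) → κ → A) : Fin (n + 2) → κ → A) (by
      intro K
      have hl : ∀ f : Fin (n + 2) → A,
          (List.ofFn f).prod = f 0 * (List.ofFn fun i => f i.succ).prod := fun f => by
        rw [List.ofFn_succ, List.prod_cons]
      rw [one_smul, hl, hl]
      simp only [hswap, hswap0, Fin.cons_succ, Fin.cons_zero]
      congr 1
      -- The two products differ by a permutation of pairwise commuting elements: of any two
      -- distinct factors at least one is an entry of z.
      refine List.Perm.prod_eq' ?_ ?_
      · exact Equiv.Perm.ofFn_comp_perm τ fun i =>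
          (Fin.cons y fun _ => z : Fin (n + 1) → κ → A) i (K i.succ)
      · rw [List.pairwise_ofFn]
        intro i j hij
        have hj : ∀ i j : Fin (n + 1), i ≠ j →
            Commute ((Fin.cons y fun _ => z : Fin (n + 1) → κ → A) i (K i.succ))
              ((Fin.cons y fun _ => z : Fin (n + 1) → κ → A) j (K j.succ)) := by
          intro i j hij
          by_cases h0 : i = 0
          · obtain ⟨j, rfl⟩ := Fin.exists_succ_eq_of_ne_zero (h0 ▸ hij.symm)
            exact (hz _ _).symm
          · obtain ⟨i, rfl⟩ := Fin.exists_succ_eq_of_ne_zero h0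
            exact hz _ _
        exact hj _ _ fun h => by
          have := τ.injective h
          omega)
  rw [one_smul] at this
  rw [← this]
  congr 1
  funext i
  refine Fin.cases ?_ (fun i => ?_) i
  · rw [hswap0]; rfl
  · rw [hswap, Fin.cons_succ, Fin.cons_succ, hw]

theorem tupleProd_two (P : ContinuousMultilinearMap ℝ (fun _ : Fin 2 => V) ℝ)
    (x : Fin 2 → κ → A) :
    tupleProd e P x = ∑ i, ∑ j, P ![e i, e j] • (x 0 i * x 1 j) := by
  rw [tupleProd, ← (finTwoArrowEquiv κ).symm.sum_comp, Fintype.sum_prod_type]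
  refine Finset.sum_congr rfl fun i _ => Finset.sum_congr rfl fun j _ => ?_
  simp only [List.ofFn_succ, List.ofFn_zero, List.prod_cons, List.prod_nil, mul_one]
  congr 2
  funext k
  fin_cases k <;> rfl

end TupleProd

/-! ### Graded commutativity -/

section Graded

variable {E : Type*} [NormedAddCommGroup E] [NormedSpace ℝ E]
  {ι : Type*} [Fintype ι] (b : Module.Basis ι ℝ E)

open ExteriorAlgebra

theorem ι_mul_ιMulti {M : Type*} [AddCommGroup M] [Module ℝ M] (f : M) {p : ℕ} (g : Fin p → M) :
    ExteriorAlgebra.ι ℝ f * ιMulti ℝ p g =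
      ((-1 : ℝ) ^ p) • (ιMulti ℝ p g * ExteriorAlgebra.ι ℝ f) := by
  induction p with
  | zero => simp
  | succ p ih =>
    have h := eq_neg_of_add_eq_zero_left (ι_add_mul_swap (R := ℝ) f (g 0))
    rw [ιMulti_succ_apply, ← mul_assoc, h, neg_mul, mul_assoc, ih, mul_smul_comm, pow_succ,
      mul_neg_one, neg_smul, mul_assoc]

theorem ι_mul_toExt (f : Module.Dual ℝ E) {p : ℕ} (η : E [⋀^Fin p]→L[ℝ] ℝ) :
    ExteriorAlgebra.ι ℝ f * toExt b p η =
      ((-1 : ℝ) ^ p) • (toExt b p η * ExteriorAlgebra.ι ℝ f) := by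
  rw [toExt_apply, mul_smul_comm, smul_mul_assoc, smul_comm ((-1 : ℝ) ^ p), Finset.mul_sum,
    Finset.sum_mul, Finset.smul_sum (r := (-1 : ℝ) ^ p)]
  refine congrArg _ (Finset.sum_congr rfl fun J _ => ?_)
  rw [mul_smul_comm, smul_mul_assoc, smul_comm, ι_mul_ιMulti]

/-- An element of even degree commutes with the generators, and these generate the algebra. -/
theorem commute_toExt_two (η : E [⋀^Fin 2]→L[ℝ] ℝ) (x : CoExt E) : Commute (toExt b 2 η) x := by
  induction x using ExteriorAlgebra.induction with
  | algebraMap r => exact Algebra.commutes' r _ |>.symm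
  | ι f => 
    have := ι_mul_toExt b f η
    rw [neg_one_sq, one_smul] at this
    exact this.symm
  | mul x y hx hy => exact hx.mul_right hy
  | add x y hx hy => exact hx.add_right hy

theorem exists_toExt_one (η : E [⋀^Fin 1]→L[ℝ] ℝ) :
    ∃ f, toExt b 1 η = ExteriorAlgebra.ι ℝ f := by
  refine ⟨((Nat.factorial 1 : ℝ))⁻¹ •
    ∑ J : Fin 1 → ι, η (fun j => b (J j)) • b.coord (J 0), ?_⟩
  rw [toExt_apply, map_smul, map_sum]
  congr 1
  refine Finset.sum_congr rfl fun J _ => ?_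
  rw [map_smul, ιMulti_apply]
  simp

open CliffordAlgebra in
theorem contractLeft_ιMulti_mul (d : Module.Dual ℝ (Module.Dual ℝ E)) {p : ℕ}
    (g : Fin p → Module.Dual ℝ E) (z : CoExt E) :
    contractLeft (Q := (0 : QuadraticForm ℝ (Module.Dual ℝ E))) d (ιMulti ℝ p g * z) =
      contractLeft (Q := (0 : QuadraticForm ℝ (Module.Dual ℝ E))) d (ιMulti ℝ p g) * z +
        ((-1 : ℝ) ^ p) • (ιMulti ℝ p g *
          contractLeft (Q := (0 : QuadraticForm ℝ (Module.Dual ℝ E))) d z) := by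
  induction p with
  | zero =>
    rw [ιMulti_zero_apply, one_mul, pow_zero, one_smul, one_mul,
      show contractLeft (Q := (0 : QuadraticForm ℝ (Module.Dual ℝ E))) d 1 = 0 from
        contractLeft_one _ _, zero_mul, zero_add]
  | succ p ih =>
    rw [ιMulti_succ_apply, mul_assoc, ExteriorAlgebra.ι, contractLeft_ι_mul, contractLeft_ι_mul, ih,
      sub_mul, mul_add, mul_smul_comm, smul_mul_assoc, pow_succ, mul_neg_one, neg_smul, mul_assoc,
      mul_assoc]
    abel

open CliffordAlgebra in
-- The antiderivation property of contraction, with the sign determined by the degree of the left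
-- factor; it supplies the signs required by `derivation_tupleProd`.
theorem contractLeft_toExt_mul (d : Module.Dual ℝ (Module.Dual ℝ E)) {p : ℕ}
    (η : E [⋀^Fin p]→L[ℝ] ℝ) (z : CoExt E) :
    contractLeft (Q := (0 : QuadraticForm ℝ (Module.Dual ℝ E))) d (toExt b p η * z) =
      contractLeft (Q := (0 : QuadraticForm ℝ (Module.Dual ℝ E))) d (toExt b p η) * z +
        ((-1 : ℝ) ^ p) • (toExt b p η *
          contractLeft (Q := (0 : QuadraticForm ℝ (Module.Dual ℝ E))) d z) := by
  rw [toExt_apply, smul_mul_assoc, map_smul, map_smul, smul_mul_assoc, smul_mul_assoc, smul_comm,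
    ← smul_add]
  congr 1
  rw [Finset.sum_mul, Finset.sum_mul, map_sum, map_sum, Finset.smul_sum, Finset.sum_mul,
    ← Finset.sum_add_distrib]
  refine Finset.sum_congr rfl fun J _ => ?_
  rw [smul_mul_assoc, map_smul, map_smul, smul_mul_assoc, smul_mul_assoc, smul_comm, ← smul_add,
    contractLeft_ιMulti_mul]

end Graded

/-! ### Identities for wedge products -/

section WedgeIdentities

open ContinuousAlternatingMap (alternatizeUncurryFin alternatizeUncurryFin_apply)

variable {E : Type*} [NormedAddCommGroup E] [NormedSpace ℝ E]
  {V : Type*} [NormedAddCommGroup V] [NormedSpace ℝ V]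
  {W : Type*} [NormedAddCommGroup W] [NormedSpace ℝ W]

theorem compContinuousAlternatingMap_alternatizeUncurryFin {U : Type*} [NormedAddCommGroup U]
    [NormedSpace ℝ U] {p : ℕ} (l : V →L[ℝ] U) (L : E →L[ℝ] E [⋀^Fin p]→L[ℝ] V)
    (L' : E →L[ℝ] E [⋀^Fin p]→L[ℝ] U) (h : ∀ v, L' v = l.compContinuousAlternatingMap (L v)) :
    l.compContinuousAlternatingMap (alternatizeUncurryFin L) = alternatizeUncurryFin L' := by
  ext v
  simp only [ContinuousLinearMap.compContinuousAlternatingMap_coe, Function.comp_apply,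
    alternatizeUncurryFin_apply, map_sum, h]
  refine Finset.sum_congr rfl fun i _ => ?_
  rcases Nat.even_or_odd (i : ℕ) with he | ho
  · simp [he.neg_one_pow]
  · simp [ho.neg_one_pow]

theorem toExt_compContinuousAlternatingMap_alternatizeUncurryFin [FiniteDimensional ℝ E]
    {ι : Type*} [Fintype ι] (b : Module.Basis ι ℝ E) {p : ℕ} (l : V →L[ℝ] ℝ) (L : E →L[ℝ] E [⋀^Fin p]→L[ℝ] V) :
    toExt b (p + 1) (l.compContinuousAlternatingMap (alternatizeUncurryFin L)) =
      ∑ i, ExteriorAlgebra.ι ℝ (b.coord i) *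
        toExt b p (l.compContinuousAlternatingMap (L (b i))) := by
  let L' : E →ₗ[ℝ] E [⋀^Fin p]→L[ℝ] ℝ :=
    { toFun := fun v => l.compContinuousAlternatingMap (L v)
      map_add' := fun v w => by ext; simp
      map_smul' := fun c v => by ext; simp }
  rw [compContinuousAlternatingMap_alternatizeUncurryFin l L (LinearMap.toContinuousLinearMap L')
    fun _ => rfl, toExt_alternatizeUncurryFin]
  rfl

variable [FiniteDimensional ℝ V]

theorem extCoord_update {ι κ : Type*} [Fintype ι]
    (b : Module.Basis ι ℝ E) (e : Module.Basis κ ℝ V) {r : ℕ} {p : Fin r → ℕ}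
    (Z : ∀ i, E [⋀^Fin (p i)]→L[ℝ] V) (l : Fin r) (y : E [⋀^Fin (p l)]→L[ℝ] V) :
    (fun i => extCoord b e (p i) (Function.update Z l y i)) =
      Function.update (fun i => extCoord b e (p i) (Z i)) l (extCoord b e (p l) y) := by
  funext i
  by_cases hi : i = l
  · subst hi; simp
  · simp [hi]

theorem extCoord_factors {ι κ : Type*} [Fintype ι]
    (b : Module.Basis ι ℝ E) (e : Module.Basis κ ℝ V) {m a c : ℕ}
    (α : E [⋀^Fin a]→L[ℝ] V) (β : E [⋀^Fin c]→L[ℝ] V) (F : E [⋀^Fin 2]→L[ℝ] V) :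
    (fun i : Fin (m + 2) => extCoord b e (degs a c i) (factors α β F i)) =
      Fin.cons (extCoord b e a α) (Fin.cons (extCoord b e c β) fun _ => extCoord b e 2 F :
        Fin (m + 1) → κ → CoExt E) := by
  funext i
  refine Fin.cases ?_ (fun i => Fin.cases ?_ (fun i => ?_) i) i <;> rfl

theorem commute_extCoord_two {ι κ : Type*} [Fintype ι]
    (b : Module.Basis ι ℝ E) (e : Module.Basis κ ℝ V) (F : E [⋀^Fin 2]→L[ℝ] V) (k : κ)
    (x : CoExt E) : Commute (extCoord b e 2 F k) x :=
  commute_toExt_two b _ x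

variable [FiniteDimensional ℝ E]

theorem extCoord_alternatizeUncurryFin {ι κ : Type*} [Fintype ι]
    (b : Module.Basis ι ℝ E) (e : Module.Basis κ ℝ V) {p : ℕ}
    (L : E →L[ℝ] E [⋀^Fin p]→L[ℝ] V) :
    extCoord b e (p + 1) (alternatizeUncurryFin L) =
      fun k => ∑ i, ExteriorAlgebra.ι ℝ (b.coord i) * extCoord b e p (L (b i)) k := by
  funext k
  simp only [extCoord_apply]
  rw [toExt_compContinuousAlternatingMap_alternatizeUncurryFin]

/-- L stands for the derivative of the l-th factor. Each covector of the alternatization must pass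
the first l factors to reach slot l, which produces the sign; there the covectors assemble into the
alternatization of L itself. -/
theorem toExt_alternatizeUncurryFin_wedge {ι κ : Type*} [Fintype ι] [Fintype κ]
    (b : Module.Basis ι ℝ E) (e : Module.Basis κ ℝ V)
    {r N : ℕ} {p : Fin r → ℕ} (h : ∑ i, p i = N)
    (P : ContinuousMultilinearMap ℝ (fun _ : Fin r => V) W)
    (Z : ∀ i, E [⋀^Fin (p i)]→L[ℝ] V) (l : Fin r) (L : E →L[ℝ] E [⋀^Fin (p l)]→L[ℝ] V)
    (f : W →L[ℝ] ℝ) :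
    toExt b (N + 1) (f.compContinuousAlternatingMap
        (alternatizeUncurryFin ((wedgeCM h P).toContinuousLinearMap Z l ∘L L))) =
      (∏ j ∈ Finset.Iio l, (-1 : ℝ) ^ p j) • tupleProd e (f.compContinuousMultilinearMap P)
        (Function.update (fun i => extCoord b e (p i) (Z i)) l
          (extCoord b e (p l + 1) (alternatizeUncurryFin L))) := by
  rw [toExt_compContinuousAlternatingMap_alternatizeUncurryFin, extCoord_alternatizeUncurryFin,
    ← sum_mul_tupleProd_update e (f.compContinuousMultilinearMap P)
      (fun i => extCoord b e (p i) (Z i)) l (fun i => ExteriorAlgebra.ι ℝ (b.coord i))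
      (fun i => extCoord b e (p l) (L (b i)))
      (fun j => (-1 : ℝ) ^ p j) fun i j _ k => ι_mul_toExt b _ _]
  refine Finset.sum_congr rfl fun i _ => ?_
  congr 1
  rw [ContinuousLinearMap.comp_apply]
  change toExt b N (f.compContinuousAlternatingMap (wedge h P (Function.update Z l (L (b i))))) = _
  rw [compContinuousAlternatingMap_wedge, toExt_wedge b e, extCoord_update]

/-- For the slots that carry a curvature only the vanishing of the differentiated factor is needed,
so no form of raised degree has to be named. -/
theorem alternatizeUncurryFin_wedge_eq_zero {r N : ℕ} {p : Fin r → ℕ} (h : ∑ i, p i = N)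
    (P : ContinuousMultilinearMap ℝ (fun _ : Fin r => V) W)
    (Z : ∀ i, E [⋀^Fin (p i)]→L[ℝ] V) (l : Fin r) (L : E →L[ℝ] E [⋀^Fin (p l)]→L[ℝ] V)
    (hL : alternatizeUncurryFin L = 0) :
    alternatizeUncurryFin ((wedgeCM h P).toContinuousLinearMap Z l ∘L L) = 0 := by
  refine ContinuousAlternatingMap.ext_dual fun f =>
    toExt_injective (Module.finBasis ℝ E) _ ?_
  rw [toExt_alternatizeUncurryFin_wedge _ (Module.finBasis ℝ V), hL, map_zero,
    tupleProd_update_zero, smul_zero,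
    show f.compContinuousAlternatingMap (0 : E [⋀^Fin (N + 1)]→L[ℝ] W) = 0 by ext; simp, map_zero]

/-- The factors are compared through their components because the components have a type independent
of the degree; for the forms themselves, updating the l-th one would change the type of the family.
-/
theorem alternatizeUncurryFin_wedge {r N : ℕ} {p p' : Fin r → ℕ} (h : ∑ i, p i = N)
    (h' : ∑ i, p' i = N + 1)
    (P : ContinuousMultilinearMap ℝ (fun _ : Fin r => V) W)
    (Z : ∀ i, E [⋀^Fin (p i)]→L[ℝ] V) (l : Fin r) (L : E →L[ℝ] E [⋀^Fin (p l)]→L[ℝ] V)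
    (Z' : ∀ i, E [⋀^Fin (p' i)]→L[ℝ] V)
    (hZ : (fun i => extCoord (Module.finBasis ℝ E) (Module.finBasis ℝ V) (p' i) (Z' i)) =
      Function.update (fun i => extCoord (Module.finBasis ℝ E) (Module.finBasis ℝ V) (p i) (Z i)) l
        (extCoord (Module.finBasis ℝ E) (Module.finBasis ℝ V) (p l + 1)
          (alternatizeUncurryFin L))) :
    alternatizeUncurryFin ((wedgeCM h P).toContinuousLinearMap Z l ∘L L) =
      (∏ j ∈ Finset.Iio l, (-1 : ℝ) ^ p j) • wedge h' P Z' := by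
  refine ContinuousAlternatingMap.ext_dual fun f =>
    toExt_injective (Module.finBasis ℝ E) _ ?_
  rw [toExt_alternatizeUncurryFin_wedge _ (Module.finBasis ℝ V),
    show f.compContinuousAlternatingMap ((∏ j ∈ Finset.Iio l, (-1 : ℝ) ^ p j) • wedge h' P Z') =
      (∏ j ∈ Finset.Iio l, (-1 : ℝ) ^ p j) • f.compContinuousAlternatingMap (wedge h' P Z') by
      ext; simp, map_smul, compContinuousAlternatingMap_wedge,
    toExt_wedge _ (Module.finBasis ℝ V), hZ]

theorem alternatizeUncurryFin_wedge_factors_zero {m a c N : ℕ}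
    (h : ∑ i : Fin (m + 2), degs a c i = N) (h' : ∑ i : Fin (m + 2), degs (a + 1) c i = N + 1)
    (P : ContinuousMultilinearMap ℝ (fun _ : Fin (m + 2) => V) W)
    (L : E →L[ℝ] E [⋀^Fin a]→L[ℝ] V) (α : E [⋀^Fin a]→L[ℝ] V)
    (β : E [⋀^Fin c]→L[ℝ] V) (F : E [⋀^Fin 2]→L[ℝ] V) :
    alternatizeUncurryFin ((wedgeCM h P).toContinuousLinearMap (factors α β F) 0 ∘L L) =
      wedge h' P (factors (alternatizeUncurryFin L) β F) := by
  rw [alternatizeUncurryFin_wedge h h' P (factors α β F) 0 L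
    (factors (alternatizeUncurryFin L) β F)]
  · rw [show Finset.Iio (0 : Fin (m + 2)) = ∅ by ext; simp, Finset.prod_empty, one_smul]
  · rw [extCoord_factors, extCoord_factors, Fin.update_cons_zero]
    rfl

theorem alternatizeUncurryFin_wedge_factors_one {m a c N : ℕ}
    (h : ∑ i : Fin (m + 2), degs a c i = N) (h' : ∑ i : Fin (m + 2), degs a (c + 1) i = N + 1)
    (P : ContinuousMultilinearMap ℝ (fun _ : Fin (m + 2) => V) W)
    (L : E →L[ℝ] E [⋀^Fin c]→L[ℝ] V) (α : E [⋀^Fin a]→L[ℝ] V)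
    (β : E [⋀^Fin c]→L[ℝ] V) (F : E [⋀^Fin 2]→L[ℝ] V) :
    alternatizeUncurryFin ((wedgeCM h P).toContinuousLinearMap (factors α β F) (Fin.succ 0) ∘L L) =
      ((-1 : ℝ) ^ a) • wedge h' P (factors α (alternatizeUncurryFin L) F) := by
  rw [alternatizeUncurryFin_wedge h h' P (factors α β F) (Fin.succ 0) L
    (factors α (alternatizeUncurryFin L) F)]
  · rw [show Finset.Iio (Fin.succ 0 : Fin (m + 2)) = {0} by
      ext i
      refine Fin.cases (by simp) (fun i => ?_) i
      simp [Fin.lt_def], Finset.prod_singleton]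
    rfl
  · rw [extCoord_factors, extCoord_factors, ← Fin.cons_update,
      Fin.update_cons_zero]
    rfl

/-- Equality of wedge products can be checked in the exterior algebra. -/
theorem wedge_eq_of_tupleProd {r r' N : ℕ} {p : Fin r → ℕ} {p' : Fin r' → ℕ} (h : ∑ i, p i = N)
    (h' : ∑ i, p' i = N) (P : ContinuousMultilinearMap ℝ (fun _ : Fin r => V) W)
    (P' : ContinuousMultilinearMap ℝ (fun _ : Fin r' => V) W)
    (Z : ∀ i, E [⋀^Fin (p i)]→L[ℝ] V) (Z' : ∀ i, E [⋀^Fin (p' i)]→L[ℝ] V) (s : ℝ)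
    (H : ∀ f : W →L[ℝ] ℝ,
      tupleProd (Module.finBasis ℝ V) (f.compContinuousMultilinearMap P)
        (fun i => extCoord (Module.finBasis ℝ E) (Module.finBasis ℝ V) (p i) (Z i)) =
      s • tupleProd (Module.finBasis ℝ V) (f.compContinuousMultilinearMap P')
        (fun i => extCoord (Module.finBasis ℝ E) (Module.finBasis ℝ V) (p' i) (Z' i))) :
    wedge h P Z = s • wedge h' P' Z' := by
  refine ContinuousAlternatingMap.ext_dual fun f =>
    toExt_injective (Module.finBasis ℝ E) _ ?_
  rw [show f.compContinuousAlternatingMap (s • wedge h' P' Z') =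
      s • f.compContinuousAlternatingMap (wedge h' P' Z') by
      ext; simp, map_smul, compContinuousAlternatingMap_wedge, compContinuousAlternatingMap_wedge,
    toExt_wedge _ (Module.finBasis ℝ V), toExt_wedge _ (Module.finBasis ℝ V), H]

theorem wedge_factors_swap {m a c N : ℕ} (h : ∑ i : Fin (m + 2), degs a c i = N)
    (h' : ∑ i : Fin (m + 2), degs c a i = N)
    (P : ContinuousMultilinearMap ℝ (fun _ : Fin (m + 2) => V) W)
    (hP : ∀ (σ : Equiv.Perm (Fin (m + 2))) (v : Fin (m + 2) → V), P (fun i => v (σ i)) = P v)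
    (α : E [⋀^Fin a]→L[ℝ] V) (β : E [⋀^Fin c]→L[ℝ] V) (F : E [⋀^Fin 2]→L[ℝ] V) (s : ℝ)
    (hs : ∀ (x : E [⋀^Fin a]→L[ℝ] ℝ) (y : E [⋀^Fin c]→L[ℝ] ℝ),
      toExt (Module.finBasis ℝ E) a x * toExt (Module.finBasis ℝ E) c y =
        s • (toExt (Module.finBasis ℝ E) c y * toExt (Module.finBasis ℝ E) a x)) :
    wedge h P (factors α β F) = s • wedge h' P (factors β α F) := by
  refine wedge_eq_of_tupleProd h h' P P _ _ s fun f => ?_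
  rw [extCoord_factors, extCoord_factors]
  refine tupleProd_cons_cons_swap _ _ (fun v => ?_) s _ _ _ fun k k' => hs _ _
  simp only [ContinuousLinearMap.compContinuousMultilinearMap_coe, Function.comp_apply, hP]

theorem wedge_factors_swap_one_two {m N : ℕ} (h : ∑ i : Fin (m + 2), degs 1 2 i = N)
    (h' : ∑ i : Fin (m + 2), degs 2 1 i = N)
    (P : ContinuousMultilinearMap ℝ (fun _ : Fin (m + 2) => V) W)
    (hP : ∀ (σ : Equiv.Perm (Fin (m + 2))) (v : Fin (m + 2) → V), P (fun i => v (σ i)) = P v)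
    (α : E [⋀^Fin 1]→L[ℝ] V) (β F : E [⋀^Fin 2]→L[ℝ] V) :
    wedge h P (factors α β F) = wedge h' P (factors β α F) := by
  rw [wedge_factors_swap h h' P hP α β F 1 fun x y => by
    rw [one_smul]; exact (commute_toExt_two _ y _).symm, one_smul]

theorem wedge_factors_swap_one_one {m N : ℕ} (h : ∑ i : Fin (m + 2), degs 1 1 i = N)
    (P : ContinuousMultilinearMap ℝ (fun _ : Fin (m + 2) => V) W)
    (hP : ∀ (σ : Equiv.Perm (Fin (m + 2))) (v : Fin (m + 2) → V), P (fun i => v (σ i)) = P v)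
    (α β : E [⋀^Fin 1]→L[ℝ] V) (F : E [⋀^Fin 2]→L[ℝ] V) :
    wedge h P (factors α β F) = -wedge h P (factors β α F) := by
  rw [wedge_factors_swap h h P hP α β F (-1) fun x y => by
    obtain ⟨f, hf⟩ := exists_toExt_one (Module.finBasis ℝ E) x
    rw [hf, ι_mul_toExt, pow_one], neg_one_smul]

/-- All factors after the first are two-forms, hence central, so the replaced one can be taken to be
the second. The replacement is compared through components since its degree equals 2 only after a
case distinction on the slot. -/
theorem wedge_factors_update_succ {m a N : ℕ} (h : ∑ i : Fin (m + 2), degs a 2 i = N)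
    (P : ContinuousMultilinearMap ℝ (fun _ : Fin (m + 2) => V) W)
    (hP : ∀ (σ : Equiv.Perm (Fin (m + 2))) (v : Fin (m + 2) → V), P (fun i => v (σ i)) = P v)
    (α : E [⋀^Fin a]→L[ℝ] V) (F : E [⋀^Fin 2]→L[ℝ] V) (l : Fin (m + 1))
    (X : E [⋀^Fin (degs a 2 l.succ)]→L[ℝ] V) (Y : E [⋀^Fin 2]→L[ℝ] V)
    (hXY : extCoord (Module.finBasis ℝ E) (Module.finBasis ℝ V) _ X =
      extCoord (Module.finBasis ℝ E) (Module.finBasis ℝ V) _ Y) :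
    wedge h P (Function.update (factors α F F) l.succ X) = wedge h P (factors α Y F) := by
  rw [← one_smul ℝ (wedge h P (factors α Y F))]
  refine wedge_eq_of_tupleProd h h P P _ _ 1 fun f => ?_
  rw [extCoord_update, extCoord_factors, extCoord_factors, one_smul, hXY,
    ← tupleProd_cons_update (Module.finBasis ℝ V) _ (fun σ v => by
      simp only [ContinuousLinearMap.compContinuousMultilinearMap_coe, Function.comp_apply, hP])
      _ _ _ (fun k x => commute_extCoord_two _ _ F k x) l, ← Fin.cons_update]
  congr 3
  funext i
  refine Fin.cases ?_ (fun i => ?_) i <;> rfl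

omit [FiniteDimensional ℝ E] in
/-- The components of the contraction of a wedge product. -/
theorem toExt_curryLeft_wedge {ι κ : Type*} [Fintype ι] [Fintype κ]
    (b : Module.Basis ι ℝ E) (e : Module.Basis κ ℝ V)
    {r N : ℕ} {p : Fin r → ℕ} (h : ∑ i, p i = N + 1)
    (P : ContinuousMultilinearMap ℝ (fun _ : Fin r => V) W)
    (Z : ∀ i, E [⋀^Fin (p i)]→L[ℝ] V) (v : E) (f : W →L[ℝ] ℝ) :
    toExt b N (f.compContinuousAlternatingMap ((wedge h P Z).curryLeft v)) =
      ∑ l, (∏ j ∈ Finset.Iio l, (-1 : ℝ) ^ p j) • tupleProd e (f.compContinuousMultilinearMap P)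
        (Function.update (fun i => extCoord b e (p i) (Z i)) l fun k =>
          CliffordAlgebra.contractLeft (Q := (0 : QuadraticForm ℝ (Module.Dual ℝ E)))
            (Module.Dual.eval ℝ E v) (extCoord b e (p l) (Z l) k)) := by
  rw [← derivation_tupleProd e (f.compContinuousMultilinearMap P)
    (CliffordAlgebra.contractLeft (Q := (0 : QuadraticForm ℝ (Module.Dual ℝ E)))
            (Module.Dual.eval ℝ E v)) (CliffordAlgebra.contractLeft_one _ _)
    (fun i => extCoord b e (p i) (Z i)) (fun j => (-1 : ℝ) ^ p j)
    fun j k z => contractLeft_toExt_mul b _ _ z, ← toExt_wedge b e h, contractLeft_toExt,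
    ← compContinuousAlternatingMap_wedge]
  rfl

omit [FiniteDimensional ℝ E] in
theorem contractLeft_extCoord {ι κ : Type*} [Fintype ι]
    (b : Module.Basis ι ℝ E) (e : Module.Basis κ ℝ V) {p : ℕ} (Z : E [⋀^Fin (p + 1)]→L[ℝ] V)
    (v : E) (k : κ) :
    CliffordAlgebra.contractLeft (Q := (0 : QuadraticForm ℝ (Module.Dual ℝ E)))
      (Module.Dual.eval ℝ E v) (extCoord b e (p + 1) Z k) = extCoord b e p (Z.curryLeft v) k := by
  rw [extCoord_apply, contractLeft_toExt]
  rfl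

omit [FiniteDimensional ℝ E] in
-- Contraction is an antiderivation. It hits α once, and it hits each of the m + 1 copies of F with
-- the same result, since a two-form can be passed without a sign.
theorem toExt_curryLeft_wedge_two {ι κ : Type*} [Fintype ι] [Fintype κ]
    (b : Module.Basis ι ℝ E) (e : Module.Basis κ ℝ V)
    {m a N : ℕ} (h : ∑ i : Fin (m + 2), degs a 2 i = N + 1)
    (P : ContinuousMultilinearMap ℝ (fun _ : Fin (m + 2) => V) W)
    (hP : ∀ (σ : Equiv.Perm (Fin (m + 2))) (v : Fin (m + 2) → V), P (fun i => v (σ i)) = P v)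
    (α : E [⋀^Fin a]→L[ℝ] V) (F : E [⋀^Fin 2]→L[ℝ] V) (v : E) (f : W →L[ℝ] ℝ) :
    toExt b N (f.compContinuousAlternatingMap ((wedge h P (factors α F F)).curryLeft v)) =
      tupleProd e (f.compContinuousMultilinearMap P) (Fin.cons (fun k =>
          CliffordAlgebra.contractLeft (Q := (0 : QuadraticForm ℝ (Module.Dual ℝ E)))
            (Module.Dual.eval ℝ E v) (extCoord b e a α k))
        (Fin.cons (extCoord b e 2 F) fun _ => extCoord b e 2 F : Fin (m + 1) → κ → CoExt E)) +
      ((m + 1 : ℝ) * (-1) ^ a) • tupleProd e (f.compContinuousMultilinearMap P)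
        (Fin.cons (extCoord b e a α) (Fin.cons (extCoord b e 1 (F.curryLeft v))
          fun _ => extCoord b e 2 F : Fin (m + 1) → κ → CoExt E)) := by
  rw [toExt_curryLeft_wedge b e, extCoord_factors, Fin.sum_univ_succ]
  congr 1
  · rw [show Finset.Iio (0 : Fin (m + 2)) = ∅ by ext; simp, Finset.prod_empty, one_smul,
      Fin.update_cons_zero]
    rfl
  · have hterm : ∀ l : Fin (m + 1), (∏ j ∈ Finset.Iio l.succ, (-1 : ℝ) ^ degs a 2 j) •
        tupleProd e (f.compContinuousMultilinearMap P)
        (Function.update (Fin.cons (extCoord b e a α) (Fin.cons (extCoord b e 2 F)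
            fun _ => extCoord b e 2 F : Fin (m + 1) → κ → CoExt E)) l.succ fun k =>
          CliffordAlgebra.contractLeft (Q := (0 : QuadraticForm ℝ (Module.Dual ℝ E)))
            (Module.Dual.eval ℝ E v) (extCoord b e (degs a 2 l.succ) (factors α F F l.succ) k)) =
        ((-1 : ℝ) ^ a) • tupleProd e (f.compContinuousMultilinearMap P)
        (Fin.cons (extCoord b e a α) (Fin.cons (extCoord b e 1 (F.curryLeft v))
          fun _ => extCoord b e 2 F : Fin (m + 1) → κ → CoExt E)) := by
      intro l
      -- Of the factors before the contracted one, only α can contribute a sign.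
      have h1 : ∏ j ∈ Finset.Iio l.succ, (-1 : ℝ) ^ degs a 2 j = (-1) ^ a := by
        rw [show Finset.Iio l.succ = insert 0 ((Finset.Iio l).map (Fin.succEmb (m + 1))) by
          ext j
          refine Fin.cases ?_ (fun j => ?_) j <;> simp]
        rw [Finset.prod_insert (by simp), Finset.prod_map, Finset.prod_eq_one, mul_one]
        · rfl
        · intro j _
          have : degs a 2 ((Fin.succEmb (m + 1)) j) = 2 := by
            refine Fin.cases ?_ (fun j => ?_) j <;> rfl
          rw [this, neg_one_sq]
      have h2 : (fun k =>
          CliffordAlgebra.contractLeft (Q := (0 : QuadraticForm ℝ (Module.Dual ℝ E)))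
            (Module.Dual.eval ℝ E v) (extCoord b e (degs a 2 l.succ) (factors α F F l.succ) k)) =
          extCoord b e 1 (F.curryLeft v) := by
        funext k
        rw [← contractLeft_extCoord]
        refine Fin.cases ?_ (fun j => ?_) l <;> rfl
      rw [h1, h2, ← tupleProd_cons_update e _ (fun σ v => by
        simp only [ContinuousLinearMap.compContinuousMultilinearMap_coe, Function.comp_apply, hP])
        _ _ _ (fun k x => commute_extCoord_two b e F k x) l, ← Fin.cons_update]
      congr 4
      funext i
      refine Fin.cases ?_ (fun i => ?_) i <;> rfl
    rw [Finset.sum_congr rfl fun l _ => hterm l, Finset.sum_const, Finset.card_univ,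
      Fintype.card_fin, ← Nat.cast_smul_eq_nsmul ℝ, smul_smul]
    push_cast
    rfl

theorem curryLeft_wedge_one_two {m N : ℕ} (h : ∑ i : Fin (m + 2), degs 1 2 i = N + 1)
    (h₀ : ∑ i : Fin (m + 2), degs 0 2 i = N) (h₁ : ∑ i : Fin (m + 2), degs 1 1 i = N)
    (P : ContinuousMultilinearMap ℝ (fun _ : Fin (m + 2) => V) W)
    (hP : ∀ (σ : Equiv.Perm (Fin (m + 2))) (v : Fin (m + 2) → V), P (fun i => v (σ i)) = P v)
    (α : E [⋀^Fin 1]→L[ℝ] V) (F : E [⋀^Fin 2]→L[ℝ] V) (v : E) :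
    (wedge h P (factors α F F)).curryLeft v =
      wedge h₀ P (factors (α.curryLeft v) F F) -
        (m + 1 : ℝ) • wedge h₁ P (factors α (F.curryLeft v) F) := by
  refine ContinuousAlternatingMap.ext_dual fun f =>
    toExt_injective (Module.finBasis ℝ E) _ ?_
  rw [toExt_curryLeft_wedge_two _ (Module.finBasis ℝ V) h P hP,
    show f.compContinuousAlternatingMap (wedge h₀ P (factors (α.curryLeft v) F F) -
        (m + 1 : ℝ) • wedge h₁ P (factors α (F.curryLeft v) F)) =
      f.compContinuousAlternatingMap (wedge h₀ P (factors (α.curryLeft v) F F)) -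
      (m + 1 : ℝ) • f.compContinuousAlternatingMap (wedge h₁ P (factors α (F.curryLeft v) F)) by
      ext; simp, map_sub, map_smul, compContinuousAlternatingMap_wedge,
    compContinuousAlternatingMap_wedge,
    toExt_wedge _ (Module.finBasis ℝ V), toExt_wedge _ (Module.finBasis ℝ V), extCoord_factors,
    extCoord_factors, pow_one, mul_neg_one, neg_smul, sub_eq_add_neg]
  simp only [contractLeft_extCoord]

/-- With F in every slot, all m + 2 terms of the antiderivation rule agree: one from the first slot,
after a swap without a sign, and m + 1 from the others. -/
theorem curryLeft_wedge_two_two {m N : ℕ} (h : ∑ i : Fin (m + 2), degs 2 2 i = N + 1)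
    (h₁ : ∑ i : Fin (m + 2), degs 1 2 i = N)
    (P : ContinuousMultilinearMap ℝ (fun _ : Fin (m + 2) => V) W)
    (hP : ∀ (σ : Equiv.Perm (Fin (m + 2))) (v : Fin (m + 2) → V), P (fun i => v (σ i)) = P v)
    (F : E [⋀^Fin 2]→L[ℝ] V) (v : E) :
    (wedge h P (factors F F F)).curryLeft v =
      (m + 2 : ℝ) • wedge h₁ P (factors (F.curryLeft v) F F) := by
  refine ContinuousAlternatingMap.ext_dual fun f =>
    toExt_injective (Module.finBasis ℝ E) _ ?_
  rw [toExt_curryLeft_wedge_two _ (Module.finBasis ℝ V) h P hP,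
    show f.compContinuousAlternatingMap
        ((m + 2 : ℝ) • wedge h₁ P (factors (F.curryLeft v) F F)) =
      (m + 2 : ℝ) • f.compContinuousAlternatingMap (wedge h₁ P (factors (F.curryLeft v) F F)) by
      ext; simp, map_smul, compContinuousAlternatingMap_wedge,
    toExt_wedge _ (Module.finBasis ℝ V), extCoord_factors]
  simp only [contractLeft_extCoord]
  rw [tupleProd_cons_cons_swap _ _ (fun v => by
      simp only [ContinuousLinearMap.compContinuousMultilinearMap_coe, Function.comp_apply, hP])
    1 (extCoord (Module.finBasis ℝ E) (Module.finBasis ℝ V) 1 (F.curryLeft v))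
      (extCoord (Module.finBasis ℝ E) (Module.finBasis ℝ V) 2 F) _
      fun k k' => by rw [one_smul]; exact commute_extCoord_two _ _ F k _, one_smul]
  rw [neg_one_sq, mul_one]
  change tupleProd _ _ _ + _ = _
  nth_rw 1 [← one_smul ℝ (tupleProd _ _ _)]
  rw [← add_smul]
  congr 1
  ring

end WedgeIdentities

/-! ### The bracket of forms -/

section Bracket

open ContinuousAlternatingMap (alternatizeUncurryFin alternatizeUncurryFin_apply)

variable {E : Type*} [NormedAddCommGroup E] [NormedSpace ℝ E]
  {𝔤 : Type*} [NormedLieRing 𝔤] [NormedLieAlgebra 𝔤] [FiniteDimensional ℝ 𝔤]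

/-- The adjoint representation as a continuous bilinear map. -/
noncomputable def adCLM (𝔤 : Type*) [NormedLieRing 𝔤] [NormedLieAlgebra 𝔤]
    [FiniteDimensional ℝ 𝔤] : 𝔤 →L[ℝ] 𝔤 →L[ℝ] 𝔤 :=
  (LinearMap.mk₂ ℝ (fun x y : 𝔤 => ⁅x, y⁆) (by simp) (by simp) (by simp)
    (by simp)).toContinuousBilinearMap

theorem adCLM_apply (X Y : 𝔤) : adCLM 𝔤 X Y = ⁅X, Y⁆ := rfl

/-- The map `v ↦ [A(v), Z]` for a one-form `A` and a form `Z`. -/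
noncomputable def adForm [FiniteDimensional ℝ E] {p : ℕ} (A : E [⋀^Fin 1]→L[ℝ] 𝔤)
    (Z : E [⋀^Fin p]→L[ℝ] 𝔤) : E →L[ℝ] E [⋀^Fin p]→L[ℝ] 𝔤 :=
  LinearMap.toContinuousLinearMap
    { toFun := fun v => (adCLM 𝔤 (A.curryLeft v ![])).compContinuousAlternatingMap Z
      map_add' := fun v w => by ext; simp
      map_smul' := fun c v => by ext; simp }

theorem adForm_apply [FiniteDimensional ℝ E] {p : ℕ} (A : E [⋀^Fin 1]→L[ℝ] 𝔤)
    (Z : E [⋀^Fin p]→L[ℝ] 𝔤) (v : E) :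
    adForm A Z v = (adCLM 𝔤 (A.curryLeft v ![])).compContinuousAlternatingMap Z := rfl

theorem toExt_formBracket {ι κ : Type*} [Fintype ι] [Fintype κ]
    (b : Module.Basis ι ℝ E) (e : Module.Basis κ ℝ 𝔤) {a c N : ℕ} (h : a + c = N)
    (α : E [⋀^Fin a]→L[ℝ] 𝔤) (β : E [⋀^Fin c]→L[ℝ] 𝔤) (f : 𝔤 →L[ℝ] ℝ) :
    toExt b N (f.compContinuousAlternatingMap (formBracket h α β)) =
      ∑ i, ∑ j, f ⁅e i, e j⁆ • (extCoord b e a α i * extCoord b e c β j) := by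
  rw [formBracket, compContinuousAlternatingMap_wedge, toExt_wedge b e, tupleProd_two]
  rfl

theorem Module.Basis.apply_eq_sum_coord {V κ : Type*} [AddCommGroup V] [Module ℝ V] [Fintype κ]
    (e : Module.Basis κ ℝ V) (g : V →ₗ[ℝ] ℝ) (Y : V) : g Y = ∑ l, g (e l) * e.coord l Y := by
  conv_lhs => rw [← e.sum_repr Y, map_sum]
  simp only [map_smul, smul_eq_mul, Module.Basis.coord_apply, mul_comm]

theorem toExt_compContinuousAlternatingMap {ι κ : Type*} [Fintype ι] [Fintype κ]
    (b : Module.Basis ι ℝ E) (e : Module.Basis κ ℝ 𝔤) {c : ℕ}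
    (β : E [⋀^Fin c]→L[ℝ] 𝔤) (f : 𝔤 →L[ℝ] ℝ) :
    toExt b c (f.compContinuousAlternatingMap β) = ∑ j, f (e j) • extCoord b e c β j := by
  simp only [extCoord_apply, ← map_smul, ← map_sum]
  congr 1
  ext v
  simp only [ContinuousLinearMap.compContinuousAlternatingMap_coe, Function.comp_apply]
  exact (e.apply_eq_sum_coord f.toLinearMap (β v)).trans (by simp)

theorem toExt_one_apply {ι : Type*} [Fintype ι] (b : Module.Basis ι ℝ E)
    (η : E [⋀^Fin 1]→L[ℝ] ℝ) :
    toExt b 1 η = ∑ i, η.curryLeft (b i) ![] • ExteriorAlgebra.ι ℝ (b.coord i) := by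
  rw [toExt_succ]
  simp only [toExt_zero_apply, Nat.cast_zero, zero_add, inv_one, one_smul]
  refine Finset.sum_congr rfl fun i _ => ?_
  rw [Algebra.smul_def, Algebra.commutes]

/-- This puts the bracket with A in the same shape as an exterior derivative, so that a covariant
derivative is the alternatization of a single map, the derivative plus ad A. -/
theorem formBracket_eq_alternatizeUncurryFin [FiniteDimensional ℝ E] {p : ℕ}
    (A : E [⋀^Fin 1]→L[ℝ] 𝔤) (Z : E [⋀^Fin p]→L[ℝ] 𝔤) :
    formBracket (Nat.add_comm 1 p) A Z = alternatizeUncurryFin (adForm A Z) := by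
  refine ContinuousAlternatingMap.ext_dual fun f =>
    toExt_injective (Module.finBasis ℝ E) _ ?_
  set b := Module.finBasis ℝ E
  set e := Module.finBasis ℝ 𝔤
  rw [toExt_formBracket b e, toExt_compContinuousAlternatingMap_alternatizeUncurryFin]
  have h1 : ∀ i, toExt b p (f.compContinuousAlternatingMap (adForm A Z (b i))) =
      ∑ k, ∑ j, (e.coord k (A.curryLeft (b i) ![]) * f ⁅e k, e j⁆) • extCoord b e p Z j := by
    intro i
    rw [adForm_apply]
    refine (toExt_compContinuousAlternatingMap b e Z
      (f.comp (adCLM 𝔤 (A.curryLeft (b i) ![])))).trans ?_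
    rw [Finset.sum_comm]
    refine Finset.sum_congr rfl fun j _ => ?_
    rw [← Finset.sum_smul]
    congr 1
    rw [ContinuousLinearMap.comp_apply, adCLM_apply]
    refine (e.apply_eq_sum_coord (f.toLinearMap ∘ₗ ((adCLM 𝔤).flip (e j)).toLinearMap)
      (A.curryLeft (b i) ![])).trans (Finset.sum_congr rfl fun k _ => mul_comm _ _)
  simp only [h1, Finset.mul_sum]
  rw [Finset.sum_comm (γ := Fin (Module.finrank ℝ E))]
  refine Finset.sum_congr rfl fun k _ => ?_
  rw [Finset.sum_comm (γ := Fin (Module.finrank ℝ E))]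
  refine Finset.sum_congr rfl fun j _ => ?_
  rw [extCoord_apply, toExt_one_apply, Finset.sum_mul, Finset.smul_sum]
  refine Finset.sum_congr rfl fun i _ => ?_
  rw [mul_smul_comm, smul_mul_assoc, smul_smul, mul_comm]
  rfl

theorem toExt_one_mul_one {ι : Type*} [Fintype ι] (b : Module.Basis ι ℝ E)
    (η η' : E [⋀^Fin 1]→L[ℝ] ℝ) :
    toExt b 1 η * toExt b 1 η' = -(toExt b 1 η' * toExt b 1 η) := by
  obtain ⟨f, hf⟩ := exists_toExt_one b η
  rw [hf, ι_mul_toExt, pow_one, neg_one_smul]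

/-- The sign from exchanging two one-forms cancels the sign from the antisymmetry of the bracket. -/
theorem formBracket_comm_one_one [FiniteDimensional ℝ E] {N : ℕ} (h : 1 + 1 = N)
    (A B : E [⋀^Fin 1]→L[ℝ] 𝔤) : formBracket h A B = formBracket h B A := by
  refine ContinuousAlternatingMap.ext_dual fun f =>
    toExt_injective (Module.finBasis ℝ E) _ ?_
  rw [toExt_formBracket _ (Module.finBasis ℝ 𝔤), toExt_formBracket _ (Module.finBasis ℝ 𝔤),
    Finset.sum_comm]
  refine Finset.sum_congr rfl fun i _ => Finset.sum_congr rfl fun j _ => ?_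
  rw [← lie_skew, map_neg, neg_smul, extCoord_apply, extCoord_apply, toExt_one_mul_one, smul_neg,
    neg_neg]

theorem formBracket_comm_two_one [FiniteDimensional ℝ E] {N : ℕ} (h : 2 + 1 = N) (h' : 1 + 2 = N)
    (F : E [⋀^Fin 2]→L[ℝ] 𝔤) (A : E [⋀^Fin 1]→L[ℝ] 𝔤) :
    formBracket h F A = -formBracket h' A F := by
  refine ContinuousAlternatingMap.ext_dual fun f =>
    toExt_injective (Module.finBasis ℝ E) _ ?_
  rw [show f.compContinuousAlternatingMap (-formBracket h' A F) =
    -f.compContinuousAlternatingMap (formBracket h' A F) by ext; simp, map_neg,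
    toExt_formBracket _ (Module.finBasis ℝ 𝔤), toExt_formBracket _ (Module.finBasis ℝ 𝔤),
    Finset.sum_comm, ← Finset.sum_neg_distrib]
  refine Finset.sum_congr rfl fun i _ => ?_
  rw [← Finset.sum_neg_distrib]
  refine Finset.sum_congr rfl fun j _ => ?_
  rw [← lie_skew, map_neg, neg_smul, (commute_extCoord_two _ _ F j _).eq]

/-- A product of three elements of degree one is invariant under cyclic permutation. The expression
therefore equals each of its two cyclic rotations, and the sum of the three has the Jacobi
expression as coefficients. -/
theorem formBracket_jacobi [FiniteDimensional ℝ E] {N : ℕ} (h : 1 + 2 = N)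
    (A : E [⋀^Fin 1]→L[ℝ] 𝔤) : formBracket h A (formBracket rfl A A) = 0 := by
  refine ContinuousAlternatingMap.ext_dual fun f =>
    toExt_injective (Module.finBasis ℝ E) _ ?_
  set b := Module.finBasis ℝ E
  set e := Module.finBasis ℝ 𝔤
  rw [toExt_formBracket b e, show f.compContinuousAlternatingMap (0 : E [⋀^Fin N]→L[ℝ] 𝔤) = 0 by
    ext; simp, map_zero]
  have h1 : ∀ l, extCoord b e 2 (formBracket rfl A A) l =
      ∑ i, ∑ j, e.coord l ⁅e i, e j⁆ • (extCoord b e 1 A i * extCoord b e 1 A j) := fun l => by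
    rw [extCoord_apply]
    exact toExt_formBracket b e rfl A A _
  set x := extCoord b e 1 A with hx
  have hxx : ∀ i j, x i * x j = -(x j * x i) := fun i j => toExt_one_mul_one b _ _
  have h2 : ∀ k, ∑ l, f ⁅e k, e l⁆ • (x k * extCoord b e 2 (formBracket rfl A A) l) =
      ∑ i, ∑ j, f ⁅e k, ⁅e i, e j⁆⁆ • (x k * (x i * x j)) := by
    intro k
    simp only [h1, Finset.mul_sum, Finset.smul_sum, mul_smul_comm]
    rw [Finset.sum_comm]
    refine Finset.sum_congr rfl fun i _ => ?_
    rw [Finset.sum_comm]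
    refine Finset.sum_congr rfl fun j _ => ?_
    simp only [smul_smul]
    rw [← Finset.sum_smul]
    congr 1
    exact (e.apply_eq_sum_coord (f.toLinearMap ∘ₗ (adCLM 𝔤 (e k)).toLinearMap) ⁅e i, e j⁆).symm
  simp only [h2]
  set S := ∑ k, ∑ i, ∑ j, f ⁅e k, ⁅e i, e j⁆⁆ • (x k * (x i * x j)) with hS
  have hcyc : ∀ i j k, x k * (x i * x j) = x i * (x j * x k) := fun i j k => by
    rw [← mul_assoc, hxx k i, neg_mul, mul_assoc, hxx k j, mul_neg, neg_neg]
  have hS1 : S = ∑ k, ∑ i, ∑ j, f ⁅e i, ⁅e j, e k⁆⁆ • (x k * (x i * x j)) := by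
    trans ∑ k, ∑ i, ∑ j, f ⁅e i, ⁅e j, e k⁆⁆ • (x i * (x j * x k))
    · conv_rhs => rw [Finset.sum_comm]; enter [2, i]; rw [Finset.sum_comm]
    · refine Finset.sum_congr rfl fun k _ => Finset.sum_congr rfl fun i _ =>
        Finset.sum_congr rfl fun j _ => ?_
      rw [hcyc i j k]
  have hS2 : S = ∑ k, ∑ i, ∑ j, f ⁅e j, ⁅e k, e i⁆⁆ • (x k * (x i * x j)) := by
    trans ∑ k, ∑ i, ∑ j, f ⁅e j, ⁅e k, e i⁆⁆ • (x j * (x k * x i))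
    · conv_rhs => enter [2, k]; rw [Finset.sum_comm]
      rw [Finset.sum_comm]
    · refine Finset.sum_congr rfl fun k _ => Finset.sum_congr rfl fun i _ =>
        Finset.sum_congr rfl fun j _ => ?_
      rw [hcyc i j k, hcyc j k i]
  have h3 : (3 : ℝ) • S = 0 := by
    rw [show (3 : ℝ) = 1 + 1 + 1 by norm_num, add_smul, add_smul, one_smul]
    nth_rw 2 [hS1]
    nth_rw 2 [hS2]
    rw [hS]
    simp only [← Finset.sum_add_distrib, ← add_smul, ← map_add]
    simp only [lie_jacobi, map_zero, zero_smul, Finset.sum_const_zero]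
  exact (smul_eq_zero.1 h3).resolve_left (by norm_num)

/-- X is a fixed element of the Lie algebra, so no signs occur and the invariance of P applies to
each permutation in the wedge product separately. -/
theorem sum_wedge_update_ad {r N : ℕ} {p : Fin r → ℕ} (h : ∑ i, p i = N)
    (P : ContinuousMultilinearMap ℝ (fun _ : Fin r => 𝔤) ℂ)
    (hP : IsInvariantSymmetric P) (Z : ∀ i, E [⋀^Fin (p i)]→L[ℝ] 𝔤) (X : 𝔤) :
    ∑ l, wedge h P (Function.update Z l ((adCLM 𝔤 X).compContinuousAlternatingMap (Z l))) = 0 := by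
  ext v
  rw [ContinuousAlternatingMap.sum_apply]
  simp only [wedge_apply]
  rw [← Finset.smul_sum, Finset.sum_comm]
  simp only [← Finset.smul_sum]
  rw [Finset.sum_eq_zero, smul_zero]
  · rfl
  · intro σ _
    have h1 := hP.invariant X fun i => Z i fun j => v (σ (finCongr h (finSigmaFinEquiv ⟨i, j⟩)))
    rw [show (0 : ℂ) = Equiv.Perm.sign σ • 0 by simp, ← h1]
    congr 1
    refine Finset.sum_congr rfl fun l _ => ?_
    congr 1
    funext i
    by_cases hi : i = l
    · subst hi; simp [adCLM_apply]
    · simp [hi]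

end Bracket

namespace Transgression

/-! ### Differential forms on manifolds -/

section FormsOnManifolds

open ContinuousAlternatingMap (alternatizeUncurryFin)

variable {E H M V W : Type*} [NormedAddCommGroup E] [NormedSpace ℝ E]
  [TopologicalSpace H] {I : ModelWithCorners ℝ E H} [TopologicalSpace M] [ChartedSpace H M]
  [NormedAddCommGroup V] [NormedSpace ℝ V] [NormedAddCommGroup W] [NormedSpace ℝ W]

theorem chartRep_add {p : ℕ} (η η' : Form E M V p) (x₀ : M) :
    chartRep I (η + η') x₀ = chartRep I η x₀ + chartRep I η' x₀ := rfl

theorem chartRep_smul {R : Type*} [Monoid R] [DistribMulAction R V] [SMulCommClass ℝ R V]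
    [ContinuousConstSMul R V] {p : ℕ} (c : R) (η : Form E M V p) (x₀ : M) :
    chartRep I (c • η) x₀ = c • chartRep I η x₀ := rfl

theorem chartRep_wedge {r N : ℕ} {p : Fin r → ℕ} (h : ∑ i, p i = N)
    (P : ContinuousMultilinearMap ℝ (fun _ : Fin r => V) W)
    (Z : ∀ i, Form E M V (p i)) (x₀ : M) (y : E) :
    chartRep I (fun x => wedge h P fun i => Z i x) x₀ y =
      wedge h P fun i => chartRep I (Z i) x₀ y :=
  wedge_compContinuousLinearMap h P _ _

/-- Derivatives are taken within the range of the model, and the target of a chart is a relative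
neighbourhood of each of its points there; this covers boundary points as well. -/
theorem isSmooth_iff {p : ℕ} {η : Form E M V p} :
    IsSmooth I η ↔ ∀ x₀ : M, ∀ y ∈ (extChartAt I x₀).target,
      ContDiffWithinAt ℝ ∞ (chartRep I η x₀) (range I) y := by
  refine forall_congr' fun x₀ => forall₂_congr fun y hy => ?_
  constructor
  · intro h
    exact h.mono_of_mem_nhdsWithin (extChartAt_target_mem_nhdsWithin_of_mem hy)
  · intro h
    exact h.mono (extChartAt_target_subset_range x₀)

theorem IsSmooth.contDiffWithinAt_self {p : ℕ} {η : Form E M V p} (h : IsSmooth I η) (x : M) :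
    ContDiffWithinAt ℝ ∞ (chartRep I η x) (range I) (extChartAt I x x) :=
  isSmooth_iff.1 h x _ (mem_extChartAt_target x)

theorem IsSmooth.differentiableWithinAt_self {p : ℕ} {η : Form E M V p} (h : IsSmooth I η)
    (x : M) : DifferentiableWithinAt ℝ (chartRep I η x) (range I) (extChartAt I x x) :=
  (h.contDiffWithinAt_self x).differentiableWithinAt (by simp)

theorem IsSmooth.add {p : ℕ} {η η' : Form E M V p} (h : IsSmooth I η) (h' : IsSmooth I η') :
    IsSmooth I (η + η') := fun x₀ => (h x₀).add (h' x₀)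

theorem IsSmooth.neg {p : ℕ} {η : Form E M V p} (h : IsSmooth I η) : IsSmooth I (-η) :=
  fun x₀ => (h x₀).neg

theorem IsSmooth.sub {p : ℕ} {η η' : Form E M V p} (h : IsSmooth I η) (h' : IsSmooth I η') :
    IsSmooth I (η - η') := by
  rw [sub_eq_add_neg]; exact h.add h'.neg

theorem IsSmooth.const_smul {p : ℕ} {η : Form E M V p} (c : ℝ) (h : IsSmooth I η) :
    IsSmooth I (c • η) := fun x₀ => (h x₀).const_smul c

theorem IsSmooth.const_smul_complex {p : ℕ} {η : Form E M ℂ p} (c : ℂ) (h : IsSmooth I η) :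
    IsSmooth I (c • η) := fun x₀ => (h x₀).const_smul c

theorem isSmooth_zero {p : ℕ} : IsSmooth I (0 : Form E M V p) :=
  fun _ => contDiffOn_const (c := (0 : E [⋀^Fin p]→L[ℝ] V))

theorem IsSmooth.sum {p : ℕ} {J : Type*} (s : Finset J) {η : J → Form E M V p}
    (h : ∀ j ∈ s, IsSmooth I (η j)) : IsSmooth I (∑ j ∈ s, η j) := by
  classical
  induction s using Finset.induction_on with
  | empty => simpa using isSmooth_zero
  | insert j s hj ih =>
    rw [Finset.sum_insert hj]
    exact (h j (by simp)).add (ih fun i hi => h i (by simp [hi]))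

theorem IsSmooth.wedge {r N : ℕ} {p : Fin r → ℕ} (h : ∑ i, p i = N)
    (P : ContinuousMultilinearMap ℝ (fun _ : Fin r => V) W)
    {Z : ∀ i, Form E M V (p i)} (hZ : ∀ i, IsSmooth I (Z i)) :
    IsSmooth I (fun x => Transgression.wedge h P fun i => Z i x) := by
  intro x₀
  have : chartRep I (fun x => Transgression.wedge h P fun i => Z i x) x₀ =
      fun y => wedgeCM h P fun i => chartRep I (Z i) x₀ y :=
    funext fun y => chartRep_wedge h P Z x₀ y
  rw [this]
  exact (wedgeCM h P).contDiff.comp_contDiffOn (contDiffOn_pi.2 fun i => hZ i x₀)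

variable [IsManifold I ∞ M]

theorem chartRep_self {p : ℕ} (η : Form E M V p) (x : M) :
    chartRep I η x (extChartAt I x x) = η x := by
  rw [chartRep, mfderivWithin_range_extChartAt_symm, extChartAt_to_inv]
  exact ContinuousAlternatingMap.ext fun v => rfl

theorem extD_eq {p : ℕ} (η : Form E M V p) (x : M) :
    extD I η x = extDerivWithin (chartRep I η x) (range I) (extChartAt I x x) := by
  rw [extD, mfderiv_extChartAt_self]
  exact ContinuousAlternatingMap.ext fun v => rfl

/-- Representations in two charts differ by the pullback along the transition map; this is the chain
rule together with the fact that the derivatives of a chart and of its inverse are inverse to each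
other. -/
theorem chartRep_eq_pullback {p : ℕ} (η : Form E M V p) (x₀ x : M) {z : E}
    (hz : z ∈ (extChartAt I x₀).target) (hz' : (extChartAt I x₀).symm z ∈ (extChartAt I x).source) :
    chartRep I η x₀ z =
      (chartRep I η x ((extChartAt I x ∘ (extChartAt I x₀).symm) z)).compContinuousLinearMap
        (fderivWithin ℝ (extChartAt I x ∘ (extChartAt I x₀).symm) (range I) z) := by
  have hU : UniqueMDiffWithinAt 𝓘(ℝ, E) (range I) z :=
    I.uniqueMDiffOn _ (extChartAt_target_subset_range x₀ hz)
  have h1 : fderivWithin ℝ (extChartAt I x ∘ (extChartAt I x₀).symm) (range I) z =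
      (mfderiv I 𝓘(ℝ, E) (extChartAt I x) ((extChartAt I x₀).symm z)).comp
        (mfderivWithin 𝓘(ℝ, E) I (extChartAt I x₀).symm (range I) z) := by
    rw [← mfderivWithin_eq_fderivWithin]
    exact mfderiv_comp_mfderivWithin _
      (mdifferentiableAt_extChartAt (by rwa [← extChartAt_source (I := I)]))
      (mdifferentiableWithinAt_extChartAt_symm hz) hU
  have h2 := mfderivWithin_extChartAt_symm_comp_mfderiv_extChartAt' (I := I) hz'
  rw [h1]
  ext v
  change η _ _ = η ((extChartAt I x).symm (extChartAt I x ((extChartAt I x₀).symm z))) _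
  rw [(extChartAt I x).left_inv hz']
  refine congrArg (η ((extChartAt I x₀).symm z)) (funext fun i => ?_)
  exact (DFunLike.congr_fun h2 (mfderivWithin 𝓘(ℝ, E) I (extChartAt I x₀).symm (range I) z (v i))).symm

/-- The exterior derivative is defined at each point in that point's own chart. Since it commutes
with pullback along transition maps, a fixed chart may be used instead. Smoothness of dη and d² = 0
depend on this. -/
theorem chartRep_extD {p : ℕ} {η : Form E M V p} (hη : IsSmooth I η) (x₀ : M) {y : E}
    (hy : y ∈ (extChartAt I x₀).target) :
    chartRep I (extD I η) x₀ y = extDerivWithin (chartRep I η x₀) (range I) y := by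
  set x := (extChartAt I x₀).symm y with hx
  have hsrc : y ∈ ((extChartAt I x₀).symm ≫ extChartAt I x).source := by
    rw [PartialEquiv.trans_source]
    exact ⟨hy, mem_extChartAt_source x⟩
  have hev : chartRep I η x₀ =ᶠ[nhdsWithin y (range I)] fun z =>
      (chartRep I η x ((extChartAt I x ∘ (extChartAt I x₀).symm) z)).compContinuousLinearMap
        (fderivWithin ℝ (extChartAt I x ∘ (extChartAt I x₀).symm) (range I) z) := by
    have hc : ContinuousWithinAt (extChartAt I x₀).symm (range I) y :=
      (mdifferentiableWithinAt_extChartAt_symm hy).continuousWithinAt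
    filter_upwards [extChartAt_target_mem_nhdsWithin_of_mem hy,
      hc.preimage_mem_nhdsWithin (extChartAt_source_mem_nhds (I := I) x)] with z hz hz'
    exact chartRep_eq_pullback η x₀ x hz hz'
  have hyr : y ∈ range I := extChartAt_target_subset_range x₀ hy
  rw [hev.extDerivWithin_eq_of_mem hyr,
    extDerivWithin_pullback (r := ∞) (t := range I)]
  · rw [chartRep, ← hx, extD_eq]
    have h1 : fderivWithin ℝ (extChartAt I x ∘ (extChartAt I x₀).symm) (range I) y =
        (mfderiv I 𝓘(ℝ, E) (extChartAt I x) x).comp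
          (mfderivWithin 𝓘(ℝ, E) I (extChartAt I x₀).symm (range I) y) := by
      rw [← mfderivWithin_eq_fderivWithin]
      exact mfderiv_comp_mfderivWithin _
        (mdifferentiableAt_extChartAt (mem_chart_source H x))
        (mdifferentiableWithinAt_extChartAt_symm hy) (I.uniqueMDiffOn _ hyr)
    rw [h1, mfderiv_extChartAt_self]
    rfl
  · exact hη.differentiableWithinAt_self x
  · exact contDiffWithinAt_ext_coord_change x x₀ hsrc
  · rw [minSmoothness_of_isRCLikeNormedField]
    exact WithTop.coe_le_coe.2 le_top
  · exact I.uniqueDiffOn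
  · exact I.range_subset_closure_interior hyr
  · exact hyr
  · intro z _
    rw [Function.comp_apply, extChartAt_coe]
    exact mem_range_self _

theorem IsSmooth.extD {p : ℕ} {η : Form E M V p} (hη : IsSmooth I η) :
    IsSmooth I (Transgression.extD I η) := by
  intro x₀
  refine ContDiffOn.congr (f := extDerivWithin (chartRep I η x₀) (range I)) ?_
    fun y hy => chartRep_extD hη x₀ hy
  intro y hy
  have h1 := (isSmooth_iff.1 hη x₀ y hy).fderivWithin_right (m := ∞) I.uniqueDiffOn (by simp)
    (extChartAt_target_subset_range x₀ hy)
  exact ((ContinuousAlternatingMap.alternatizeUncurryFinCLM ℝ E V).contDiff.comp_contDiffWithinAt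
    h1).mono (extChartAt_target_subset_range x₀)

theorem extD_extD {p : ℕ} {η : Form E M V p} (hη : IsSmooth I η) : extD I (extD I η) = 0 := by
  funext x
  have hmem : extChartAt I x x ∈ range I := mem_range_self _
  -- Near the base point, dη is represented by the exterior derivative computed in one fixed chart,
  -- so the identity reduces to d² = 0 on the model space.
  rw [extD_eq, Filter.EventuallyEq.extDerivWithin_eq_of_mem
    (ω₂ := extDerivWithin (chartRep I η x) (range I)) ?_ hmem,
    extDerivWithin_extDerivWithin_apply (hη.contDiffWithinAt_self x)]
  · rfl
  · rw [minSmoothness_of_isRCLikeNormedField]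
    exact WithTop.coe_le_coe.2 le_top
  · exact I.uniqueDiffOn
  · exact I.range_subset_closure_interior (mem_range_self _)
  · exact mem_range_self _
  · filter_upwards [extChartAt_target_mem_nhdsWithin x] with y hy
    exact chartRep_extD hη x hy

/-- The derivative of a form in the preferred chart at the point. -/
noncomputable def locD (I : ModelWithCorners ℝ E H) {p : ℕ} (η : Form E M V p) (x : M) :
    E →L[ℝ] E [⋀^Fin p]→L[ℝ] V :=
  fderivWithin ℝ (chartRep I η x) (range I) (extChartAt I x x)

theorem extD_eq_alternatizeUncurryFin {p : ℕ} (η : Form E M V p) (x : M) :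
    extD I η x = alternatizeUncurryFin (locD I η x) := extD_eq η x

omit [IsManifold I ∞ M] in
theorem uniqueDiffWithinAt_extChartAt (x : M) :
    UniqueDiffWithinAt ℝ (range I) (extChartAt I x x) :=
  I.uniqueDiffOn _ (mem_range_self _)

theorem extD_add {p : ℕ} {η η' : Form E M V p} (h : IsSmooth I η) (h' : IsSmooth I η') :
    extD I (η + η') = extD I η + extD I η' := by
  funext x
  rw [Pi.add_apply, extD_eq, extD_eq, extD_eq, chartRep_add, extDerivWithin_add
    (uniqueDiffWithinAt_extChartAt x) (h.differentiableWithinAt_self x)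
    (h'.differentiableWithinAt_self x)]

theorem extD_const_smul {p : ℕ} (c : ℝ) (η : Form E M V p) :
    extD I (c • η) = c • extD I η := by
  funext x
  rw [Pi.smul_apply, extD_eq, extD_eq, chartRep_smul, extDerivWithin_smul _ _
    (uniqueDiffWithinAt_extChartAt x)]

theorem extD_neg {p : ℕ} (η : Form E M V p) : extD I (-η) = -extD I η := by
  rw [← neg_one_smul ℝ, extD_const_smul, neg_one_smul]

theorem extD_sub {p : ℕ} {η η' : Form E M V p} (h : IsSmooth I η) (h' : IsSmooth I η') :
    extD I (η - η') = extD I η - extD I η' := by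
  rw [sub_eq_add_neg, extD_add h h'.neg, extD_neg, sub_eq_add_neg]

theorem extD_zero {p : ℕ} : extD I (0 : Form E M V p) = 0 := by
  simpa using extD_const_smul (I := I) (0 : ℝ) (0 : Form E M V p)

theorem extD_const_smul_complex {p : ℕ} (c : ℂ) {η : Form E M ℂ p} (h : IsSmooth I η) :
    extD I (c • η) = c • extD I η := by
  funext x
  rw [Pi.smul_apply, extD_eq, extD_eq, chartRep_smul, extDerivWithin, extDerivWithin,
    fderivWithin_const_smul (uniqueDiffWithinAt_extChartAt x) (h.differentiableWithinAt_self x)]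
  ext v
  rw [ContinuousAlternatingMap.alternatizeUncurryFin_apply, ContinuousAlternatingMap.smul_apply,
    ContinuousAlternatingMap.alternatizeUncurryFin_apply, Finset.smul_sum]
  refine Finset.sum_congr rfl fun i _ => ?_
  rw [smul_comm c]
  rfl

theorem extD_sum {p : ℕ} {J : Type*} (s : Finset J) {η : J → Form E M V p}
    (h : ∀ j ∈ s, IsSmooth I (η j)) : extD I (∑ j ∈ s, η j) = ∑ j ∈ s, extD I (η j) := by
  classical
  induction s using Finset.induction_on with
  | empty => simpa using extD_zero
  | insert j s hj ih =>
    rw [Finset.sum_insert hj, Finset.sum_insert hj, extD_add (h j (by simp))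
      (IsSmooth.sum s fun i hi => h i (by simp [hi])), ih fun i hi => h i (by simp [hi])]

theorem locD_wedge {r N : ℕ} {p : Fin r → ℕ} (h : ∑ i, p i = N)
    (P : ContinuousMultilinearMap ℝ (fun _ : Fin r => V) W)
    {Z : ∀ i, Form E M V (p i)} (hZ : ∀ i, IsSmooth I (Z i)) (x : M) :
    locD I (fun x => wedge h P fun i => Z i x) x =
      ∑ l, (wedgeCM h P).toContinuousLinearMap (fun i => Z i x) l ∘L locD I (Z l) x := by
  have h1 : chartRep I (fun x => Transgression.wedge h P fun i => Z i x) x =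
      fun y => wedgeCM h P fun i => chartRep I (Z i) x y :=
    funext fun y => chartRep_wedge h P Z x y
  have h2 := (HasFDerivWithinAt.multilinear_comp (f := wedgeCM h P)
    (g := fun i => chartRep I (Z i) x) (fun i =>
      ((hZ i).differentiableWithinAt_self x).hasFDerivWithinAt)).fderivWithin
      (uniqueDiffWithinAt_extChartAt x)
  rw [locD, h1, h2]
  simp only [chartRep_self]
  rfl

theorem isSmooth_contract {p : ℕ} {ξ : ∀ x : M, TangentSpace I x}
    (hξ : ContMDiff I I.tangent ∞ (fun x => (⟨x, ξ x⟩ : TangentBundle I M)))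
    {η : Form E M V (p + 1)} (hη : IsSmooth I η) : IsSmooth I (contract ξ η) := by
  intro x₀
  -- The vector field in coordinates. Its smoothness comes from the tangent bundle trivialization at
  -- x₀, which on the chart domain is the derivative of the chart.
  let ζ : E → E := fun y => mfderiv I 𝓘(ℝ, E) (extChartAt I x₀) ((extChartAt I x₀).symm y)
    (ξ ((extChartAt I x₀).symm y))
  have h1 : ContMDiffOn I 𝓘(ℝ, E) ∞
      (fun x => ((trivializationAt E (TangentSpace I) x₀) ⟨x, ξ x⟩).2)
      (trivializationAt E (TangentSpace I) x₀).baseSet :=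
    (trivializationAt E (TangentSpace I) x₀).contMDiffOn_section_baseSet_iff.1 hξ.contMDiffOn
  have hbase : (trivializationAt E (TangentSpace I) x₀).baseSet = (chartAt H x₀).source := rfl
  have h2 : ContDiffOn ℝ ∞ ζ (extChartAt I x₀).target := by
    rw [← contMDiffOn_iff_contDiffOn]
    refine (h1.comp (contMDiffOn_extChartAt_symm x₀) fun y hy => ?_).congr fun y hy => ?_
    · rw [hbase, ← extChartAt_source I]
      exact (extChartAt I x₀).map_target hy
    · have hsrc : (extChartAt I x₀).symm y ∈ (chartAt H x₀).source := by
        rw [← extChartAt_source I]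
        exact (extChartAt I x₀).map_target hy
      have := TangentBundle.continuousLinearMapAt_trivializationAt (I := I) hsrc
      simp only [ζ]
      rw [← this]
      exact congrFun ((trivializationAt E (TangentSpace I) x₀).coe_linearMapAt_of_mem
        (R := ℝ) hsrc) _
  have h3 : ∀ y ∈ (extChartAt I x₀).target, chartRep I (contract ξ η) x₀ y =
      (chartRep I η x₀ y).curryLeft (ζ y) := by
    intro y hy
    have := mfderivWithin_extChartAt_symm_comp_mfderiv_extChartAt (I := I) hy
    have h4 := DFunLike.congr_fun this (ξ ((extChartAt I x₀).symm y))
    ext v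
    refine congrArg (η ((extChartAt I x₀).symm y)) (funext fun i => ?_)
    refine Fin.cases ?_ (fun i => ?_) i
    · exact h4.symm
    · rfl
  refine ContDiffOn.congr ?_ h3
  exact (((ContinuousAlternatingMap.curryLeftLI (𝕜 := ℝ) (E := E) (F := V)
    (n := p)).toContinuousLinearMap.contDiff.comp_contDiffOn (hη x₀)).clm_apply h2)

end FormsOnManifolds

/-! ### Covariant calculus -/

section Factors

variable {E : Type*} [NormedAddCommGroup E] [NormedSpace ℝ E]
  {V : Type*} [NormedAddCommGroup V] [NormedSpace ℝ V]
  {W : Type*} [NormedAddCommGroup W] [NormedSpace ℝ W]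

theorem update_factors_zero {a c m : ℕ} (α α' : E [⋀^Fin a]→L[ℝ] V) (β : E [⋀^Fin c]→L[ℝ] V)
    (F : E [⋀^Fin 2]→L[ℝ] V) :
    Function.update (factors α β F : ∀ i : Fin (m + 2), E [⋀^Fin (degs a c i)]→L[ℝ] V) 0 α' =
      factors α' β F := by
  funext i
  refine Fin.cases ?_ (fun i => Fin.cases ?_ (fun i => ?_) i) i
  · exact Function.update_self _ _ _
  · exact Function.update_of_ne (Fin.succ_ne_zero _) _ _
  · exact Function.update_of_ne (Fin.succ_ne_zero _) _ _

theorem update_factors_one {a c m : ℕ} (α : E [⋀^Fin a]→L[ℝ] V) (β β' : E [⋀^Fin c]→L[ℝ] V)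
    (F : E [⋀^Fin 2]→L[ℝ] V) :
    Function.update (factors α β F : ∀ i : Fin (m + 2), E [⋀^Fin (degs a c i)]→L[ℝ] V)
      (Fin.succ 0) β' = factors α β' F := by
  funext i
  refine Fin.cases ?_ (fun i => Fin.cases ?_ (fun i => ?_) i) i
  · exact Function.update_of_ne (Fin.succ_ne_zero _).symm _ _
  · exact Function.update_self _ _ _
  · exact Function.update_of_ne (fun h => Fin.succ_ne_zero _ (Fin.succ_injective _ h)) _ _

variable {a c m N : ℕ} (h : ∑ i : Fin (m + 2), degs a c i = N)
  (P : ContinuousMultilinearMap ℝ (fun _ : Fin (m + 2) => V) W)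
  (α α' : E [⋀^Fin a]→L[ℝ] V) (β β' : E [⋀^Fin c]→L[ℝ] V) (F : E [⋀^Fin 2]→L[ℝ] V)

theorem wedge_factors_add_left :
    wedge h P (factors (α + α') β F) = wedge h P (factors α β F) + wedge h P (factors α' β F) :=
  ((congrArg (wedge h P) (update_factors_zero α (α + α') β F)).symm.trans
    (wedge_update_add h P (factors α β F) 0 α α')).trans
    (congrArg₂ (· + ·) (congrArg (wedge h P) (update_factors_zero α α β F))
      (congrArg (wedge h P) (update_factors_zero α α' β F)))

theorem wedge_factors_smul_left (r : ℝ) :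
    wedge h P (factors (r • α) β F) = r • wedge h P (factors α β F) :=
  ((congrArg (wedge h P) (update_factors_zero α (r • α) β F)).symm.trans
    (wedge_update_smul h P (factors α β F) 0 r α)).trans
    (congrArg (r • ·) (congrArg (wedge h P) (update_factors_zero α α β F)))

theorem wedge_factors_add_right :
    wedge h P (factors α (β + β') F) = wedge h P (factors α β F) + wedge h P (factors α β' F) :=
  ((congrArg (wedge h P) (update_factors_one α β (β + β') F)).symm.trans
    (wedge_update_add h P (factors α β F) (Fin.succ 0) β β')).trans
    (congrArg₂ (· + ·) (congrArg (wedge h P) (update_factors_one α β β F))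
      (congrArg (wedge h P) (update_factors_one α β β' F)))

theorem wedge_factors_smul_right (r : ℝ) :
    wedge h P (factors α (r • β) F) = r • wedge h P (factors α β F) :=
  ((congrArg (wedge h P) (update_factors_one α β (r • β) F)).symm.trans
    (wedge_update_smul h P (factors α β F) (Fin.succ 0) r β)).trans
    (congrArg (r • ·) (congrArg (wedge h P) (update_factors_one α β β F)))

theorem wedge_factors_neg_left :
    wedge h P (factors (-α) β F) = -wedge h P (factors α β F) := by
  rw [← neg_one_smul ℝ α, wedge_factors_smul_left, neg_one_smul]

theorem wedge_factors_zero_right : wedge h P (factors α 0 F) = 0 := by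
  rw [← zero_smul ℝ (0 : E [⋀^Fin c]→L[ℝ] V), wedge_factors_smul_right, zero_smul]

theorem wedge_factors_zero_left : wedge h P (factors 0 β F) = 0 := by
  rw [← zero_smul ℝ (0 : E [⋀^Fin a]→L[ℝ] V), wedge_factors_smul_left, zero_smul]

end Factors

/-! ### Bilinearity of the bracket of forms -/

section FormBracket

variable {E : Type*} [NormedAddCommGroup E] [NormedSpace ℝ E]
  {𝔤 : Type*} [NormedLieRing 𝔤] [NormedLieAlgebra 𝔤] [FiniteDimensional ℝ 𝔤]
  {a c N : ℕ} (h : a + c = N)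
  (α α' : E [⋀^Fin a]→L[ℝ] 𝔤) (β β' : E [⋀^Fin c]→L[ℝ] 𝔤)

theorem formBracket_add_left :
    formBracket h (α + α') β = formBracket h α β + formBracket h α' β :=
  wedge_factors_add_left _ _ _ _ _ _

theorem formBracket_add_right :
    formBracket h α (β + β') = formBracket h α β + formBracket h α β' :=
  wedge_factors_add_right _ _ _ _ _ _

theorem formBracket_smul_left (r : ℝ) : formBracket h (r • α) β = r • formBracket h α β :=
  wedge_factors_smul_left _ _ _ _ _ _

theorem formBracket_smul_right (r : ℝ) : formBracket h α (r • β) = r • formBracket h α β :=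
  wedge_factors_smul_right _ _ _ _ _ _

end FormBracket

/-! ### Covariant derivatives, the Bianchi identity and the covariant Leibniz rule -/

section Covariant

open ContinuousAlternatingMap (alternatizeUncurryFin)

variable {E H M V W : Type*} [NormedAddCommGroup E] [NormedSpace ℝ E]
  [TopologicalSpace H] {I : ModelWithCorners ℝ E H} [TopologicalSpace M] [ChartedSpace H M]
  [NormedAddCommGroup V] [NormedSpace ℝ V] [NormedAddCommGroup W] [NormedSpace ℝ W]
  {𝔤 : Type*} [NormedLieRing 𝔤] [NormedLieAlgebra 𝔤] [FiniteDimensional ℝ 𝔤]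

theorem isSmooth_factors {a c r : ℕ} {α : Form E M V a} {β : Form E M V c} {F : Form E M V 2}
    (hα : IsSmooth I α) (hβ : IsSmooth I β) (hF : IsSmooth I F) :
    ∀ i : Fin r, IsSmooth I (fun x => factors (α x) (β x) (F x) i)
  | ⟨0, _⟩ => hα
  | ⟨1, _⟩ => hβ
  | ⟨_ + 2, _⟩ => hF

theorem isSmooth_wedge_factors {a c r N : ℕ} (h : ∑ i : Fin r, degs a c i = N)
    (P : ContinuousMultilinearMap ℝ (fun _ : Fin r => V) W)
    {α : Form E M V a} {β : Form E M V c} {F : Form E M V 2}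
    (hα : IsSmooth I α) (hβ : IsSmooth I β) (hF : IsSmooth I F) :
    IsSmooth I (fun x => wedge h P (factors (α x) (β x) (F x))) :=
  IsSmooth.wedge h P (isSmooth_factors hα hβ hF)

theorem isSmooth_formBracket {a c N : ℕ} (h : a + c = N) {α : Form E M 𝔤 a} {β : Form E M 𝔤 c}
    (hα : IsSmooth I α) (hβ : IsSmooth I β) : IsSmooth I (fun x => formBracket h (α x) (β x)) :=
  isSmooth_wedge_factors _ _ hα hβ isSmooth_zero

variable [IsManifold I ∞ M]

theorem isSmooth_curvature {A : Form E M 𝔤 1} (hA : IsSmooth I A) :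
    IsSmooth I (curvature I A) :=
  hA.extD.add ((isSmooth_formBracket rfl hA hA).const_smul (1 / 2))

theorem isSmooth_covD {p : ℕ} {A : Form E M 𝔤 1} {Z : Form E M 𝔤 p} (hA : IsSmooth I A)
    (hZ : IsSmooth I Z) : IsSmooth I (covD I A Z) :=
  hZ.extD.add (isSmooth_formBracket _ hA hZ)

variable [FiniteDimensional ℝ E]

theorem covD_eq_alternatizeUncurryFin {p : ℕ} (A : Form E M 𝔤 1) (Z : Form E M 𝔤 p) (x : M) :
    covD I A Z x = alternatizeUncurryFin (locD I Z x + adForm (A x) (Z x)) := by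
  rw [covD, extD_eq_alternatizeUncurryFin, formBracket_eq_alternatizeUncurryFin,
    ContinuousAlternatingMap.alternatizeUncurryFin_add]

/-- The Leibniz rule gives [dA, A] - [A, dA], and exchanging a two-form with a one-form in the
bracket only produces a sign from antisymmetry, so the two terms add up. -/
theorem extD_formBracket_self {A : Form E M 𝔤 1} (hA : IsSmooth I A) (x : M) :
    extD I (fun x => formBracket (rfl : 1 + 1 = 2) (A x) (A x)) x =
      (-2 : ℝ) • formBracket (rfl : 1 + 2 = 3) (A x) (extD I A x) := by
  have h1 : locD I (fun x => formBracket (rfl : 1 + 1 = 2) (A x) (A x)) x = _ :=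
    locD_wedge (p := degs 1 1) (Z := fun i x => factors (A x) (A x) 0 i) (r := 2)
      (by simp [sum_degs]) (lieBracket 𝔤)
      (isSmooth_factors hA hA isSmooth_zero) x
  rw [extD_eq_alternatizeUncurryFin, h1, Fin.sum_univ_two,
    ContinuousAlternatingMap.alternatizeUncurryFin_add]
  have h2 := alternatizeUncurryFin_wedge_factors_zero (m := 0) (a := 1) (c := 1) (N := 2)
    (by simp [sum_degs]) (by simp [sum_degs])
    (lieBracket 𝔤) (locD I A x) (A x) (A x) 0
  have h3 := alternatizeUncurryFin_wedge_factors_one (m := 0) (a := 1) (c := 1) (N := 2)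
    (by simp [sum_degs]) (by simp [sum_degs])
    (lieBracket 𝔤) (locD I A x) (A x) (A x) 0
  refine (congrArg₂ (· + ·) h2 h3).trans ?_
  rw [← extD_eq_alternatizeUncurryFin, pow_one]
  change formBracket (rfl : 2 + 1 = 3) (extD I A x) (A x) +
    (-1 : ℝ) • formBracket (rfl : 1 + 2 = 3) (A x) (extD I A x) = _
  rw [formBracket_comm_two_one rfl rfl]
  module

/-- The Bianchi identity. -/
theorem covD_curvature {A : Form E M 𝔤 1} (hA : IsSmooth I A) :
    covD I A (curvature I A) = 0 := by
  funext x
  -- Only the quadratic part of F contributes, because ddA = 0.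
  have h1 : extD I (curvature I A) x = -formBracket (rfl : 1 + 2 = 3) (A x) (extD I A x) := by
    have : curvature I A =
        extD I A + (1 / 2 : ℝ) • fun x => formBracket (rfl : 1 + 1 = 2) (A x) (A x) := rfl
    rw [this, extD_add hA.extD ((isSmooth_formBracket rfl hA hA).const_smul (1 / 2)), extD_extD hA,
      zero_add, extD_const_smul, Pi.smul_apply, extD_formBracket_self hA]
    module
  -- The cubic term [A, [A, A]] vanishes by the Jacobi identity.
  have h2 : formBracket (rfl : 1 + 2 = 3) (A x) (curvature I A x) =
      formBracket (rfl : 1 + 2 = 3) (A x) (extD I A x) :=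
    (formBracket_add_right rfl (A x) (extD I A x) _).trans <|
      (congrArg _ ((formBracket_smul_right rfl (A x) _ _).trans <|
        (congrArg _ (formBracket_jacobi rfl (A x))).trans (smul_zero _))).trans (add_zero _)
  exact (congrArg₂ (· + ·) h1 h2).trans (neg_add_cancel _)

/-- The Leibniz rule for an invariant polynomial of two forms and curvatures. -/
theorem extD_wedge_factors_curvature {m a c N : ℕ} (h : ∑ i : Fin (m + 2), degs a c i = N)
    (h₀ : ∑ i : Fin (m + 2), degs (a + 1) c i = N + 1)
    (h₁ : ∑ i : Fin (m + 2), degs a (c + 1) i = N + 1)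
    (P : ContinuousMultilinearMap ℝ (fun _ : Fin (m + 2) => 𝔤) ℂ) (hP : IsInvariantSymmetric P)
    {A : Form E M 𝔤 1} {α : Form E M 𝔤 a} {β : Form E M 𝔤 c} (hA : IsSmooth I A)
    (hα : IsSmooth I α) (hβ : IsSmooth I β) (x : M) :
    extD I (fun x => wedge h P (factors (α x) (β x) (curvature I A x))) x =
      wedge h₀ P (factors (covD I A α x) (β x) (curvature I A x)) +
        ((-1 : ℝ) ^ a) • wedge h₁ P (factors (α x) (covD I A β x) (curvature I A x)) := by
  set F := curvature I A with hF
  have hFs : IsSmooth I F := isSmooth_curvature hA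
  let Z : ∀ i : Fin (m + 2), Form E M 𝔤 (degs a c i) := fun i x => factors (α x) (β x) (F x) i
  have hZ : ∀ i, IsSmooth I (Z i) := isSmooth_factors hα hβ hFs
  -- By invariance of P, the terms with ad A(v) add up to zero over all slots, so each derivative
  -- can be completed to a covariant one.
  have h1 : locD I (fun x => wedge h P fun i => Z i x) x =
      ∑ l, (wedgeCM h P).toContinuousLinearMap (fun i => Z i x) l ∘L
        (locD I (Z l) x + adForm (A x) (Z l x)) := by
    rw [locD_wedge h P hZ]
    simp only [ContinuousLinearMap.comp_add, Finset.sum_add_distrib]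
    rw [left_eq_add]
    ext1 v
    rw [sum_apply]
    exact sum_wedge_update_ad h P hP (fun i => Z i x) _
  have h2 : extD I (fun x => wedge h P (factors (α x) (β x) (F x))) x =
      alternatizeUncurryFin (locD I (fun x => wedge h P fun i => Z i x) x) :=
    extD_eq_alternatizeUncurryFin _ x
  rw [h2, h1, ← ContinuousAlternatingMap.alternatizeUncurryFinCLM_apply, map_sum,
    Fin.sum_univ_succ, Fin.sum_univ_succ, ← add_assoc]
  simp only [ContinuousAlternatingMap.alternatizeUncurryFinCLM_apply]
  rw [Finset.sum_eq_zero, add_zero]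
  · refine congrArg₂ (· + ·) ?_ ?_
    · rw [covD_eq_alternatizeUncurryFin]
      exact alternatizeUncurryFin_wedge_factors_zero h h₀ P
        (locD I α x + adForm (A x) (α x)) (α x) (β x) (F x)
    · rw [covD_eq_alternatizeUncurryFin]
      exact alternatizeUncurryFin_wedge_factors_one h h₁ P
        (locD I β x + adForm (A x) (β x)) (α x) (β x) (F x)
  -- The remaining slots carry the curvature, whose covariant derivative vanishes by the Bianchi
  -- identity.
  · intro l _
    refine alternatizeUncurryFin_wedge_eq_zero h P _ _ _ ?_
    have := congrFun (covD_curvature hA) x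
    rw [covD_eq_alternatizeUncurryFin] at this
    exact this

end Covariant

/-! ### Families of forms depending polynomially on a parameter -/

section PolyFam

variable {E H M V W : Type*} [NormedAddCommGroup E] [NormedSpace ℝ E]
  [TopologicalSpace H] {I : ModelWithCorners ℝ E H} [TopologicalSpace M] [ChartedSpace H M]
  [NormedAddCommGroup V] [NormedSpace ℝ V] [NormedAddCommGroup W] [NormedSpace ℝ W]
  {p : ℕ}

/-- A family of forms which is polynomial in the parameter, with smooth coefficients. -/
def IsPolyFam (I : ModelWithCorners ℝ E H) (η : ℝ → Form E M V p) : Prop :=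
  ∃ (J : Type) (_ : Fintype J) (e : J → ℕ) (c : J → Form E M V p),
    (∀ j, IsSmooth I (c j)) ∧ ∀ t, η t = ∑ j, t ^ e j • c j

theorem isPolyFam_const {c : Form E M V p} (hc : IsSmooth I c) : IsPolyFam I fun _ => c :=
  ⟨Unit, inferInstance, fun _ => 0, fun _ => c, fun _ => hc, fun t => by simp⟩

theorem isPolyFam_id_smul {c : Form E M V p} (hc : IsSmooth I c) : IsPolyFam I fun t => t • c :=
  ⟨Unit, inferInstance, fun _ => 1, fun _ => c, fun _ => hc, fun t => by simp⟩

theorem IsPolyFam.add {η η' : ℝ → Form E M V p} (h : IsPolyFam I η) (h' : IsPolyFam I η') :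
    IsPolyFam I fun t => η t + η' t := by
  obtain ⟨J, _, e, c, hc, hη⟩ := h
  obtain ⟨J', _, e', c', hc', hη'⟩ := h'
  refine ⟨J ⊕ J', inferInstance, Sum.elim e e', Sum.elim c c', ?_, fun t => ?_⟩
  · rintro (j | j)
    exacts [hc j, hc' j]
  · simp only [hη, hη', Fintype.sum_sum_type]
    rfl

theorem IsPolyFam.const_smul {η : ℝ → Form E M V p} (r : ℝ) (h : IsPolyFam I η) :
    IsPolyFam I fun t => r • η t := by
  obtain ⟨J, _, e, c, hc, hη⟩ := h
  refine ⟨J, inferInstance, e, fun j => r • c j, fun j => (hc j).const_smul r, fun t => ?_⟩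
  simp only [hη, Finset.smul_sum]
  exact Finset.sum_congr rfl fun j _ => smul_comm _ _ _

/-- Multilinear expansion: the monomials of the product are indexed by a choice of one monomial from
each factor, and the exponents add. -/
theorem IsPolyFam.wedge {r N : ℕ} {q : Fin r → ℕ} (h : ∑ i, q i = N)
    (P : ContinuousMultilinearMap ℝ (fun _ : Fin r => V) W)
    {Z : ∀ i, ℝ → Form E M V (q i)} (hZ : ∀ i, IsPolyFam I (Z i)) :
    IsPolyFam I fun t x => Transgression.wedge h P fun i => Z i t x := by
  choose J hJ e c hc hη using hZ
  refine ⟨∀ i, J i, inferInstance, fun s => ∑ i, e i (s i),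
    fun s x => Transgression.wedge h P fun i => c i (s i) x,
    fun s => IsSmooth.wedge h P fun i => hc i (s i), fun t => ?_⟩
  funext x
  have h1 : (fun i => Z i t x) = fun i => ∑ j, t ^ e i j • c i j x := by
    funext i
    rw [hη i t, Finset.sum_apply]
    rfl
  refine (congrArg (wedgeCM h P) h1).trans ?_
  rw [ContinuousMultilinearMap.map_sum, Finset.sum_apply]
  refine Finset.sum_congr rfl fun s _ => ?_
  rw [ContinuousMultilinearMap.map_smul_univ, Finset.prod_pow_eq_pow_sum]
  rfl

theorem IsPolyFam.isSmooth {η : ℝ → Form E M V p} (h : IsPolyFam I η) (t : ℝ) :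
    IsSmooth I (η t) := by
  obtain ⟨J, _, e, c, hc, hη⟩ := h
  rw [hη]
  exact IsSmooth.sum _ fun j _ => (hc j).const_smul _

theorem IsPolyFam.continuous {η : ℝ → Form E M V p} (h : IsPolyFam I η) (x : M) :
    Continuous fun t => η t x := by
  obtain ⟨J, _, e, c, hc, hη⟩ := h
  have : (fun t => η t x) = fun t => ∑ j, t ^ e j • c j x := by
    funext t
    rw [hη, Finset.sum_apply]
    rfl
  rw [this]
  fun_prop

omit [TopologicalSpace M] in
-- The integral over the parameter is a finite combination of smooth coefficients. Hence it is
-- smooth and commutes with d, with no differentiation under the integral sign.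
theorem IsPolyFam.intForm_eq [CompleteSpace V] {J : Type} [Fintype J] {e : J → ℕ}
    {c : J → Form E M V p} {η : ℝ → Form E M V p} (hη : ∀ t, η t = ∑ j, t ^ e j • c j) :
    intForm η = ∑ j, ((e j : ℝ) + 1)⁻¹ • c j := by
  funext x
  have : (fun t => η t x) = fun t => ∑ j, t ^ e j • c j x := by
    funext t
    rw [hη, Finset.sum_apply]
    rfl
  rw [intForm, this, Finset.sum_apply, intervalIntegral.integral_finsetSum]
  · refine Finset.sum_congr rfl fun j _ => ?_
    rw [intervalIntegral.integral_smul_const, integral_pow]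
    simp
  · exact fun j _ => (by fun_prop : Continuous fun t : ℝ => t ^ e j • c j x).intervalIntegrable _ _

theorem IsPolyFam.isSmooth_intForm [CompleteSpace V] {η : ℝ → Form E M V p}
    (h : IsPolyFam I η) : IsSmooth I (intForm η) := by
  obtain ⟨J, _, e, c, hc, hη⟩ := h
  rw [IsPolyFam.intForm_eq hη]
  exact IsSmooth.sum _ fun j _ => (hc j).const_smul _

theorem IsPolyFam.intervalIntegrable {η : ℝ → Form E M V p} (h : IsPolyFam I η) (x : M)
    (a b : ℝ) : IntervalIntegrable (fun t => η t x) volume a b :=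
  (h.continuous x).intervalIntegrable a b

theorem IsPolyFam.contract_intForm [CompleteSpace V] (ξ : ∀ x : M, TangentSpace I x)
    {η : ℝ → Form E M V (p + 1)} (h : IsPolyFam I η) :
    Transgression.contract ξ (intForm η) = intForm fun t => Transgression.contract ξ (η t) := by
  funext x
  let v : E := ξ x
  exact (((ContinuousLinearMap.apply ℝ _ v).comp
    (ContinuousAlternatingMap.curryLeftLI (𝕜 := ℝ) (E := E) (F := V)
      (n := p)).toContinuousLinearMap).intervalIntegral_comp_comm
        (h.intervalIntegrable x 0 1)).symm

variable [IsManifold I ∞ M]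

theorem IsPolyFam.contract {ξ : ∀ x : M, TangentSpace I x} {η : ℝ → Form E M V (p + 1)}
    (hξ : ContMDiff I I.tangent ∞ (fun x => (⟨x, ξ x⟩ : TangentBundle I M)))
    (h : IsPolyFam I η) :
    IsPolyFam I fun t => Transgression.contract ξ (η t) := by
  obtain ⟨J, _, e, c, hc, hη⟩ := h
  refine ⟨J, inferInstance, e, fun j => Transgression.contract ξ (c j),
    fun j => isSmooth_contract hξ (hc j), fun t => ?_⟩
  funext x
  ext v
  change η t x _ = _
  rw [hη, Finset.sum_apply, Finset.sum_apply, ContinuousAlternatingMap.sum_apply,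
    ContinuousAlternatingMap.sum_apply]
  rfl

theorem IsPolyFam.extD_apply {J : Type} [Fintype J] {e : J → ℕ}
    {c : J → Form E M V p} (hc : ∀ j, IsSmooth I (c j)) {η : ℝ → Form E M V p}
    (hη : ∀ t, η t = ∑ j, t ^ e j • c j) (t : ℝ) :
    Transgression.extD I (η t) = ∑ j, t ^ e j • Transgression.extD I (c j) := by
  rw [hη, extD_sum _ fun j _ => (hc j).const_smul _]
  exact Finset.sum_congr rfl fun j _ => extD_const_smul _ _

theorem IsPolyFam.extD {η : ℝ → Form E M V p} (h : IsPolyFam I η) :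
    IsPolyFam I fun t => Transgression.extD I (η t) := by
  obtain ⟨J, _, e, c, hc, hη⟩ := h
  exact ⟨J, inferInstance, e, fun j => Transgression.extD I (c j), fun j => (hc j).extD,
    IsPolyFam.extD_apply hc hη⟩

/-- The exterior derivative commutes with the integral over the parameter. -/
theorem IsPolyFam.extD_intForm [CompleteSpace V] {η : ℝ → Form E M V p} (h : IsPolyFam I η) :
    Transgression.extD I (intForm η) = intForm fun t => Transgression.extD I (η t) := by
  obtain ⟨J, _, e, c, hc, hη⟩ := h
  rw [IsPolyFam.intForm_eq hη, IsPolyFam.intForm_eq (IsPolyFam.extD_apply hc hη),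
    extD_sum _ fun j _ => (hc j).const_smul _]
  exact Finset.sum_congr rfl fun j _ => extD_const_smul _ _

end PolyFam

/-! ### Curvature and covariant derivatives along lines of connections -/

section GaugePolyFam

variable {E H M V W : Type*} [NormedAddCommGroup E] [NormedSpace ℝ E]
  [TopologicalSpace H] {I : ModelWithCorners ℝ E H} [TopologicalSpace M] [ChartedSpace H M]
  [NormedAddCommGroup V] [NormedSpace ℝ V] [NormedAddCommGroup W] [NormedSpace ℝ W]
  {𝔤 : Type*} [NormedLieRing 𝔤] [NormedLieAlgebra 𝔤] [FiniteDimensional ℝ 𝔤]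

theorem isPolyFam_factors {a c r : ℕ} {α : ℝ → Form E M V a} {β : ℝ → Form E M V c}
    {F : ℝ → Form E M V 2} (hα : IsPolyFam I α) (hβ : IsPolyFam I β) (hF : IsPolyFam I F) :
    ∀ i : Fin r, IsPolyFam I (fun t x => factors (α t x) (β t x) (F t x) i)
  | ⟨0, _⟩ => hα
  | ⟨1, _⟩ => hβ
  | ⟨_ + 2, _⟩ => hF

theorem isPolyFam_wedge_factors {a c r N : ℕ} (h : ∑ i : Fin r, degs a c i = N)
    (P : ContinuousMultilinearMap ℝ (fun _ : Fin r => V) W)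
    {α : ℝ → Form E M V a} {β : ℝ → Form E M V c} {F : ℝ → Form E M V 2}
    (hα : IsPolyFam I α) (hβ : IsPolyFam I β) (hF : IsPolyFam I F) :
    IsPolyFam I (fun t x => wedge h P (factors (α t x) (β t x) (F t x))) :=
  IsPolyFam.wedge h P (isPolyFam_factors hα hβ hF)

theorem isPolyFam_formBracket {a c N : ℕ} (h : a + c = N) {α : ℝ → Form E M 𝔤 a}
    {β : ℝ → Form E M 𝔤 c} (hα : IsPolyFam I α) (hβ : IsPolyFam I β) :
    IsPolyFam I (fun t x => formBracket h (α t x) (β t x)) :=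
  isPolyFam_wedge_factors _ _ hα hβ (isPolyFam_const isSmooth_zero)

omit [FiniteDimensional ℝ 𝔤] in
theorem isPolyFam_interp {B B' : Form E M 𝔤 1} (hB : IsSmooth I B) (hB' : IsSmooth I B') :
    IsPolyFam I (interp B B') :=
  (isPolyFam_const hB').add (isPolyFam_id_smul (hB.sub hB'))

variable [IsManifold I ∞ M]

theorem IsPolyFam.covD {p : ℕ} {A : ℝ → Form E M 𝔤 1} {Z : ℝ → Form E M 𝔤 p}
    (hA : IsPolyFam I A) (hZ : IsPolyFam I Z) : IsPolyFam I fun t => covD I (A t) (Z t) :=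
  hZ.extD.add (isPolyFam_formBracket _ hA hZ)

theorem IsPolyFam.curvature {A : ℝ → Form E M 𝔤 1} (hA : IsPolyFam I A) :
    IsPolyFam I fun t => curvature I (A t) :=
  hA.extD.add ((isPolyFam_formBracket rfl hA hA).const_smul (1 / 2))

/-- The curvature along a line of connections. -/
theorem curvature_add_smul {A B : Form E M 𝔤 1} (hA : IsSmooth I A) (hB : IsSmooth I B)
    [FiniteDimensional ℝ E] (ε : ℝ) (x : M) :
    Transgression.curvature I (A + ε • B) x = Transgression.curvature I A x +
      ε • Transgression.covD I A B x +
        (ε ^ 2 / 2) • formBracket (rfl : 1 + 1 = 2) (B x) (B x) := by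
  have h1 : Transgression.extD I (A + ε • B) x =
      Transgression.extD I A x + ε • Transgression.extD I B x := by
    rw [extD_add hA (hB.const_smul ε), extD_const_smul]
    rfl
  have h2 : formBracket (rfl : 1 + 1 = 2) ((A + ε • B) x) ((A + ε • B) x) =
      formBracket rfl (A x) (A x) + (2 * ε) • formBracket rfl (A x) (B x) +
        ε ^ 2 • formBracket rfl (B x) (B x) := by
    change formBracket _ (A x + ε • B x) (A x + ε • B x) = _
    rw [formBracket_add_left, formBracket_add_right, formBracket_add_right,
      formBracket_smul_left, formBracket_smul_left, formBracket_smul_right,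
      formBracket_smul_right, formBracket_comm_one_one rfl (B x) (A x)]
    module
  rw [Transgression.curvature, h1, h2, Transgression.curvature, Transgression.covD]
  module

omit [IsManifold I ∞ M] in
theorem covD_add_smul {p : ℕ} (A B : Form E M 𝔤 1) (Z : Form E M 𝔤 p) (ε : ℝ) (x : M) :
    Transgression.covD I (A + ε • B) Z x = Transgression.covD I A Z x +
      ε • formBracket (Nat.add_comm 1 p) (B x) (Z x) := by
  have h2 : formBracket (Nat.add_comm 1 p) ((A + ε • B) x) (Z x) =
      formBracket (Nat.add_comm 1 p) (A x) (Z x) +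
        ε • formBracket (Nat.add_comm 1 p) (B x) (Z x) := by
    change formBracket _ (A x + ε • B x) (Z x) = _
    rw [formBracket_add_left, formBracket_smul_left]
  rw [Transgression.covD, h2, Transgression.covD, add_assoc]

/-- The derivative of the curvature along a line of connections. -/
theorem hasDerivAt_curvature {A B : Form E M 𝔤 1} (hA : IsSmooth I A) (hB : IsSmooth I B)
    [FiniteDimensional ℝ E] (ε : ℝ) (x : M) :
    HasDerivAt (fun ε : ℝ => Transgression.curvature I (A + ε • B) x)
      (Transgression.covD I (A + ε • B) B x) ε := by
  simp only [curvature_add_smul hA hB]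
  have h1 := ((hasDerivAt_id ε).smul_const (Transgression.covD I A B x)).const_add
    (Transgression.curvature I A x)
  have h2 := (((hasDerivAt_id ε).pow 2).div_const 2).smul_const
    (formBracket (rfl : 1 + 1 = 2) (B x) (B x))
  refine (h1.add h2).congr_deriv ?_
  -- The quadratic term of the curvature contributes ε[B, B], exactly the change of D_A B when A is
  -- moved to A + εB.
  rw [covD_add_smul, one_smul]
  congr 2
  simp

end GaugePolyFam

/-! ### Variations -/

/-- Differentiation under the integral sign for a jointly continuous derivative. -/
theorem hasDerivAt_integral_of_continuous {W : Type*} [NormedAddCommGroup W] [NormedSpace ℝ W]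
    {f f' : ℝ → ℝ → W} (hf : ∀ ε, Continuous (f ε)) (hf' : Continuous fun q : ℝ × ℝ => f' q.1 q.2)
    (hd : ∀ ε t, HasDerivAt (fun ε => f ε t) (f' ε t) ε) (ε₀ a b : ℝ) :
    HasDerivAt (fun ε => ∫ t in a..b, f ε t) (∫ t in a..b, f' ε₀ t) ε₀ := by
  -- A constant dominates the derivative for parameters within distance 1 of ε₀, by compactness.
  obtain ⟨C, hC⟩ := ((isCompact_closedBall ε₀ 1).prod (isCompact_uIcc (a := a) (b := b))
    ).exists_bound_of_continuousOn hf'.continuousOn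
  have hm : Continuous (f' ε₀) := hf'.comp (by fun_prop : Continuous fun t : ℝ => (ε₀, t))
  refine (intervalIntegral.hasDerivAt_integral_of_dominated_loc_of_deriv_le (bound := fun _ => C)
    (Metric.closedBall_mem_nhds ε₀ one_pos)
    (Filter.Eventually.of_forall fun ε => (hf ε).aestronglyMeasurable)
    ((hf ε₀).intervalIntegrable _ _) hm.aestronglyMeasurable
    (Filter.Eventually.of_forall fun t ht ε hε => hC (ε, t) ⟨hε, uIoc_subset_uIcc ht⟩)
    intervalIntegrable_const
    (Filter.Eventually.of_forall fun t _ ε _ => hd ε t)).2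

/-! ### Derivatives of wedge products along curves -/

section WedgeDeriv

variable {E V W : Type*} [NormedAddCommGroup E] [NormedSpace ℝ E]
  [NormedAddCommGroup V] [NormedSpace ℝ V] [NormedAddCommGroup W] [NormedSpace ℝ W]

theorem hasDerivAt_factors {a c r : ℕ} {α : ℝ → E [⋀^Fin a]→L[ℝ] V} {β : ℝ → E [⋀^Fin c]→L[ℝ] V}
    {F : ℝ → E [⋀^Fin 2]→L[ℝ] V} {α' : E [⋀^Fin a]→L[ℝ] V} {β' : E [⋀^Fin c]→L[ℝ] V}
    {F' : E [⋀^Fin 2]→L[ℝ] V} {t : ℝ} (hα : HasDerivAt α α' t) (hβ : HasDerivAt β β' t)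
    (hF : HasDerivAt F F' t) :
    ∀ i : Fin r, HasDerivAt (fun s => factors (α s) (β s) (F s) i) (factors α' β' F' i) t
  | ⟨0, _⟩ => hα
  | ⟨1, _⟩ => hβ
  | ⟨_ + 2, _⟩ => hF

theorem continuous_factors {X : Type*} [TopologicalSpace X] {a c r : ℕ}
    {α : X → E [⋀^Fin a]→L[ℝ] V} {β : X → E [⋀^Fin c]→L[ℝ] V}
    {F : X → E [⋀^Fin 2]→L[ℝ] V} (hα : Continuous α) (hβ : Continuous β) (hF : Continuous F) :
    ∀ i : Fin r, Continuous (fun s => factors (α s) (β s) (F s) i)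
  | ⟨0, _⟩ => hα
  | ⟨1, _⟩ => hβ
  | ⟨_ + 2, _⟩ => hF

theorem continuous_wedge_factors {X : Type*} [TopologicalSpace X] {a c r N : ℕ}
    (h : ∑ i : Fin r, degs a c i = N)
    (P : ContinuousMultilinearMap ℝ (fun _ : Fin r => V) W)
    {α : X → E [⋀^Fin a]→L[ℝ] V} {β : X → E [⋀^Fin c]→L[ℝ] V}
    {F : X → E [⋀^Fin 2]→L[ℝ] V} (hα : Continuous α) (hβ : Continuous β) (hF : Continuous F) :
    Continuous fun s => wedge h P (factors (α s) (β s) (F s)) :=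
  (wedgeCM h P).cont.comp (continuous_pi (continuous_factors hα hβ hF))

theorem hasDerivAt_wedge {r N : ℕ} {p : Fin r → ℕ} (h : ∑ i, p i = N)
    (P : ContinuousMultilinearMap ℝ (fun _ : Fin r => V) W)
    {Z : ℝ → ∀ i, E [⋀^Fin (p i)]→L[ℝ] V} {Z' : ∀ i, E [⋀^Fin (p i)]→L[ℝ] V} {t : ℝ}
    (hZ : ∀ i, HasDerivAt (fun s => Z s i) (Z' i) t) :
    HasDerivAt (fun s => wedge h P (Z s))
      (∑ i, wedge h P (Function.update (Z t) i (Z' i))) t := by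
  have h1 := (HasFDerivAt.multilinear_comp (f := wedgeCM h P)
    (fun i => (hZ i).hasFDerivAt)).hasDerivAt
  refine h1.congr_deriv ?_
  rw [sum_apply]
  refine Finset.sum_congr rfl fun i _ => ?_
  change wedge h P (Function.update (Z t) i ((1 : ℝ) • Z' i)) = _
  rw [one_smul]

/-- The derivative of `⟨α F ⋯ F⟩` along a curve. -/
theorem hasDerivAt_wedge_factors [FiniteDimensional ℝ E] [FiniteDimensional ℝ V] {m a N : ℕ}
    (h : ∑ i : Fin (m + 2), degs a 2 i = N)
    (P : ContinuousMultilinearMap ℝ (fun _ : Fin (m + 2) => V) W)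
    (hP : ∀ (σ : Equiv.Perm (Fin (m + 2))) (v : Fin (m + 2) → V), P (fun i => v (σ i)) = P v)
    {α : ℝ → E [⋀^Fin a]→L[ℝ] V} {F : ℝ → E [⋀^Fin 2]→L[ℝ] V} {α' : E [⋀^Fin a]→L[ℝ] V}
    {F' : E [⋀^Fin 2]→L[ℝ] V} {t : ℝ} (hα : HasDerivAt α α' t) (hF : HasDerivAt F F' t) :
    HasDerivAt (fun s => wedge h P (factors (α s) (F s) (F s)))
      (wedge h P (factors α' (F t) (F t)) +
        (m + 1 : ℝ) • wedge h P (factors (α t) F' (F t))) t := by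
  refine (hasDerivAt_wedge h P (hasDerivAt_factors hα hF hF)).congr_deriv ?_
  rw [Fin.sum_univ_succ]
  refine congrArg₂ (· + ·) (congrArg (wedge h P) (update_factors_zero (α t) α' (F t) (F t))) ?_
  have h1 : ∀ l : Fin (m + 1), wedge h P (Function.update
      (factors (α t) (F t) (F t) : ∀ i : Fin (m + 2), E [⋀^Fin (degs a 2 i)]→L[ℝ] V) l.succ
      (factors α' F' F' l.succ)) = wedge h P (factors (α t) F' (F t)) := fun l =>
    wedge_factors_update_succ h P hP (α t) (F t) l _ F' (Fin.cases rfl (fun _ => rfl) l)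
  rw [Finset.sum_congr rfl fun l _ => h1 l, Finset.sum_const, Finset.card_univ, Fintype.card_fin,
    ← Nat.cast_smul_eq_nsmul ℝ]
  push_cast
  rfl

/-- The derivative of an integral of `⟨α F ⋯ F⟩`. -/
theorem hasDerivAt_integral_wedge_factors [FiniteDimensional ℝ E] [FiniteDimensional ℝ V]
    {m a N : ℕ} (h : ∑ i : Fin (m + 2), degs a 2 i = N)
    (P : ContinuousMultilinearMap ℝ (fun _ : Fin (m + 2) => V) W)
    (hP : ∀ (σ : Equiv.Perm (Fin (m + 2))) (v : Fin (m + 2) → V), P (fun i => v (σ i)) = P v)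
    {α : ℝ → E [⋀^Fin a]→L[ℝ] V} {α' : E [⋀^Fin a]→L[ℝ] V} {F F' : ℝ → ℝ → E [⋀^Fin 2]→L[ℝ] V}
    (hα : ∀ ε, HasDerivAt α α' ε) (hF : ∀ ε t, HasDerivAt (fun ε => F ε t) (F' ε t) ε)
    (cF : Continuous fun q : ℝ × ℝ => F q.1 q.2) (cF' : Continuous fun q : ℝ × ℝ => F' q.1 q.2)
    (ε₀ a b : ℝ) :
    HasDerivAt (fun ε => ∫ t in a..b, wedge h P (factors (α ε) (F ε t) (F ε t)))
      ((∫ t in a..b, wedge h P (factors α' (F ε₀ t) (F ε₀ t))) +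
        (m + 1 : ℝ) • ∫ t in a..b, wedge h P (factors (α ε₀) (F' ε₀ t) (F ε₀ t))) ε₀ := by
  have cα : Continuous α :=
    continuous_iff_continuousAt.2 fun ε => (hα ε).continuousAt
  have hi : ∀ ε : ℝ, Continuous fun t : ℝ => (ε, t) := fun ε => by fun_prop
  have cFε : ∀ ε, Continuous (F ε) := fun ε => cF.comp (hi ε)
  have cFε' : ∀ ε, Continuous (F' ε) := fun ε => cF'.comp (hi ε)
  have cαq : Continuous fun q : ℝ × ℝ => α q.1 := cα.comp continuous_fst
  let f : ℝ → ℝ → E [⋀^Fin N]→L[ℝ] W := fun ε t => wedge h P (factors (α ε) (F ε t) (F ε t))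
  let g : ℝ → ℝ → E [⋀^Fin N]→L[ℝ] W := fun ε t => wedge h P (factors α' (F ε t) (F ε t))
  let gF : ℝ → ℝ → E [⋀^Fin N]→L[ℝ] W := fun ε t =>
    wedge h P (factors (α ε) (F' ε t) (F ε t))
  have k0 : ∀ ε, Continuous (f ε) := fun ε =>
    continuous_wedge_factors h P continuous_const (cFε ε) (cFε ε)
  have k1 : Continuous fun q : ℝ × ℝ => g q.1 q.2 :=
    continuous_wedge_factors h P continuous_const cF cF
  have k1' : Continuous fun q : ℝ × ℝ => gF q.1 q.2 :=
    continuous_wedge_factors h P cαq cF' cF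
  have k3 : Continuous (g ε₀) := continuous_wedge_factors h P continuous_const (cFε ε₀) (cFε ε₀)
  have k3' : Continuous (gF ε₀) :=
    continuous_wedge_factors h P continuous_const (cFε' ε₀) (cFε ε₀)
  have k2 : ∀ ε t, HasDerivAt (fun ε => f ε t) (g ε t + (m + 1 : ℝ) • gF ε t) ε :=
    fun ε t => hasDerivAt_wedge_factors h P hP (hα ε) (hF ε t)
  refine (hasDerivAt_integral_of_continuous (f' := fun ε t => g ε t + (m + 1 : ℝ) • gF ε t)
    k0 (k1.add (k1'.const_smul (m + 1 : ℝ))) k2 ε₀ a b).congr_deriv ?_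
  refine (intervalIntegral.integral_add (k3.intervalIntegrable _ _)
    ((k3'.const_smul (m + 1 : ℝ)).intervalIntegrable _ _)).trans ?_
  exact congrArg _ (intervalIntegral.integral_smul (m + 1 : ℝ) (gF ε₀))

/-- A form of degree above the dimension vanishes. -/
theorem alternating_eq_zero_of_finrank_lt [FiniteDimensional ℝ E] {p : ℕ}
    (hp : Module.finrank ℝ E < p) (f : E [⋀^Fin p]→L[ℝ] V) : f = 0 := by
  ext v
  refine f.toAlternatingMap.map_linearDependent v fun hv => ?_
  have := hv.fintype_card_le_finrank
  rw [Fintype.card_fin] at this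
  omega

end WedgeDeriv

/-! ### The transgression formula -/

section Current

variable {E H M : Type*} [NormedAddCommGroup E] [NormedSpace ℝ E] [FiniteDimensional ℝ E]
  [TopologicalSpace H] {I : ModelWithCorners ℝ E H} [TopologicalSpace M] [ChartedSpace H M]
  {𝔤 : Type*} [NormedLieRing 𝔤] [NormedLieAlgebra 𝔤] [FiniteDimensional ℝ 𝔤]
  {m : ℕ} {P : ContinuousMultilinearMap ℝ (fun _ : Fin (m + 2) => 𝔤) ℂ}
  {A A' : Form E M 𝔤 1} {a : ℕ}

omit [FiniteDimensional ℝ E] [TopologicalSpace M] [FiniteDimensional ℝ 𝔤] in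
theorem interp_one (B B' : Form E M 𝔤 1) : interp B B' 1 = B := by
  rw [interp, one_smul, add_sub_cancel]

omit [FiniteDimensional ℝ E] [TopologicalSpace M] [FiniteDimensional ℝ 𝔤] in
theorem interp_zero (B B' : Form E M 𝔤 1) : interp B B' 0 = B' := by
  rw [interp, zero_smul, add_zero]

omit [FiniteDimensional ℝ E] [TopologicalSpace M] [FiniteDimensional ℝ 𝔤] in
theorem interp_add_smul (B B' C C' : Form E M 𝔤 1) (ε t : ℝ) :
    interp (B + ε • C) (B' + ε • C') t = interp B B' t + ε • interp C C' t := by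
  simp only [interp]
  module

variable [IsManifold I ∞ M]

omit [FiniteDimensional ℝ E] in
theorem isPolyFam_angle (hA : IsSmooth I A) (hA' : IsSmooth I A') {α : ℝ → Form E M 𝔤 a}
    (hα : IsPolyFam I α) :
    IsPolyFam I fun t x => angle P (α t x) ((A - A') x) (curvature I (interp A A' t) x) :=
  isPolyFam_wedge_factors _ P hα (isPolyFam_const (hA.sub hA')) (isPolyFam_interp hA hA').curvature

omit [FiniteDimensional ℝ E] in
theorem isPolyFam_angleCurv (hA : IsSmooth I A) (hA' : IsSmooth I A') {α : ℝ → Form E M 𝔤 a}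
    (hα : IsPolyFam I α) : IsPolyFam I fun t => angleCurv I P (α t) (interp A A' t) :=
  isPolyFam_wedge_factors _ P hα (isPolyFam_interp hA hA').curvature
    (isPolyFam_interp hA hA').curvature

omit [FiniteDimensional ℝ E] in
theorem isSmooth_angleInt (hA : IsSmooth I A) (hA' : IsSmooth I A') {α : ℝ → Form E M 𝔤 a}
    (hα : IsPolyFam I α) : IsSmooth I (angleInt I P α A A') :=
  (isPolyFam_angle hA hA' hα).isSmooth_intForm

omit [FiniteDimensional ℝ E] in
theorem isSmooth_angleCurv (hA : IsSmooth I A) {α : Form E M 𝔤 a} (hα : IsSmooth I α) :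
    IsSmooth I (angleCurv I P α A) :=
  isSmooth_wedge_factors _ P hα (isSmooth_curvature hA) (isSmooth_curvature hA)

/-- `d ⟨α Fⁿ⟩ = ⟨D_A α Fⁿ⟩`. -/
theorem extD_angleCurv (hP : IsInvariantSymmetric P) (hA : IsSmooth I A) {α : Form E M 𝔤 a}
    (hα : IsSmooth I α) :
    extD I (angleCurv I P α A) =
      (angleCurv I P (covD I A α) A : Form E M ℂ (2 * m + (a + 1 + 2))) := by
  funext x
  refine (extD_wedge_factors_curvature (sum_degs a 2 m)
    ((sum_degs (a + 1) 2 m).trans (by omega)) ((sum_degs a 3 m).trans (by omega)) P hP hA hα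
    (isSmooth_curvature hA) x).trans ?_
  rw [covD_curvature hA]
  exact (congrArg _ ((congrArg _ (wedge_factors_zero_right _ P _ _)).trans (smul_zero _))).trans
    (add_zero _)

/-- `d ⟨α θ Fⁿ⁻¹⟩ = ⟨D_A α θ Fⁿ⁻¹⟩ ± ⟨α D_A θ Fⁿ⁻¹⟩`. -/
theorem extD_angle (hP : IsInvariantSymmetric P) (hA : IsSmooth I A) {α : Form E M 𝔤 a}
    {θ : Form E M 𝔤 1} (hα : IsSmooth I α) (hθ : IsSmooth I θ) (x : M) :
    extD I (fun x => angle P (α x) (θ x) (curvature I A x)) x =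
      (angle P (covD I A α x) (θ x) (curvature I A x) :
          E [⋀^Fin (2 * m + (a + 1 + 1))]→L[ℝ] ℂ) +
        ((-1 : ℝ) ^ a) • angle P (α x) (covD I A θ x) (curvature I A x) :=
  extD_wedge_factors_curvature (sum_degs a 1 m)
    ((sum_degs (a + 1) 1 m).trans (by omega)) (sum_degs a 2 m) P hP hA hα hθ x

/-- The transgression formula for `∫₀¹ dt ⟨α_t θ F_tⁿ⁻¹⟩`. -/
theorem extD_angleInt (hP : IsInvariantSymmetric P) (hA : IsSmooth I A) (hA' : IsSmooth I A')
    {α : ℝ → Form E M 𝔤 a} {α' : Form E M 𝔤 a} (hα : IsPolyFam I α) (hα' : IsSmooth I α')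
    (hd : ∀ t x, HasDerivAt (fun t => α t x) (α' x) t) (x : M) :
    (m + 1 : ℝ) • extD I (angleInt I P α A A') x =
      ((m + 1 : ℝ) • angleInt I P (fun t => covD I (interp A A' t) (α t)) A A' x :
        E [⋀^Fin (2 * m + (a + 2))]→L[ℝ] ℂ) +
      ((-1 : ℝ) ^ a) • (angleCurv I P (α 1) A x - angleCurv I P (α 0) A' x -
        intForm (fun t => angleCurv I P α' (interp A A' t)) x) := by
  have hθ := hA.sub hA'
  have hi := isPolyFam_interp hA hA'
  have h1 : extD I (angleInt I P α A A') x = ∫ t in (0 : ℝ)..1, extD I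
      (fun x => angle P (α t x) ((A - A') x) (curvature I (interp A A' t) x)) x :=
    congrFun (isPolyFam_angle hA hA' hα).extD_intForm x
  -- A_t is the line through Ā with velocity θ, so the curvature F_t has derivative D_tθ.
  have h2 : ∀ t, HasDerivAt (fun t => angleCurv I P (α t) (interp A A' t) x)
      (angleCurv I P α' (interp A A' t) x + (m + 1 : ℝ) •
        angle P (α t x) (covD I (interp A A' t) (A - A') x) (curvature I (interp A A' t) x)) t :=
    fun t => hasDerivAt_wedge_factors _ P hP.symmetric (hd t x) (hasDerivAt_curvature hA' hθ t x)
  have c1 := (isPolyFam_angleCurv (P := P) hA hA' (isPolyFam_const hα')).continuous x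
  have c2 : Continuous fun t => angle P (α t x) (covD I (interp A A' t) (A - A') x)
      (curvature I (interp A A' t) x) :=
    continuous_wedge_factors _ P (hα.continuous x)
      ((hi.covD (isPolyFam_const hθ)).continuous x) (hi.curvature.continuous x)
  have c2' : Continuous fun t => (m + 1 : ℝ) • angle P (α t x)
      (covD I (interp A A' t) (A - A') x) (curvature I (interp A A' t) x) := c2.const_smul (m + 1 : ℝ)
  have c2'' : Continuous fun t => ((-1 : ℝ) ^ a) • angle P (α t x)
      (covD I (interp A A' t) (A - A') x) (curvature I (interp A A' t) x) := c2.const_smul ((-1 : ℝ) ^ a)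
  have c3 := (isPolyFam_angle (P := P) hA hA' (hi.covD hα)).continuous x
  -- The fundamental theorem of calculus; the endpoints t = 1 and t = 0 give the curvatures of A and
  -- Ā.
  have h3 := intervalIntegral.integral_eq_sub_of_hasDerivAt (fun t _ => h2 t)
    ((c1.add c2').intervalIntegrable 0 1)
  rw [intervalIntegral.integral_add (c1.intervalIntegrable _ _)
    (c2'.intervalIntegrable _ _), intervalIntegral.integral_smul,
    interp_one, interp_zero] at h3
  -- The covariant Leibniz rule for A_t at each t. It contains the same D_tθ term as the
  -- t-derivative above, and this term is then eliminated between the two.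
  have h4 : ∀ t, extD I (fun x => angle P (α t x) ((A - A') x) (curvature I (interp A A' t) x)) x
      = _ := fun t => extD_angle hP (hi.isSmooth t) (hα.isSmooth t) hθ x
  rw [h1]
  simp only [h4]
  rw [intervalIntegral.integral_add (c3.intervalIntegrable _ _)
    (c2''.intervalIntegrable _ _), intervalIntegral.integral_smul,
    ← h3, intForm, angleInt, intForm]
  module

end Current

/-! ### The variation of the lagrangian -/

section Variation

variable {E H M : Type*} [NormedAddCommGroup E] [NormedSpace ℝ E] [FiniteDimensional ℝ E]
  [TopologicalSpace H] {I : ModelWithCorners ℝ E H} [TopologicalSpace M] [ChartedSpace H M]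
  [IsManifold I ∞ M]
  {𝔤 : Type*} [NormedLieRing 𝔤] [NormedLieAlgebra 𝔤] [FiniteDimensional ℝ 𝔤]
  {m : ℕ} {P : ContinuousMultilinearMap ℝ (fun _ : Fin (m + 2) => 𝔤) ℂ}
  {A A' : Form E M 𝔤 1} (k : ℂ)

omit [FiniteDimensional ℝ E] [IsManifold I ∞ M] [TopologicalSpace M] [FiniteDimensional ℝ 𝔤] in
theorem hasDerivAt_interp (B B' : Form E M 𝔤 1) (t : ℝ) (x : M) :
    HasDerivAt (fun t => interp B B' t x) ((B - B') x) t := by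
  have := ((hasDerivAt_id t).smul_const ((B - B') x)).const_add (B' x)
  rw [one_smul] at this
  exact this

/-- The derivative of the integral of `⟨θ Fⁿ⟩` under a variation of the connections. -/
theorem hasDerivAt_intForm_angleCurv (hP : IsInvariantSymmetric P) (hA : IsSmooth I A)
    (hA' : IsSmooth I A') {B B' : Form E M 𝔤 1} (hB : IsSmooth I B) (hB' : IsSmooth I B') (x : M) :
    HasDerivAt (fun ε : ℝ => intForm (fun t => angleCurv I P ((A + ε • B) - (A' + ε • B'))
        (interp (A + ε • B) (A' + ε • B') t)) x)
      (intForm (fun t => angleCurv I P (B - B') (interp A A' t)) x +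
        (m + 1 : ℝ) • ∫ t in (0 : ℝ)..1, angle P ((A - A') x)
          (covD I (interp A A' t) (interp B B' t) x) (curvature I (interp A A' t) x)) 0 := by
  have hi := isPolyFam_interp hA hA'
  have hj := isPolyFam_interp hB hB'
  -- Interpolation is linear in the pair of connections, so for fixed t the varied connections
  -- interpolate to the line A_t + ε δA_t.
  let F : ℝ → ℝ → E [⋀^Fin 2]→L[ℝ] 𝔤 := fun ε t =>
    curvature I (interp A A' t + ε • interp B B' t) x
  let F' : ℝ → ℝ → E [⋀^Fin 2]→L[ℝ] 𝔤 := fun ε t =>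
    covD I (interp A A' t + ε • interp B B' t) (interp B B' t) x
  let α : ℝ → E [⋀^Fin 1]→L[ℝ] 𝔤 := fun ε => (A - A') x + ε • (B - B') x
  have e1 : ∀ ε t, angleCurv I P ((A + ε • B) - (A' + ε • B'))
      (interp (A + ε • B) (A' + ε • B') t) x = angle P (α ε) (F ε t) (F ε t) := by
    intro ε t
    have h1 : ((A + ε • B) - (A' + ε • B')) x = α ε := by
      simp only [α, Pi.add_apply, Pi.sub_apply, Pi.smul_apply]
      module
    rw [angleCurv, interp_add_smul, h1]
  have hbr : Continuous fun t : ℝ => formBracket (rfl : 1 + 1 = 2) (interp B B' t x)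
      (interp B B' t x) := (isPolyFam_formBracket rfl hj hj).continuous x
  have hF : Continuous fun q : ℝ × ℝ => F q.1 q.2 := by
    simp only [F, curvature_add_smul (hi.isSmooth _) (hj.isSmooth _)]
    exact (((hi.curvature.continuous x).comp continuous_snd).add
      (continuous_fst.smul (((hi.covD hj).continuous x).comp continuous_snd))).add
      (((continuous_fst.pow 2).div_const 2).smul (hbr.comp continuous_snd))
  have hF' : Continuous fun q : ℝ × ℝ => F' q.1 q.2 := by
    simp only [F', covD_add_smul]
    exact (((hi.covD hj).continuous x).comp continuous_snd).add
      (continuous_fst.smul (hbr.comp continuous_snd))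
  have hdα : ∀ ε, HasDerivAt α ((B - B') x) ε := by
    intro ε
    have := ((hasDerivAt_id ε).smul_const ((B - B') x)).const_add ((A - A') x)
    rw [one_smul] at this
    exact this
  have key := hasDerivAt_integral_wedge_factors (sum_degs 1 2 m) P hP.symmetric hdα
    (fun ε t => hasDerivAt_curvature (hi.isSmooth t) (hj.isSmooth t) ε x) hF hF' 0 0 1
  have h0 : ∀ t, F 0 t = curvature I (interp A A' t) x := fun t => by
    simp only [F, zero_smul, add_zero]
  have h0' : ∀ t, F' 0 t = covD I (interp A A' t) (interp B B' t) x := fun t => by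
    simp only [F', zero_smul, add_zero]
  have hα0 : α 0 = (A - A') x := by simp only [α, zero_smul, add_zero]
  change HasDerivAt (fun ε => ∫ t in (0 : ℝ)..1, angle P (α ε) (F ε t) (F ε t)) ((∫ t in (0 : ℝ)..1, angle P ((B - B') x) (F 0 t) (F 0 t)) + (m + 1 : ℝ) • ∫ t in (0 : ℝ)..1, angle P (α 0) (F' 0 t) (F 0 t)) 0 at key
  simp only [h0, h0', hα0] at key
  simp only [intForm, e1]
  exact key

theorem angle_swap_one_two (hP : IsInvariantSymmetric P) (α : E [⋀^Fin 1]→L[ℝ] 𝔤)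
    (β F : E [⋀^Fin 2]→L[ℝ] 𝔤) :
    angle P α β F = (angle P β α F : E [⋀^Fin (2 * m + (2 + 1))]→L[ℝ] ℂ) :=
  wedge_factors_swap_one_two _ _ P hP.symmetric α β F

/-- Separates the prefactor n(n+1)k into the complex factor of the lagrangian and the real factor n
that appears in the transgression formula. -/
theorem coeff_smul {W : Type*} [AddCommGroup W] [Module ℂ W] [Module ℝ W]
    [IsScalarTower ℝ ℂ W] (w : W) :
    ((m + 1 : ℂ) * (m + 2) * k) • w = ((m + 2 : ℂ) * k) • (m + 1 : ℝ) • w := by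
  have h : (m + 1 : ℂ) * (m + 2) * k = (m + 2 : ℂ) * k * algebraMap ℝ ℂ (m + 1) := by
    push_cast [Complex.coe_algebraMap]
    ring
  rw [h, mul_smul, algebraMap_smul]

/-- The variation of the transgression lagrangian. -/
theorem hasVariation_lagrangian (hP : IsInvariantSymmetric P) (hA : IsSmooth I A)
    (hA' : IsSmooth I A') {B B' : Form E M 𝔤 1} (hB : IsSmooth I B) (hB' : IsSmooth I B') :
    HasVariation I P k A A' B B'
      (bulk I P k A A' B B' + extD I (boundaryTerm I P k A A' B B')) := by
  intro x
  have hj := isPolyFam_interp hB hB'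
  have h1 := (hasDerivAt_intForm_angleCurv hP hA hA' hB hB' x).const_smul ((m + 2 : ℂ) * k)
  refine h1.congr_deriv ?_
  -- Here α_t = δA_t, whose t-derivative is δA - δĀ = δθ. Its degree is one, so the bracket of
  -- endpoint terms enters with a minus sign, and the integral with δθ is the one produced by
  -- varying θ.
  have h2 := extD_angleInt hP hA hA' hj (hB.sub hB') (hasDerivAt_interp B B') x
  rw [interp_one, interp_zero, pow_one] at h2
  -- Passing the one-form θ across the two-form D_tδA_t costs no sign.
  have h3 : ∫ t in (0 : ℝ)..1, angle P ((A - A') x)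
      (covD I (interp A A' t) (interp B B' t) x) (curvature I (interp A A' t) x) =
      angleInt I P (fun t => covD I (interp A A' t) (interp B B' t)) A A' x := by
    rw [angleInt, intForm]
    exact intervalIntegral.integral_congr fun t _ => angle_swap_one_two hP _ _ _
  have h4 : extD I (boundaryTerm I P k A A' B B') x =
      ((m + 2 : ℂ) * k) • (m + 1 : ℝ) • extD I (angleInt I P (interp B B') A A') x := by
    rw [boundaryTerm, extD_const_smul_complex _ (isSmooth_angleInt hA hA' hj), Pi.smul_apply,
      coeff_smul]
  rw [h3, Pi.add_apply, h4, bulk, Pi.smul_apply, ← smul_add]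
  refine congrArg _ ?_
  refine Eq.trans ?_ (congrArg _ h2.symm)
  change _ + (m + 1 : ℝ) • angleInt I P _ A A' x = (_ - _) + ((m + 1 : ℝ) • angleInt I P _ A A' x +
    (-1 : ℝ) • (_ - _ - _))
  module

end Variation

/-! ### Noether currents and their potentials -/

section Currents

variable {E H M : Type*} [NormedAddCommGroup E] [NormedSpace ℝ E] [FiniteDimensional ℝ E]
  [TopologicalSpace H] {I : ModelWithCorners ℝ E H} [TopologicalSpace M] [ChartedSpace H M]
  [IsManifold I ∞ M]
  {𝔤 : Type*} [NormedLieRing 𝔤] [NormedLieAlgebra 𝔤] [FiniteDimensional ℝ 𝔤]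
  {m : ℕ} {P : ContinuousMultilinearMap ℝ (fun _ : Fin (m + 2) => 𝔤) ℂ}
  {A A' : Form E M 𝔤 1} (k : ℂ)

/-! ### The bulk term -/

omit [FiniteDimensional ℝ E] [IsManifold I ∞ M] in
theorem angleCurv_add {a : ℕ} (α β : Form E M 𝔤 a) (A : Form E M 𝔤 1) :
    angleCurv I P (α + β) A = angleCurv I P α A + angleCurv I P β A :=
  funext fun _ => wedge_factors_add_left _ P _ _ _ _

omit [FiniteDimensional ℝ E] [IsManifold I ∞ M] in
theorem angleCurv_neg {a : ℕ} (α : Form E M 𝔤 a) (A : Form E M 𝔤 1) :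
    angleCurv I P (-α) A = -angleCurv I P α A :=
  funext fun _ => wedge_factors_neg_left _ P _ _ _

omit [FiniteDimensional ℝ E] [IsManifold I ∞ M] in
theorem bulk_add {a : ℕ} (α α' β β' : Form E M 𝔤 a) :
    bulk I P k A A' (α + β) (α' + β') = bulk I P k A A' α α' + bulk I P k A A' β β' := by
  rw [bulk, angleCurv_add, angleCurv_add, bulk, bulk, ← smul_add]
  congr 1
  abel

omit [FiniteDimensional ℝ E] [IsManifold I ∞ M] in
theorem bulk_neg {a : ℕ} (α α' : Form E M 𝔤 a) :
    bulk I P k A A' (-α) (-α') = -bulk I P k A A' α α' := by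
  rw [bulk, angleCurv_neg, angleCurv_neg, bulk, ← smul_neg]
  congr 1
  abel

omit [FiniteDimensional ℝ E] in
theorem isSmooth_bulk (hA : IsSmooth I A) (hA' : IsSmooth I A') {a : ℕ} {α α' : Form E M 𝔤 a}
    (hα : IsSmooth I α) (hα' : IsSmooth I α') : IsSmooth I (bulk I P k A A' α α') :=
  ((isSmooth_angleCurv hA hα).sub (isSmooth_angleCurv hA' hα')).const_smul_complex _

/-- Turns the derivative of the bulk part of a current into the bulk variation along covariant
derivatives, which is how the two cancel in the symmetry statements. -/
theorem extD_bulk (hP : IsInvariantSymmetric P) (hA : IsSmooth I A) (hA' : IsSmooth I A')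
    {a : ℕ} {α α' : Form E M 𝔤 a} (hα : IsSmooth I α) (hα' : IsSmooth I α') :
    extD I (bulk I P k A A' α α') =
      (bulk I P k A A' (covD I A α) (covD I A' α') : Form E M ℂ (2 * m + (a + 1 + 2))) := by
  have h1 := isSmooth_angleCurv (P := P) hA hα
  have h2 := isSmooth_angleCurv (P := P) hA' hα'
  rw [bulk, extD_const_smul_complex _ (h1.sub h2), extD_sub h1 h2, extD_angleCurv hP hA hα,
    extD_angleCurv hP hA' hα']
  rfl

omit [FiniteDimensional ℝ E] [IsManifold I ∞ M] in
-- The expression depends on the zero-form pointwise, so at each point the zero-form can be replaced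
-- by the constant with the same value there.
theorem FieldEquation.angleCurv_eq_zero (h : FieldEquation I P A) (f : Form E M 𝔤 0) :
    angleCurv I P f A = 0 := by
  funext x
  have h1 : f x = ContinuousAlternatingMap.constOfIsEmpty ℝ E (Fin 0) (f x ![]) := by
    ext v
    rw [Subsingleton.elim v ![]]
    rfl
  rw [angleCurv, h1]
  exact congrFun (h (f x ![])) x

omit [FiniteDimensional ℝ E] [IsManifold I ∞ M] in
theorem bulk_eq_zero_of_fieldEquation (h : FieldEquation I P A) (h' : FieldEquation I P A')
    (f f' : Form E M 𝔤 0) : bulk I P k A A' f f' = 0 := by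
  rw [bulk, h.angleCurv_eq_zero, h'.angleCurv_eq_zero, sub_zero, smul_zero]

/-! ### Linearity of the boundary term -/

omit [FiniteDimensional ℝ E] [IsManifold I ∞ M] in
theorem angleInt_congr {a : ℕ} {α β : ℝ → Form E M 𝔤 a} (h : ∀ t x, α t x = β t x) :
    angleInt I P α A A' = angleInt I P β A A' := by
  rw [show α = β from funext fun t => funext fun x => h t x]

omit [FiniteDimensional ℝ E] [IsManifold I ∞ M] in
theorem angleInt_neg {a : ℕ} (α : ℝ → Form E M 𝔤 a) :
    angleInt I P (fun t => -α t) A A' = -angleInt I P α A A' := by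
  funext x
  rw [Pi.neg_apply, angleInt, angleInt, intForm, intForm, ← intervalIntegral.integral_neg]
  exact intervalIntegral.integral_congr fun t _ => wedge_factors_neg_left _ P _ _ _

omit [FiniteDimensional ℝ E] in
theorem angleInt_add (hA : IsSmooth I A) (hA' : IsSmooth I A') {a : ℕ}
    {α β : ℝ → Form E M 𝔤 a} (hα : IsPolyFam I α) (hβ : IsPolyFam I β) :
    angleInt I P (fun t => α t + β t) A A' = angleInt I P α A A' + angleInt I P β A A' := by
  funext x
  rw [Pi.add_apply, angleInt, angleInt, angleInt, intForm, intForm, intForm,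
    ← intervalIntegral.integral_add ((isPolyFam_angle hA hA' hα).intervalIntegrable x 0 1)
      ((isPolyFam_angle hA hA' hβ).intervalIntegrable x 0 1)]
  exact intervalIntegral.integral_congr fun t _ => wedge_factors_add_left _ P _ _ _ _

omit [FiniteDimensional ℝ E] [IsManifold I ∞ M] in
theorem neg_boundaryTerm_neg {B : ℝ → Form E M 𝔤 1} {C C' : Form E M 𝔤 1}
    (h : ∀ t x, interp C C' t x = B t x) :
    -boundaryTerm I P k A A' (-C) (-C') =
      ((m + 1 : ℂ) * (m + 2) * k) • angleInt I P B A A' := by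
  have h1 : ∀ t x, interp (-C) (-C') t x = (-B t) x := fun t x => by
    rw [Pi.neg_apply, ← h t x]
    change -C' x + t • (-C x - -C' x) = -(C' x + t • (C x - C' x))
    module
  rw [boundaryTerm, angleInt_congr h1, angleInt_neg, smul_neg, neg_neg]

omit [FiniteDimensional ℝ E] in
theorem isSmooth_lagrangian (hA : IsSmooth I A) (hA' : IsSmooth I A') :
    IsSmooth I (lagrangian I P k A A') :=
  (isPolyFam_angleCurv hA hA' (isPolyFam_const (hA.sub hA'))).isSmooth_intForm.const_smul_complex _

/-! ### Gauge transformations -/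

omit [FiniteDimensional ℝ E] [IsManifold I ∞ M] in
-- The covariant derivative is affine in the connection, so it commutes with interpolation between
-- connections.
theorem interp_covD (Z : Form E M 𝔤 0) (t : ℝ) (x : M) :
    interp (covD I A Z) (covD I A' Z) t x = covD I (interp A A' t) Z x := by
  have h := covD_add_smul (I := I) A' (A - A') Z t x
  have h2 := covD_add_smul (I := I) A' (A - A') Z 1 x
  rw [one_smul, add_sub_cancel, one_smul] at h2
  refine Eq.trans ?_ h.symm
  change covD I A' Z x + t • (covD I A Z x - covD I A' Z x) = _
  rw [h2, add_sub_cancel_left]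

/-- The transgression formula for a family constant in t and of degree zero: the integral with the
t-derivative drops out and the endpoint terms are the bulk part. -/
theorem gaugeCurrent_eq (hP : IsInvariantSymmetric P) (hA : IsSmooth I A) (hA' : IsSmooth I A')
    {Z : Form E M 𝔤 0} (hZ : IsSmooth I Z) :
    gaugeCurrent I P k A A' Z =
      ((m + 1 : ℂ) * (m + 2) * k) • extD I (angleInt I P (fun _ => Z) A A') -
        bulk I P k A A' Z Z := by
  rw [gaugeCurrent, neg_boundaryTerm_neg k fun t x => interp_covD Z t x]
  funext x
  have h1 := extD_angleInt hP hA hA' (isPolyFam_const hZ) isSmooth_zero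
    (fun t x => hasDerivAt_const t (Z x)) x
  have h2 : intForm (fun t => angleCurv I P (0 : Form E M 𝔤 0) (interp A A' t)) x = 0 := by
    rw [intForm]
    refine (intervalIntegral.integral_congr fun t _ => ?_).trans intervalIntegral.integral_zero
    exact wedge_factors_zero_left _ P _ _
  rw [h2, pow_zero, one_smul, sub_zero] at h1
  rw [Pi.sub_apply, bulk, Pi.smul_apply, Pi.smul_apply, Pi.smul_apply,
    coeff_smul, coeff_smul, ← smul_sub]
  refine congrArg _ ?_
  rw [Pi.sub_apply]
  exact eq_sub_of_add_eq h1.symm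

/-- The variation of the lagrangian under a gauge transformation vanishes. -/
theorem hasVariation_gauge (hP : IsInvariantSymmetric P) (hA : IsSmooth I A)
    (hA' : IsSmooth I A') {Z : Form E M 𝔤 0} (hZ : IsSmooth I Z) :
    HasVariation I P k A A' (-covD I A Z) (-covD I A' Z) 0 := by
  have hD := isSmooth_covD hA hZ
  have hD' := isSmooth_covD hA' hZ
  have h := hasVariation_lagrangian k hP hA hA' hD.neg hD'.neg
  have hpot : IsSmooth I (angleInt I P (fun _ => Z) A A') :=
    isSmooth_angleInt hA hA' (isPolyFam_const hZ)
  have h1 : boundaryTerm I P k A A' (-covD I A Z) (-covD I A' Z) =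
      bulk I P k A A' Z Z -
        ((m + 1 : ℂ) * (m + 2) * k) • extD I (angleInt I P (fun _ => Z) A A') := by
    rw [← neg_neg (boundaryTerm I P k A A' _ _)]
    exact (congrArg _ (gaugeCurrent_eq k hP hA hA' hZ)).trans (neg_sub _ _)
  -- The boundary term is a bulk part minus an exact form. Its derivative is the bulk part along the
  -- covariant derivatives of Λ, which cancels the bulk variation.
  have h2 : bulk I P k A A' (-covD I A Z) (-covD I A' Z) +
      extD I (boundaryTerm I P k A A' (-covD I A Z) (-covD I A' Z)) = 0 := by
    rw [h1, extD_sub (isSmooth_bulk k hA hA' hZ hZ) (hpot.extD.const_smul_complex _),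
      extD_const_smul_complex _ hpot.extD, extD_extD hpot, smul_zero, sub_zero,
      extD_bulk k hP hA hA' hZ hZ, bulk_neg]
    exact neg_add_cancel _
  rwa [h2] at h

/-! ### Diffeomorphisms -/

/-- Contracting ½[α, α] hits either factor with equal result and gives [α(v), α], the negative of
[α, α(v)]. -/
theorem formBracket_curryLeft_add (α : E [⋀^Fin 1]→L[ℝ] 𝔤) (v : E) :
    formBracket (Nat.add_comm 1 0) α (α.curryLeft v) +
      (1 / 2 : ℝ) • (formBracket (Nat.add_comm 1 1) α α).curryLeft v = 0 := by
  ext u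
  have key0 : ∀ (w : E) (z : Fin 0 → E),
      ((adCLM 𝔤 (α.curryLeft w ![])).compContinuousAlternatingMap (α.curryLeft v)) z =
        ⁅α ![w], α ![v]⁆ := fun w z =>
    congrArg (fun q => ⁅α ![w], α (Matrix.vecCons v q)⁆) (Subsingleton.elim z ![])
  have key1 : ∀ (w : E) (z : Fin 1 → E),
      ((adCLM 𝔤 (α.curryLeft w ![])).compContinuousAlternatingMap α) z =
        ⁅α ![w], α ![z 0]⁆ := fun w z =>
    congrArg (fun q => ⁅α ![w], α q⁆) (funext fun i => by rw [Subsingleton.elim i 0]; rfl)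
  rw [ContinuousAlternatingMap.add_apply, ContinuousAlternatingMap.smul_apply,
    ContinuousAlternatingMap.curryLeft_apply_apply, formBracket_eq_alternatizeUncurryFin,
    formBracket_eq_alternatizeUncurryFin, ContinuousAlternatingMap.alternatizeUncurryFin_apply,
    ContinuousAlternatingMap.alternatizeUncurryFin_apply]
  simp only [Fin.sum_univ_succ, Fin.sum_univ_zero, adForm_apply, key0, key1, add_zero]
  change (-1 : ℤ) ^ 0 • ⁅α ![u 0], α ![v]⁆ + (1 / 2 : ℝ) • ((-1 : ℤ) ^ 0 • ⁅α ![v], α ![u 0]⁆ +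
    (-1 : ℤ) ^ 1 • ⁅α ![u 0], α ![v]⁆) = 0
  rw [← lie_skew (α ![v]) (α ![u 0]), pow_zero, pow_one, one_smul, one_smul, neg_one_smul]
  module

omit [IsManifold I ∞ M] in
/-- `£_ξ A = D_A I_ξ A + I_ξ F`. -/
theorem lieD_eq (ξ : ∀ x : M, TangentSpace I x) (A : Form E M 𝔤 1) :
    lieD I ξ A = covD I A (contract ξ A) + contract ξ (curvature I A) := by
  funext x
  have h := formBracket_curryLeft_add (A x) (ξ x)
  change extD I (contract ξ A) x + (extD I A x).curryLeft (ξ x) =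
    (extD I (contract ξ A) x + formBracket (Nat.add_comm 1 0) (A x) ((A x).curryLeft (ξ x))) +
      ((extD I A x).curryLeft (ξ x) +
        (1 / 2 : ℝ) • (formBracket (Nat.add_comm 1 1) (A x) (A x)).curryLeft (ξ x))
  rw [add_add_add_comm]
  exact ((congrArg _ h).trans (add_zero _)).symm

omit [FiniteDimensional ℝ E] [FiniteDimensional ℝ 𝔤] in
-- The Lie derivative is linear on smooth forms; smoothness enters because d is additive only for
-- differentiable forms.
theorem interp_lieD {ξ : ∀ x : M, TangentSpace I x}
    (hξ : ContMDiff I I.tangent ∞ (fun x => (⟨x, ξ x⟩ : TangentBundle I M)))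
    (hA : IsSmooth I A) (hA' : IsSmooth I A') (t : ℝ) :
    interp (lieD I ξ A) (lieD I ξ A') t = lieD I ξ (interp A A' t) := by
  have h1 : extD I (contract ξ (interp A A' t)) = extD I (contract ξ A') +
      t • (extD I (contract ξ A) - extD I (contract ξ A')) := by
    have c := isSmooth_contract hξ hA
    have c' := isSmooth_contract hξ hA'
    rw [← extD_sub c c', ← extD_const_smul, ← extD_add c' ((c.sub c').const_smul t)]
    rfl
  have h2 : contract ξ (extD I (interp A A' t)) = contract ξ (extD I A') +
      t • (contract ξ (extD I A) - contract ξ (extD I A')) := by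
    rw [interp, extD_add hA' ((hA.sub hA').const_smul t), extD_const_smul, extD_sub hA hA']
    rfl
  rw [interp, lieD, lieD, lieD, h1, h2]
  module

/-- The minus sign from contracting past α is cancelled by exchanging the one-forms α and F(v, ·),
which also brings the term into the order used in the boundary term. -/
theorem curryLeft_angle (hP : IsInvariantSymmetric P) (α : E [⋀^Fin 1]→L[ℝ] 𝔤)
    (F : E [⋀^Fin 2]→L[ℝ] 𝔤) (v : E) :
    ContinuousAlternatingMap.curryLeft (n := 2 * m + 2) (angle P α F F) v =
      angle P (α.curryLeft v) F F + (m + 1 : ℝ) • angle P (F.curryLeft v) α F := by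
  refine (curryLeft_wedge_one_two (sum_degs 1 2 m) (sum_degs 0 2 m) (sum_degs 1 1 m) P
    hP.symmetric α F v).trans ?_
  rw [wedge_factors_swap_one_one _ P hP.symmetric α, smul_neg, sub_neg_eq_add]
  rfl

theorem contract_intForm_angleCurv (hP : IsInvariantSymmetric P) {ξ : ∀ x : M, TangentSpace I x}
    (hξ : ContMDiff I I.tangent ∞ (fun x => (⟨x, ξ x⟩ : TangentBundle I M)))
    (hA : IsSmooth I A) (hA' : IsSmooth I A') (x : M) :
    contract (p := 2 * m + 2) ξ
        (intForm fun t => angleCurv I P (A - A') (interp A A' t)) x =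
      intForm (fun t => angleCurv I P (contract ξ (A - A')) (interp A A' t)) x +
        (m + 1 : ℝ) • angleInt I P (fun t => contract ξ (curvature I (interp A A' t))) A A' x := by
  have hθ := hA.sub hA'
  have c1 := isPolyFam_angleCurv (P := P) hA hA' (isPolyFam_const (isSmooth_contract hξ hθ))
  have c2 := (isPolyFam_angle (P := P) hA hA'
    ((isPolyFam_interp hA hA').curvature.contract hξ)).const_smul (m + 1 : ℝ)
  rw [IsPolyFam.contract_intForm ξ (isPolyFam_angleCurv hA hA' (isPolyFam_const hθ)),
    angleInt, intForm, intForm, intForm, ← intervalIntegral.integral_smul]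
  refine Eq.trans ?_ (intervalIntegral.integral_add (c1.intervalIntegrable x 0 1)
    (c2.intervalIntegrable x 0 1))
  let v : E := ξ x
  exact intervalIntegral.integral_congr fun t _ => curryLeft_angle hP _ _ v

/-- By £_ξA_t = D_t I_ξA_t + I_ξF_t, the boundary term splits in two. The part with I_ξF_t cancels
against the same part of I_ξL. What remains is the transgression formula for α_t = I_ξA_t, whose
t-derivative I_ξθ accounts for the rest of I_ξL. -/
theorem diffCurrent_eq (hP : IsInvariantSymmetric P) {ξ : ∀ x : M, TangentSpace I x}
    (hξ : ContMDiff I I.tangent ∞ (fun x => (⟨x, ξ x⟩ : TangentBundle I M)))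
    (hA : IsSmooth I A) (hA' : IsSmooth I A') :
    diffCurrent I P k A A' ξ =
      ((m + 1 : ℂ) * (m + 2) * k) •
          extD I (angleInt I P (fun t => contract ξ (interp A A' t)) A A') -
        bulk I P k A A' (contract ξ A) (contract ξ A') := by
  have hi := isPolyFam_interp hA hA'
  have hd : ∀ t x, HasDerivAt (fun t => contract ξ (interp A A' t) x)
      (contract ξ (A - A') x) t := fun t x => by
    have := ((hasDerivAt_id t).smul_const (contract ξ (A - A') x)).const_add (contract ξ A' x)
    rw [one_smul] at this
    exact this
  have h0 : angleInt I P (fun t => lieD I ξ (interp A A' t)) A A' =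
      angleInt I P (fun t => covD I (interp A A' t) (contract ξ (interp A A' t))) A A' +
        angleInt I P (fun t => contract ξ (curvature I (interp A A' t))) A A' := by
    simp only [lieD_eq]
    exact angleInt_add hA hA' (hi.covD (hi.contract hξ)) (hi.curvature.contract hξ)
  rw [diffCurrent, neg_boundaryTerm_neg k fun t x => congrFun (interp_lieD hξ hA hA' t) x, h0]
  funext x
  have h1 := extD_angleInt hP hA hA' (hi.contract hξ)
    (isSmooth_contract hξ (hA.sub hA')) hd x
  rw [pow_zero, one_smul, interp_one, interp_zero] at h1
  have h2 : contract ξ (lagrangian I P k A A') x = ((m + 2 : ℂ) * k) •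
      contract (p := 2 * m + 2) ξ
        (intForm fun t => angleCurv I P (A - A') (interp A A' t)) x := rfl
  rw [Pi.sub_apply, h2, contract_intForm_angleCurv hP hξ hA hA', Pi.sub_apply, bulk, Pi.smul_apply,
    Pi.smul_apply, Pi.smul_apply, coeff_smul, coeff_smul, ← smul_sub, ← smul_sub, Pi.add_apply,
    Pi.sub_apply]
  refine congrArg _ ?_
  refine Eq.trans ?_ (congrArg (· - _) h1.symm)
  generalize angleInt I P (fun t => covD I (interp A A' t) (contract ξ (interp A A' t))) A A' x = u
  generalize angleInt I P (fun t => contract ξ (curvature I (interp A A' t))) A A' x = v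
  generalize intForm (fun t => angleCurv I P (contract ξ (A - A')) (interp A A' t)) x = w
  change (m + 1 : ℝ) • (u + v) - (w + (m + 1 : ℝ) • v) =
    (m + 1 : ℝ) • u + (angleCurv I P (contract ξ A) A x - angleCurv I P (contract ξ A') A' x - w) -
      (angleCurv I P (contract ξ A) A x - angleCurv I P (contract ξ A') A' x)
  module

omit [IsManifold I ∞ M] in
/-- `⟨I_ξ F Fⁿ⟩` vanishes for degree reasons. -/
theorem angleCurv_contract_curvature (hP : IsInvariantSymmetric P)
    (hE : Module.finrank ℝ E = 2 * (m + 1) + 1) (ξ : ∀ x : M, TangentSpace I x) :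
    angleCurv I P (contract ξ (curvature I A)) A = 0 := by
  funext x
  -- The contraction of ⟨F^{n+1}⟩, a form of degree 2n + 2 in dimension 2n + 1, is n + 1 times the
  -- expression in question.
  have h := curryLeft_wedge_two_two ((sum_degs 2 2 m).trans (by omega)) (sum_degs 1 2 m) P
    hP.symmetric (curvature I A x) (ξ x)
  rw [alternating_eq_zero_of_finrank_lt (by omega) (wedge _ P _)] at h
  have h2 : (m + 2 : ℝ) ≠ 0 := by positivity
  exact (smul_eq_zero.1 h.symm).resolve_left h2

/-- The variation of the lagrangian under a diffeomorphism. -/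
theorem hasVariation_diff (hP : IsInvariantSymmetric P)
    (hE : Module.finrank ℝ E = 2 * (m + 1) + 1) {ξ : ∀ x : M, TangentSpace I x}
    (hξ : ContMDiff I I.tangent ∞ (fun x => (⟨x, ξ x⟩ : TangentBundle I M)))
    (hA : IsSmooth I A) (hA' : IsSmooth I A') :
    HasVariation I P k A A' (-lieD I ξ A) (-lieD I ξ A')
      (-extD I (contract ξ (lagrangian I P k A A'))) := by
  have hl : ∀ {B : Form E M 𝔤 1}, IsSmooth I B → IsSmooth I (lieD I ξ B) := fun hB =>
    (isSmooth_contract hξ hB).extD.add (isSmooth_contract hξ hB.extD)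
  have h := hasVariation_lagrangian k hP hA hA' (hl hA).neg (hl hA').neg
  have hc := isSmooth_contract hξ hA
  have hc' := isSmooth_contract hξ hA'
  have hpot : IsSmooth I (angleInt I P (fun t => contract ξ (interp A A' t)) A A') :=
    isSmooth_angleInt hA hA' ((isPolyFam_interp hA hA').contract hξ)
  have hιL : IsSmooth I (contract ξ (lagrangian I P k A A')) :=
    isSmooth_contract hξ (isSmooth_lagrangian k hA hA')
  have h1 : boundaryTerm I P k A A' (-lieD I ξ A) (-lieD I ξ A') =
      bulk I P k A A' (contract ξ A) (contract ξ A') -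
        ((m + 1 : ℂ) * (m + 2) * k) •
          extD I (angleInt I P (fun t => contract ξ (interp A A' t)) A A') -
        contract ξ (lagrangian I P k A A') := by
    have := diffCurrent_eq k hP hξ hA hA'
    rw [diffCurrent, sub_eq_iff_eq_add, neg_eq_iff_eq_neg] at this
    rw [this]
    abel
  -- Of the two parts of the Lie derivative, the contracted curvature contributes nothing to the
  -- bulk for degree reasons.
  have h2 : bulk I P k A A' (-lieD I ξ A) (-lieD I ξ A') =
      -bulk I P k A A' (covD I A (contract ξ A)) (covD I A' (contract ξ A')) := by
    rw [bulk_neg, lieD_eq, lieD_eq, bulk_add]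
    refine congrArg _ ((congrArg _ ?_).trans (add_zero _))
    rw [bulk, angleCurv_contract_curvature hP hE, angleCurv_contract_curvature hP hE, sub_zero,
      smul_zero]
  -- The covariant part of the bulk variation cancels the derivative of the bulk part of the
  -- boundary term, d² = 0 removes the potential, and only the exact form from I_ξL is left.
  have h3 : bulk I P k A A' (-lieD I ξ A) (-lieD I ξ A') +
      extD I (boundaryTerm I P k A A' (-lieD I ξ A) (-lieD I ξ A')) =
      -extD I (contract ξ (lagrangian I P k A A')) := by
    have e1 := isSmooth_bulk (P := P) k hA hA' hc hc'
    have e2 := hpot.extD.const_smul_complex ((m + 1 : ℂ) * (m + 2) * k)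
    rw [h1, h2, extD_sub (e1.sub e2) hιL, extD_sub e1 e2,
      extD_const_smul_complex _ hpot.extD, extD_extD hpot, smul_zero, sub_zero,
      extD_bulk k hP hA hA' hc hc', sub_eq_add_neg]
    exact neg_add_cancel_left _ _
  rwa [h3] at h

end Currents

end Transgression

theorem mainTheorem3 (m : ℕ)
    {E : Type*} [NormedAddCommGroup E] [NormedSpace ℝ E] (hE : Module.finrank ℝ E = 2 * (m + 1) + 1)
    {H : Type*} [TopologicalSpace H] (I : ModelWithCorners ℝ E H)
    {M : Type*} [TopologicalSpace M] [ChartedSpace H M] [IsManifold I ∞ M]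
    {𝔤 : Type*} [NormedLieRing 𝔤] [NormedLieAlgebra 𝔤]
    [FiniteDimensional ℝ 𝔤]
    (P : ContinuousMultilinearMap ℝ (fun _ : Fin (m + 2) => 𝔤) ℂ)
    (hP : IsInvariantSymmetric P) (k : ℂ)
    (A A' : Form E M 𝔤 1)
    (hA : IsSmooth I A) (hA' : IsSmooth I A') :
    -- `Θ` is the boundary term: `δL = (n + 1) k (⟨δA Fⁿ⟩ - ⟨δĀ F̄ⁿ⟩) + dΘ`
    (∀ δA δA' : Form E M 𝔤 1,
      IsSmooth I δA → IsSmooth I δA' →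
      HasVariation I P k A A' δA δA'
        (bulk I P k A A' δA δA' +
          extD I (boundaryTerm I P k A A' δA δA'))) ∧
    -- gauge transformations
    (∀ Λ : Form E M 𝔤 0, IsSmooth I Λ →
      HasVariation I P k A A'
        (-covD I A Λ) (-covD I A' Λ) 0 ∧
      IsSmooth I (angleInt I P (fun _ => Λ) A A') ∧
      gaugeCurrent I P k A A' Λ =
        ((m + 1 : ℂ) * (m + 2) * k) •
            extD I (angleInt I P (fun _ => Λ) A A') -
          bulk I P k A A' Λ Λ ∧
      (FieldEquation I P A → FieldEquation I P A' →
        gaugeCurrent I P k A A' Λ =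
          ((m + 1 : ℂ) * (m + 2) * k) •
            extD I (angleInt I P (fun _ => Λ) A A') ∧
        extD I (gaugeCurrent I P k A A' Λ) = 0)) ∧
    -- diffeomorphisms
    (∀ ξ : ∀ x : M, TangentSpace I x,
      ContMDiff I I.tangent ∞ (fun x => (⟨x, ξ x⟩ : TangentBundle I M)) →
      HasVariation I P k A A'
        (-lieD I ξ A) (-lieD I ξ A')
        (-extD I
          (contract ξ (lagrangian I P k A A'))) ∧
      IsSmooth I (angleInt I P
        (fun t => contract ξ (interp A A' t)) A A') ∧
      diffCurrent I P k A A' ξ =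
        ((m + 1 : ℂ) * (m + 2) * k) •
            extD I (angleInt I P
              (fun t => contract ξ (interp A A' t)) A A') -
          bulk I P k A A'
            (contract ξ A) (contract ξ A') ∧
      (FieldEquation I P A → FieldEquation I P A' →
        diffCurrent I P k A A' ξ =
          ((m + 1 : ℂ) * (m + 2) * k) •
            extD I (angleInt I P
              (fun t => contract ξ (interp A A' t)) A A') ∧
        extD I (diffCurrent I P k A A' ξ) = 0)) := by
  -- The rank of an infinite-dimensional space is 0 by convention, so a positive rank forces finite
  -- dimension.
  have : FiniteDimensional ℝ E := FiniteDimensional.of_finrank_pos (by omega)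
  refine ⟨fun δA δA' h h' => hasVariation_lagrangian k hP hA hA' h h', fun Λ hΛ => ?_,
    fun ξ hξ => ?_⟩
  · have hpot : IsSmooth I (angleInt I P (fun _ => Λ) A A') :=
      isSmooth_angleInt hA hA' (isPolyFam_const hΛ)
    have hJ := gaugeCurrent_eq k hP hA hA' hΛ
    refine ⟨hasVariation_gauge k hP hA hA' hΛ, hpot, hJ, fun h h' => ?_⟩
    -- On shell the bulk part of the current vanishes pointwise; conservation of the remaining exact
    -- form is d² = 0.
    rw [bulk_eq_zero_of_fieldEquation k h h', sub_zero] at hJ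
    refine ⟨hJ, ?_⟩
    rw [hJ, extD_const_smul_complex _ hpot.extD, extD_extD hpot, smul_zero]
  · have hpot : IsSmooth I (angleInt I P (fun t => contract ξ (interp A A' t)) A A') :=
      isSmooth_angleInt hA hA' ((isPolyFam_interp hA hA').contract hξ)
    have hJ := diffCurrent_eq k hP hξ hA hA'
    refine ⟨hasVariation_diff k hP hE hξ hA hA', hpot, hJ, fun h h' => ?_⟩
    rw [bulk_eq_zero_of_fieldEquation k h h', sub_zero] at hJ
    refine ⟨hJ, ?_⟩
    rw [hJ, extD_const_smul_complex _ hpot.extD, extD_extD hpot, smul_zero]
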